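/- For a large real number $T$ put $W=(\log\log\log T)^4$, $X=T^{1/(\log\log\log T)^2}$, $Y=T^{1/(\log\log T)^2}$ and $\sigma_0=\tfrac12+\frac{W}{\log T}$. For a positive integer $n$ let $a(n)=1$ if all prime factors of $n$ are at most $X$, and, counted with multiplicity, $n$ has at most $100\log\log T$ prime factors $p\le Y$ and at most $100\log\log\log T$ prime factors $p$ with $Y<p\le X$; let $a(n)=0$ otherwise. Let $\mu$ be the Möbius function and let $M(s)=\sum_{n\ge1}\mu(n)a(n)n^{-s}$ (a finite sum depending on $T$). Then, as $T\to\infty$, $$\int_T^{2T}\bigl|1-\zeta(\sigma_0+it)M(\sigma_0+it)\bigr|^2\,dt=o(T).$$ Consequently $\zeta(\sigma_0+it)M(\sigma_0+it)=1+o(1)$ for $t\in[T,2T]$ outside a set of measure $o(T)$; that is, there are measurable sets $E_T\subseteq[T,2T]$ of measure $o(T)$ and real numbers $\varepsilon_T\to0$ such that, for all large $T$, $|\zeta(\sigma_0+it)M(\sigma_0+it)-1|\le\varepsilon_T$ for every $t\in[T,2T]\setminus E_T$. -/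

import Mathlib

open Filter Topology Asymptotics MeasureTheory

noncomputable section

namespace SelbergCLT

/-- `log log T`. -/
def log₂ (T : ℝ) : ℝ := Real.log (Real.log T)

/-- `log log log T`. -/
def log₃ (T : ℝ) : ℝ := Real.log (Real.log (Real.log T))

/-- `W = (log log log T)^4`. -/
def W (T : ℝ) : ℝ := log₃ T ^ 4

/-- `X = T^{1/(log log log T)^2}`. -/
def X (T : ℝ) : ℝ := T ^ (1 / log₃ T ^ 2)

/-- `Y = T^{1/(log log T)^2}`. -/
def Y (T : ℝ) : ℝ := T ^ (1 / log₂ T ^ 2)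

/-- `σ₀ = 1/2 + W / log T`. -/
def σ₀ (T : ℝ) : ℝ := 1 / 2 + W T / Real.log T

/-- The number of prime factors `p` of `n` with `y < p ≤ x`, counted with multiplicity. -/
def bigOmegaBetween (y x : ℝ) (n : ℕ) : ℕ :=
  ∑ p ∈ n.primeFactors.filter (fun p : ℕ => y < (p : ℝ) ∧ (p : ℝ) ≤ x), n.factorization p

/-- The indicator function of the positive integers `n` all of whose prime factors are at most `X`,
with at most `100 log log T` prime factors up to `Y` and at most `100 log log log T` prime factors
between `Y` and `X`. -/
def a (T : ℝ) (n : ℕ) : ℂ :=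
  open Classical in
  if n ≠ 0 ∧ (∀ p ∈ n.primeFactors, (p : ℝ) ≤ X T) ∧
      (bigOmegaBetween 0 (Y T) n : ℝ) ≤ 100 * log₂ T ∧
      (bigOmegaBetween (Y T) (X T) n : ℝ) ≤ 100 * log₃ T
  then 1 else 0

/-- The mollifier `M(s) = ∑ μ(n) a(n) / n^s`. Only finitely many terms are nonzero, as
`finite_support_mollifier` shows. -/
def M (T : ℝ) (s : ℂ) : ℂ :=
  ∑' n : ℕ, (ArithmeticFunction.moebius n : ℂ) * a T n / (n : ℂ) ^ s

/-- The sum that defines the mollifier is a finite sum. -/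
theorem finite_support_mollifier (T : ℝ) (s : ℂ) :
    (Function.support fun n : ℕ =>
      (ArithmeticFunction.moebius n : ℂ) * a T n / (n : ℂ) ^ s).Finite := by
  refine (primorial ⌊X T⌋₊).divisors.finite_toSet.subset fun n hn => ?_
  have hn' : (ArithmeticFunction.moebius n : ℂ) * a T n / (n : ℂ) ^ s ≠ 0 := hn
  have hμ : ArithmeticFunction.moebius n ≠ 0 := by
    intro h
    simp [h] at hn'
  have ha : a T n ≠ 0 := by
    intro h
    simp [h] at hn'
  have hsq : Squarefree n := ArithmeticFunction.moebius_ne_zero_iff_squarefree.mp hμ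
  have hX : ∀ p ∈ n.primeFactors, (p : ℝ) ≤ X T := by
    by_contra h
    exact ha (if_neg fun h' => h h'.2.1)
  rw [Finset.mem_coe, Nat.mem_divisors]
  refine ⟨?_, (primorial_pos _).ne'⟩
  rw [← Nat.prod_primeFactors_of_squarefree hsq]
  refine Finset.prod_dvd_prod_of_subset _ _ _ fun p hp => ?_
  rw [Finset.mem_filter, Finset.mem_range]
  exact ⟨Nat.lt_succ_of_le (Nat.le_floor (hX p hp)), Nat.prime_of_mem_primeFactors hp⟩

/-- The mollified zeta function `t ↦ ζ(σ₀ + it) M(σ₀ + it)`. -/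
def zetaM (T t : ℝ) : ℂ :=
  riemannZeta ((σ₀ T : ℂ) + Complex.I * t) * M T ((σ₀ T : ℂ) + Complex.I * t)

end SelbergCLT

end

/-!
The mean square of `1 - ζ M` over `[T, 2T]` is bounded by elementary means, without moments of `ζ`.

In the critical strip `-ζ(s) / s` is the Mellin transform of the fractional part `{1 / t}`. Hence, for
a Dirichlet polynomial `M(s) = ∑ c_i d_i^{-s}`, the quotient `(1 - ζ(s) M(s)) / s` is the Mellin
transform, in the variable `1 / x`, of `S(x) = ∑ c_i {x / d_i} + 1_{x ≥ 1}`. The increment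
`S(x) - S(x e^{-1/T})` introduces the factor `1 - e^{-s/T}`, of constant size for `T ≤ Im s ≤ 2T`, so
Plancherel's theorem gives (`lintegral_one_sub_zeta_mul_sq_le`)
`∫_T^{2T} |1 - ζ M|² dt ≪ T² ∫_0^∞ |S(x) - S(x e^{-1/T})|² x^{-2σ-1} dx`.

* For `x < T` an interval `(x e^{-1/T}, x]` holds at most one integer `n`, and the increment sees just
  the coefficient `b(n) = ∑_{d_i ∣ n} c_i` of `ζ M`. This range costs
  `T (∑_{n ≥ 2} b(n)² n^{-2σ} + (∑ c_i / d_i)² T^{1-2σ})` (`lintegral_increment_Ioo_le`).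
* For `x ≥ T` the increments are replaced by additive ones and averaged over a window of length about
  `√T`. Two fractional parts with periods `d_i` and `d_j` correlate only through `gcd(d_i, d_j)`
  (`integral_fractIncrement_mul`), which leaves a quadratic form in the `c_i / d_i`. If `Q` bounds that
  form, this range costs `T Q T^{1-2σ} / (2σ - 1)`, up to a power saving for short polynomials
  (`lintegral_increment_Ici_le`).

For the mollifier, the indices are pairs of sets of primes, one set from each range, of bounded sizes.
Selberg's diagonalization of the form over the gcd (`gcdFormBound_of_prod`) makes `Q` a product of
two local factors. The first is of order `∏_{p ≤ Y} (1 - 1/p)`, at most `(log log T)² / log T`,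
because by Rankin's trick the truncation at `100 log log T` primes is harmless (`sieveForm_le`). The
second is at most a power of `log log T` (`sieveForm_le_exp`). The factor
`T^{1-2σ₀} = exp(-2 (log log log T)^4)` beats all these powers of `log log T`, so
`Q T^{1-2σ₀} / (2σ₀ - 1)` tends to `0`.

The coefficient `b(n)` is a product of two truncated alternating sums, each of which vanishes unless
`n` has no prime factor in the range or more of them than the truncation allows. So `∑ b(n)² n^{-2σ₀}`
is close to its term at `n = 1`: Rankin's trick handles the numbers with many prime factors, and the
numbers composed of primes above `X` contribute little, since
`∑_{p > X} p^{-2σ₀} ≪ 1 / ((2σ₀ - 1) log X)` and `(2σ₀ - 1) log X = 2 (log log log T)²`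
(`sum_divisorSum_sq_mul_rpow_le`). All sums over primes rest on Chebyshev's upper bound. The second
assertion follows from the first by Chebyshev's inequality.
-/


/-! ### The Mellin transform of the fractional part -/

open Set in
theorem riemannZeta_eq_mul_integral_floor {s : ℂ} (hs : 1 < s.re) :
    riemannZeta s = s * ∫ t in Ioi (1 : ℝ), (⌊t⌋₊ : ℂ) * (t : ℂ) ^ (-(s + 1)) := by
  have h := LSeries_eq_mul_integral' (1 : ℕ → ℂ) (r := 1) zero_le_one hs (by
    refine IsBigO.of_bound 1 (Eventually.of_forall fun n => ?_)
    simp)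
  rw [LSeries_one_eq_riemannZeta hs] at h
  rw [h]
  congr 1
  refine setIntegral_congr_fun measurableSet_Ioi fun t _ => ?_
  simp

/-- The fractional part of `1 / t`, cut off at `t ≤ 1`. -/
noncomputable def fractInvCut (t : ℝ) : ℂ := (Set.Ioc (0:ℝ) 1).indicator (fun t => ((Int.fract t⁻¹ : ℝ) : ℂ)) t

theorem norm_fract_inv_le (t : ℝ) : ‖((Int.fract t⁻¹ : ℝ) : ℂ)‖ ≤ 1 := by
  rw [Complex.norm_real, Real.norm_of_nonneg (Int.fract_nonneg _)]
  exact (Int.fract_lt_one _).le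

theorem measurable_fract_inv : Measurable fun t : ℝ => ((Int.fract t⁻¹ : ℝ) : ℂ) :=
  Complex.measurable_ofReal.comp (measurable_fract.comp measurable_inv)

theorem norm_fractInvCut_le (t : ℝ) : ‖fractInvCut t‖ ≤ 1 := by
  unfold fractInvCut
  by_cases h : t ∈ Set.Ioc (0:ℝ) 1
  · rw [Set.indicator_of_mem h]; exact norm_fract_inv_le t
  · rw [Set.indicator_of_notMem h]; simp

theorem locallyIntegrableOn_fractInvCut (s : Set ℝ) : LocallyIntegrableOn fractInvCut s := by
  refine LocallyIntegrable.locallyIntegrableOn ?_ s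
  refine LocallyIntegrable.mono (locallyIntegrable_const (1 : ℝ))
    (measurable_fract_inv.indicator measurableSet_Ioc).aestronglyMeasurable
    (Eventually.of_forall fun t => ?_)
  simpa using norm_fractInvCut_le t

theorem isBigO_rpow_zero_of_norm_le_one {f : ℝ → ℂ} (hf : ∀ t, ‖f t‖ ≤ 1) (l : Filter ℝ) :
    f =O[l] (fun t : ℝ => t ^ (-0 : ℝ)) := by
  refine IsBigO.of_bound 1 (Eventually.of_forall fun t => ?_)
  simpa using hf t

theorem isBigO_fractInvCut_atTop (a : ℝ) : fractInvCut =O[atTop] (fun t : ℝ => t ^ a) := by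
  refine IsBigO.of_bound 1 ?_
  filter_upwards [eventually_gt_atTop 1] with t ht
  have : fractInvCut t = 0 := Set.indicator_of_notMem (fun h => absurd h.2 (not_le.2 ht)) _
  rw [this, norm_zero]; positivity

theorem mellinConvergent_fractInvCut {s : ℂ} (hs : 0 < s.re) : MellinConvergent fractInvCut s :=
  mellinConvergent_of_isBigO_rpow (a := s.re + 1) (b := 0) (locallyIntegrableOn_fractInvCut _)
    (isBigO_fractInvCut_atTop _) (by linarith) (isBigO_rpow_zero_of_norm_le_one norm_fractInvCut_le _) hs

theorem differentiableAt_mellin_fractInvCut {s : ℂ} (hs : 0 < s.re) :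
    DifferentiableAt ℂ (mellin fractInvCut) s :=
  mellin_differentiableAt_of_isBigO_rpow (a := s.re + 1) (b := 0) (locallyIntegrableOn_fractInvCut _)
    (isBigO_fractInvCut_atTop _) (by linarith) (isBigO_rpow_zero_of_norm_le_one norm_fractInvCut_le _) hs

open Set in
theorem mellin_fractInvCut_of_one_lt_re {s : ℂ} (hs : 1 < s.re) :
    mellin fractInvCut s = 1 / (s - 1) - riemannZeta s / s := by
  have hs0 : s ≠ 0 := by rintro rfl; simp at hs; linarith
  have hfl : IntegrableOn (fun t : ℝ => (t : ℂ) ^ (-s)) (Ioi 1) :=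
    integrableOn_Ioi_cpow_of_lt (by simpa using hs) one_pos
  have hfr : IntegrableOn (fun t : ℝ => ((Int.fract t : ℝ) : ℂ) * (t : ℂ) ^ (-s - 1)) (Ioi 1) := by
    have := integrableOn_Ioi_cpow_of_lt (a := -s - 1) (c := 1) (by simp; linarith) one_pos
    refine Integrable.bdd_mul (c := 1) this
      (Complex.measurable_ofReal.comp measurable_fract).aestronglyMeasurable ?_
    refine Eventually.of_forall fun t => ?_
    rw [Complex.norm_real, Real.norm_of_nonneg (Int.fract_nonneg _)]
    exact (Int.fract_lt_one _).le
  have h1 : mellin fractInvCut s = ∫ t in Ioi (1:ℝ), ((Int.fract t : ℝ) : ℂ) * (t : ℂ) ^ (-s - 1) := by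
    have e : fractInvCut = fun t => (fun x => (Ici (1:ℝ)).indicator (fun x => ((Int.fract x : ℝ) : ℂ)) x) t⁻¹ := by
      ext t
      unfold fractInvCut
      by_cases h : t ∈ Ioc (0:ℝ) 1
      · have : t⁻¹ ∈ Ici (1:ℝ) := (one_le_inv₀ h.1).2 h.2
        rw [indicator_of_mem h]
        exact (indicator_of_mem this (fun x : ℝ => ((Int.fract x : ℝ) : ℂ))).symm
      · have : t⁻¹ ∉ Ici (1:ℝ) := by
          intro h2
          have h3 : (0:ℝ) < t := inv_pos.1 (lt_of_lt_of_le one_pos h2)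
          exact h ⟨h3, (one_le_inv₀ h3).1 h2⟩
        rw [indicator_of_notMem h]
        exact (indicator_of_notMem this (fun x : ℝ => ((Int.fract x : ℝ) : ℂ))).symm
    rw [e, mellin_comp_inv, mellin, ← integral_Ici_eq_integral_Ioi (x := (1:ℝ)),
      ← integral_indicator measurableSet_Ioi, ← integral_indicator measurableSet_Ici]
    congr 1
    ext x
    by_cases hx : x ∈ Ici (1:ℝ)
    · have : x ∈ Ioi (0:ℝ) := mem_Ioi.2 (lt_of_lt_of_le one_pos (mem_Ici.1 hx))
      rw [indicator_of_mem hx, indicator_of_mem this, indicator_of_mem hx, smul_eq_mul, mul_comm]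
    · rw [indicator_of_notMem hx]
      by_cases h0 : x ∈ Ioi (0:ℝ)
      · rw [indicator_of_mem h0, indicator_of_notMem hx, smul_zero]
      · rw [indicator_of_notMem h0]
  have h2 : ∫ t in Ioi (1 : ℝ), (⌊t⌋₊ : ℂ) * (t : ℂ) ^ (-(s + 1)) =
      (∫ t in Ioi (1 : ℝ), (t : ℂ) ^ (-s)) -
        ∫ t in Ioi (1:ℝ), ((Int.fract t : ℝ) : ℂ) * (t : ℂ) ^ (-s - 1) := by
    rw [← integral_sub hfl hfr]
    refine setIntegral_congr_fun measurableSet_Ioi fun t ht => ?_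
    have ht0 : (0:ℝ) < t := lt_trans one_pos ht
    have e1 : (t : ℂ) ^ (-s) = t * (t : ℂ) ^ (-s - 1) := by
      rw [Complex.cpow_sub _ _ (by exact_mod_cast ht0.ne'), Complex.cpow_one,
        mul_div_cancel₀ _ (by exact_mod_cast ht0.ne')]
    have e2 : (⌊t⌋₊ : ℂ) = t - ((Int.fract t : ℝ) : ℂ) := by
      have : (⌊t⌋₊ : ℝ) = t - Int.fract t := by
        rw [natCast_floor_eq_intCast_floor ht0.le, Int.self_sub_fract]
      exact_mod_cast congrArg (fun x : ℝ => (x : ℂ)) this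
    rw [e1, e2, show -(s + 1) = -s - 1 by ring]
    ring
  have h3 : ∫ t in Ioi (1 : ℝ), (t : ℂ) ^ (-s) = 1 / (s - 1) := by
    rw [integral_Ioi_cpow_of_lt (by simpa using hs) one_pos]
    have : s - 1 ≠ 0 := by intro h; rw [sub_eq_zero.1 h] at hs; simp at hs
    have : -s + 1 ≠ 0 := by intro h; apply this; linear_combination -h
    simp
    grind
  have h4 := riemannZeta_eq_mul_integral_floor hs
  rw [h2, h3, ← h1] at h4
  rw [h4]; field_simp; ring

/-- The Mellin transform of the cut-off fractional part in the right half-plane. Here `riemannZeta₀` is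
`ζ(s) - 1 / (s - 1)`, extended over `s = 1`, and the identity theorem continues the formula from
`Re s > 1`. -/
theorem mellin_fractInvCut {s : ℂ} (hs : 0 < s.re) :
    s * mellin fractInvCut s = 1 - riemannZeta₀ s := by
  have hopen : IsOpen {z : ℂ | 0 < z.re} := isOpen_lt continuous_const Complex.continuous_re
  have hf : AnalyticOnNhd ℂ (fun z => z * mellin fractInvCut z) {z : ℂ | 0 < z.re} := by
    refine DifferentiableOn.analyticOnNhd (fun z hz => ?_) hopen
    exact (differentiableAt_id.mul (differentiableAt_mellin_fractInvCut hz)).differentiableWithinAt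
  have hg : AnalyticOnNhd ℂ (fun z => 1 - riemannZeta₀ z) {z : ℂ | 0 < z.re} :=
    DifferentiableOn.analyticOnNhd
      ((differentiable_const 1).sub differentiable_riemannZeta₀).differentiableOn hopen
  have hconn : IsPreconnected {z : ℂ | 0 < z.re} :=
    (convex_halfSpace_re_gt 0).isPreconnected
  refine hf.eqOn_of_preconnected_of_eventuallyEq hg hconn (z₀ := 2) (by simp) ?_ hs
  have : {z : ℂ | 1 < z.re} ∈ 𝓝 (2 : ℂ) :=
    (isOpen_lt continuous_const Complex.continuous_re).mem_nhds (by simp)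
  filter_upwards [this] with z hz
  have hz0 : z ≠ 0 := by rintro rfl; simp at hz; linarith
  have hz1 : z ≠ 1 := by rintro rfl; simp at hz
  have hz1' : z - 1 ≠ 0 := sub_ne_zero.2 hz1
  rw [mellin_fractInvCut_of_one_lt_re hz, riemannZeta_eq_inv_sub_add hz1]
  field_simp
  ring

open Set in
theorem hasMellin_inv_Ioi {s : ℂ} (hs : s.re < 1) :
    HasMellin ((Ioi (1:ℝ)).indicator fun t : ℝ => ((t⁻¹ : ℝ) : ℂ)) s (1 / (1 - s)) := by
  have key : ∀ t ∈ Ioi (0:ℝ), (t : ℂ) ^ (s - 1) • (Ioi (1:ℝ)).indicator (fun t : ℝ => ((t⁻¹ : ℝ) : ℂ)) t =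
      (Ioi (1:ℝ)).indicator (fun t : ℝ => (t : ℂ) ^ (s - 2)) t := by
    intro t ht
    by_cases h : t ∈ Ioi (1:ℝ)
    · rw [indicator_of_mem h, indicator_of_mem h, show s - 2 = s - 1 - 1 by ring,
        Complex.cpow_sub (s - 1) 1 (by exact_mod_cast (ne_of_gt ht)), Complex.cpow_one]
      simp [div_eq_mul_inv]
    · rw [indicator_of_notMem h, indicator_of_notMem h, smul_zero]
  have hint : IntegrableOn (fun t : ℝ => (t : ℂ) ^ (s - 2)) (Ioi 1) :=
    integrableOn_Ioi_cpow_of_lt (by simp; linarith) one_pos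
  have hsub : Ioi (0:ℝ) ∩ Ioi 1 = Ioi 1 := inter_eq_right.2 (Ioi_subset_Ioi zero_le_one)
  constructor
  · rw [MellinConvergent, integrableOn_congr_fun key measurableSet_Ioi]
    rwa [integrableOn_indicator_iff measurableSet_Ioi, inter_comm, hsub]
  · rw [mellin, setIntegral_congr_fun measurableSet_Ioi key, setIntegral_indicator measurableSet_Ioi,
      hsub, integral_Ioi_cpow_of_lt (by simp; linarith) one_pos]
    have : (1 : ℂ) - s ≠ 0 := by
      intro h
      have := congrArg Complex.re h
      simp at this; linarith
    have h2 : s - 2 + 1 ≠ 0 := by intro h; apply this; linear_combination -h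
    simp
    grind

/-- In the critical strip `-ζ(s)/s` is the Mellin transform of the fractional part of `1 / t`. -/
theorem hasMellin_fract_inv {s : ℂ} (hs0 : 0 < s.re) (hs1 : s.re < 1) :
    HasMellin (fun t : ℝ => ((Int.fract t⁻¹ : ℝ) : ℂ)) s (-riemannZeta s / s) := by
  have hadd := hasMellin_add (mellinConvergent_fractInvCut hs0) (hasMellin_inv_Ioi hs1).1
  have hs : s ≠ 0 := by rintro rfl; simp at hs0
  have hs' : s ≠ 1 := by rintro rfl; simp at hs1
  have hs1' : s - 1 ≠ 0 := sub_ne_zero.2 hs'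
  have hs2' : 1 - s ≠ 0 := sub_ne_zero.2 hs'.symm
  have e : Set.EqOn (fun t : ℝ => fractInvCut t + (Set.Ioi (1:ℝ)).indicator (fun t : ℝ => ((t⁻¹ : ℝ) : ℂ)) t)
      (fun t : ℝ => ((Int.fract t⁻¹ : ℝ) : ℂ)) (Set.Ioi 0) := by
    intro t ht
    rw [Set.mem_Ioi] at ht
    simp only [fractInvCut]
    rcases le_or_gt t 1 with h | h
    · rw [Set.indicator_of_mem (show t ∈ Set.Ioc (0:ℝ) 1 from ⟨ht, h⟩), Set.indicator_of_notMem (by simpa using h),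
        add_zero]
    · rw [Set.indicator_of_notMem (fun h' => absurd h'.2 (not_le.2 h)),
        Set.indicator_of_mem (Set.mem_Ioi.2 h), zero_add]
      congr 1
      rw [eq_comm, Int.fract_eq_self]
      exact ⟨(inv_pos.2 ht).le, inv_lt_one_of_one_lt₀ h⟩
  have e' : Set.EqOn (fun t : ℝ => (t : ℂ) ^ (s - 1) • (fractInvCut t + (Set.Ioi (1:ℝ)).indicator (fun t : ℝ => ((t⁻¹ : ℝ) : ℂ)) t))
      (fun t : ℝ => (t : ℂ) ^ (s - 1) • ((Int.fract t⁻¹ : ℝ) : ℂ)) (Set.Ioi 0) := fun t ht => by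
    have := e ht
    simp only at this ⊢
    rw [this]
  constructor
  · exact (integrableOn_congr_fun e' measurableSet_Ioi).1 hadd.1
  · rw [mellin, ← setIntegral_congr_fun measurableSet_Ioi e']
    have h1 := hadd.2
    rw [mellin, (hasMellin_inv_Ioi hs1).2] at h1
    rw [h1]
    have h2 := mellin_fractInvCut hs0
    have h3 : mellin fractInvCut s = (1 - riemannZeta₀ s) / s := by
      rw [← h2]; field_simp
    rw [h3, riemannZeta_eq_inv_sub_add hs']
    field_simp
    ring

/-! ### Plancherel's theorem for Fourier and Mellin transforms -/

open scoped FourierTransform SchwartzMap in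
/-- Plancherel's theorem for the Fourier integral of a function in `L¹ ∩ L²`: the Fourier integral
represents the Fourier transform on `L²`. -/
theorem fourier_ae_eq_of_integrable_memLp {f : ℝ → ℂ} (h1 : Integrable f) (h2 : MemLp f 2) :
    𝓕 f =ᵐ[volume] (𝓕 (h2.toLp f) : Lp (α := ℝ) ℂ 2) := by
  have hc : Continuous (𝓕 f) := VectorFourier.fourierIntegral_continuous Real.continuous_fourierChar
    (by fun_prop) h1
  refine ae_eq_of_integral_contDiff_smul_eq (hc.locallyIntegrable) ?_ ?_
  · exact (Lp.memLp _).locallyIntegrable (by norm_num)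
  · intro g hg hgs
    have hgs' : HasCompactSupport (fun x => (g x : ℂ)) := hgs.comp_left (g := fun x : ℝ => (x : ℂ)) (by simp)
    have hg' : ContDiff ℝ ((⊤ : ℕ∞) : WithTop ℕ∞) (fun x => (g x : ℂ)) := Complex.ofRealCLM.contDiff.comp hg
    let φ : 𝓢(ℝ, ℂ) := hgs'.toSchwartzMap hg'
    have e1 := congrArg (fun D => D φ) (Lp.fourier_toTemperedDistribution_eq (h2.toLp f))
    simp only [TemperedDistribution.fourier_apply, Lp.toTemperedDistribution_apply] at e1
    have e2 : ∫ x, (𝓕 φ) x • (h2.toLp f) x = ∫ x, (𝓕 φ) x • f x := by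
      refine integral_congr_ae ?_
      filter_upwards [h2.coeFn_toLp] with x hx
      rw [hx]
    have e3 : ∫ x, (𝓕 (φ : ℝ → ℂ)) x • f x = ∫ x, φ x • (𝓕 f) x := by
      have := VectorFourier.integral_fourierIntegral_smul_eq_flip (L := innerₗ ℝ)
        Real.continuous_fourierChar (by fun_prop) (φ.integrable (μ := volume)) h1
      rw [flip_innerₗ] at this
      exact this
    rw [e2] at e1
    have e4 : ∀ h : ℝ → ℂ, ∫ x, φ x • h x = ∫ x, g x • h x := fun h => by
      refine integral_congr_ae (Eventually.of_forall fun x => ?_)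
      simp [φ]
    rw [← e4, ← e4, ← e1, ← e3]
    rfl

open scoped FourierTransform in
/-- Plancherel's theorem as an inequality, for integrable functions. -/
theorem lintegral_enorm_fourier_sq_le {f : ℝ → ℂ} (h1 : Integrable f) :
    ∫⁻ ξ, ‖𝓕 f ξ‖ₑ ^ 2 ≤ ∫⁻ x, ‖f x‖ₑ ^ 2 := by
  rcases eq_or_ne (∫⁻ x, ‖f x‖ₑ ^ 2) ⊤ with htop | htop
  · rw [htop]; exact le_top
  have hn : ∀ g : ℝ → ℂ, eLpNorm g 2 volume ^ 2 = ∫⁻ x, ‖g x‖ₑ ^ 2 := fun g => by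
    have := eLpNorm_nnreal_pow_eq_lintegral (f := g) (μ := volume) (p := 2) (by norm_num)
    have h2 : ((2 : NNReal) : ℝ) = ((2 : ℕ) : ℝ) := by norm_num
    simp only [h2, ENNReal.rpow_natCast] at this
    exact_mod_cast this
  have h2 : MemLp f 2 := by
    refine ⟨h1.aestronglyMeasurable, lt_top_iff_ne_top.2 fun h => htop ?_⟩
    rw [← hn, h]; simp
  rw [← hn, ← hn]
  have e1 : eLpNorm (𝓕 f) 2 volume = eLpNorm (𝓕 (h2.toLp f) : Lp (α := ℝ) ℂ 2 volume) 2 volume :=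
    eLpNorm_congr_ae (fourier_ae_eq_of_integrable_memLp h1 h2)
  have e2 : eLpNorm f 2 volume = eLpNorm (h2.toLp f) 2 volume := (eLpNorm_congr_ae h2.coeFn_toLp).symm
  have e3 := MeasureTheory.Lp.norm_fourier_eq (h2.toLp f)
  rw [e1, e2, ← Lp.enorm_def (μ := volume), ← Lp.enorm_def (μ := volume), ← ofReal_norm, ← ofReal_norm, e3]

open scoped FourierTransform in
/-- Parseval's inequality for the Mellin transform on a vertical line. -/
theorem lintegral_enorm_mellin_sq_le {f : ℝ → ℂ} {σ : ℝ} (hf : MellinConvergent f σ) :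
    ∫⁻ t : ℝ, ‖mellin f (σ + Complex.I * t)‖ₑ ^ 2 ≤
      ENNReal.ofReal (2 * Real.pi) *
        ∫⁻ x in Set.Ioi (0 : ℝ), ‖f x‖ₑ ^ 2 * ENNReal.ofReal (x ^ (2 * σ - 1)) := by
  have hderiv : ∀ x ∈ Set.univ, HasDerivWithinAt (fun u : ℝ => Real.exp (-u)) (-Real.exp (-x)) Set.univ x :=
    fun x _ => by simpa using (hasDerivAt_neg x).exp
  have hinj : Set.InjOn (fun u : ℝ => Real.exp (-u)) Set.univ := fun x _ y _ h => by
    simpa using h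
  have himage : (fun u : ℝ => Real.exp (-u)) '' Set.univ = Set.Ioi 0 := by
    ext y
    simp only [Set.image_univ, Set.mem_range, Set.mem_Ioi]
    constructor
    · rintro ⟨u, rfl⟩; positivity
    · intro hy; exact ⟨-Real.log y, by simp [Real.exp_log hy]⟩
  set g : ℝ → ℂ := fun u => Real.exp (-σ * u) • f (Real.exp (-u)) with hg
  have hgint : Integrable g := by
    rw [MellinConvergent, ← himage, integrableOn_image_iff_integrableOn_abs_deriv_smul
      MeasurableSet.univ hderiv hinj, integrableOn_univ] at hf
    refine hf.congr (Eventually.of_forall fun u => ?_)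
    have : ((Real.exp (-u) : ℝ) : ℂ) ^ ((σ : ℂ) - 1) = ((Real.exp (-u) ^ (σ - 1) : ℝ) : ℂ) := by
      rw [Complex.ofReal_cpow (Real.exp_pos _).le]; push_cast; rfl
    simp only [hg, this, abs_neg, abs_of_pos (Real.exp_pos _)]
    rw [← Real.exp_mul, smul_eq_mul, Complex.real_smul, Complex.real_smul, ← mul_assoc,
      ← Complex.ofReal_mul, ← Real.exp_add]
    congr 3; ring
  have h1 : ∀ t : ℝ, mellin f (σ + Complex.I * t) = 𝓕 g (t / (2 * Real.pi)) := fun t => by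
    rw [mellin_eq_fourier]
    simp [hg]
  have h2pi : (0:ℝ) < 2 * Real.pi := by positivity
  have h2 : ∫⁻ t : ℝ, ‖𝓕 g (t / (2 * Real.pi))‖ₑ ^ 2 =
      ENNReal.ofReal (2 * Real.pi) * ∫⁻ ξ : ℝ, ‖𝓕 g ξ‖ₑ ^ 2 := by
    have himg : (fun ξ : ℝ => ξ * (2 * Real.pi)) '' Set.univ = Set.univ := by
      rw [Set.image_univ, Set.range_eq_univ]
      intro y; exact ⟨y / (2 * Real.pi), by field_simp⟩
    have := lintegral_image_eq_lintegral_abs_deriv_mul (s := Set.univ)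
      (f := fun ξ : ℝ => ξ * (2 * Real.pi)) (f' := fun _ => 2 * Real.pi) MeasurableSet.univ
      (fun x _ => by simpa using (hasDerivAt_id x).mul_const (2 * Real.pi))
      (fun x _ y _ h => by simpa [h2pi.ne'] using h) (fun t => ‖𝓕 g (t / (2 * Real.pi))‖ₑ ^ 2)
    rw [himg] at this
    simp only [Measure.restrict_univ, abs_of_pos h2pi] at this
    rw [this, lintegral_const_mul']
    · congr 2; ext ξ; rw [mul_div_cancel_right₀ _ h2pi.ne']
    · exact ENNReal.ofReal_ne_top
  have h3 : ∫⁻ x in Set.Ioi (0 : ℝ), ‖f x‖ₑ ^ 2 * ENNReal.ofReal (x ^ (2 * σ - 1)) = ∫⁻ u, ‖g u‖ₑ ^ 2 := by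
    rw [← himage, lintegral_image_eq_lintegral_abs_deriv_mul MeasurableSet.univ hderiv hinj]
    rw [Measure.restrict_univ]
    refine lintegral_congr fun u => ?_
    simp only [hg, abs_neg, abs_of_pos (Real.exp_pos _)]
    rw [enorm_smul, mul_pow, Real.enorm_of_nonneg (Real.exp_pos _).le, mul_left_comm, mul_comm,
      ← ENNReal.ofReal_mul (Real.exp_pos _).le, ← ENNReal.ofReal_pow (Real.exp_pos _).le,
      ← Real.exp_mul, ← Real.exp_add, ← Real.exp_nat_mul]
    congr 3; push_cast; ring
  rw [h3]
  simp_rw [h1]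
  rw [h2]
  exact mul_le_mul_right (lintegral_enorm_fourier_sq_le hgint) _

/-! ### From the mean square of `1 - ζ M` to short intervals -/

section DirichletPolynomial

variable {ι : Type*}

/-- The Dirichlet polynomial `∑ c_i d_i^{-s}`. -/
noncomputable def dirichletPoly (B : Finset ι) (d : ι → ℕ) (c : ι → ℝ) (s : ℂ) : ℂ :=
  ∑ i ∈ B, (c i : ℂ) * ((d i : ℝ) : ℂ) ^ (-s)

/-- The weighted sum of fractional parts `∑ c_i {x / d_i}`. -/
noncomputable def fractSum (B : Finset ι) (d : ι → ℕ) (c : ι → ℝ) (x : ℝ) : ℝ :=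
  ∑ i ∈ B, c i * Int.fract (x / d i)

/-- The function `∑ c_i {x / d_i} + 1_{x ≥ 1}`. With `x = 1 / t`, its Mellin transform in `t` is
`(1 - ζ(s) M(s)) / s`. -/
noncomputable def fractSumStep (B : Finset ι) (d : ι → ℕ) (c : ι → ℝ) (x : ℝ) : ℝ :=
  fractSum B d c x + (Set.Ici (1 : ℝ)).indicator 1 x

variable {B : Finset ι} {d : ι → ℕ} {c : ι → ℝ}

theorem measurable_fractSum : Measurable (fractSum B d c) := by
  unfold fractSum
  exact Finset.measurable_sum _ fun i _ =>
    (measurable_fract.comp (measurable_id.div_const _)).const_mul _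

theorem hasMellin_fractSumStep_inv (hd : ∀ i ∈ B, 0 < d i) {s : ℂ} (hs0 : 0 < s.re) (hs1 : s.re < 1) :
    HasMellin (fun t : ℝ => ((fractSumStep B d c t⁻¹ : ℝ) : ℂ)) s
      ((1 - riemannZeta s * dirichletPoly B d c s) / s) := by
  have hs : s ≠ 0 := by rintro rfl; simp at hs0
  have hfr : HasMellin (fun t : ℝ => ((fractSum B d c t⁻¹ : ℝ) : ℂ)) s
      (-(riemannZeta s * dirichletPoly B d c s) / s) := by
    have hi : ∀ i ∈ B, HasMellin (fun t : ℝ => ((c i * Int.fract (t⁻¹ / d i) : ℝ) : ℂ)) s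
        (c i * (((d i : ℝ) : ℂ) ^ (-s) * (-riemannZeta s / s))) := fun i hi => by
      have hdi : (0 : ℝ) < d i := by exact_mod_cast hd i hi
      have h0 := hasMellin_fract_inv hs0 hs1
      have h1 : HasMellin (fun t : ℝ => ((Int.fract ((d i : ℝ) * t)⁻¹ : ℝ) : ℂ)) s
          (((d i : ℝ) : ℂ) ^ (-s) * (-riemannZeta s / s)) :=
        ⟨(MellinConvergent.comp_mul_left (f := fun t : ℝ => ((Int.fract t⁻¹ : ℝ) : ℂ)) hdi).2 h0.1,
          by rw [mellin_comp_mul_left (fun t : ℝ => ((Int.fract t⁻¹ : ℝ) : ℂ)) s hdi, h0.2, smul_eq_mul]⟩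
      have h2 := hasMellin_const_smul h1.1 (c i : ℂ)
      rw [h1.2] at h2
      simp only [smul_eq_mul] at h2
      refine Eq.mp ?_ h2
      congr 1
      ext t
      push_cast
      rw [mul_inv, div_eq_mul_inv, mul_comm (t⁻¹)]
    constructor
    · have : IntegrableOn (fun t : ℝ => ∑ i ∈ B, (t : ℂ) ^ (s - 1) • ((c i * Int.fract (t⁻¹ / d i) : ℝ) : ℂ))
          (Set.Ioi 0) := integrable_finsetSum _ fun i h => (hi i h).1
      refine this.congr (Eventually.of_forall fun t => ?_)
      simp only [fractSum]
      push_cast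
      rw [Finset.smul_sum]
    · have : ∑ i ∈ B, mellin (fun t : ℝ => ((c i * Int.fract (t⁻¹ / d i) : ℝ) : ℂ)) s =
          -(riemannZeta s * dirichletPoly B d c s) / s := by
        rw [Finset.sum_congr rfl fun i h => (hi i h).2, dirichletPoly, Finset.mul_sum,
          ← Finset.sum_neg_distrib, Finset.sum_div]
        refine Finset.sum_congr rfl fun i _ => ?_
        ring
      rw [← this]
      simp only [mellin]
      rw [← integral_finsetSum _ fun i h => (hi i h).1]
      refine integral_congr_ae (Eventually.of_forall fun t => ?_)
      simp only [fractSum]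
      push_cast
      rw [Finset.smul_sum]
  have hadd := hasMellin_add hfr.1 (hasMellin_one_Ioc hs0).1
  rw [hfr.2, (hasMellin_one_Ioc hs0).2] at hadd
  have key : ∀ t ∈ Set.Ioi (0:ℝ), ((fractSum B d c t⁻¹ : ℝ) : ℂ) + (Set.Ioc (0:ℝ) 1).indicator (fun _ => (1:ℂ)) t =
      ((fractSumStep B d c t⁻¹ : ℝ) : ℂ) := by
    intro t ht
    rw [Set.mem_Ioi] at ht
    rw [fractSumStep]
    by_cases h : t ≤ 1
    · rw [Set.indicator_of_mem (show t ∈ Set.Ioc (0:ℝ) 1 from ⟨ht, h⟩),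
        Set.indicator_of_mem (show t⁻¹ ∈ Set.Ici (1:ℝ) from (one_le_inv₀ ht).2 h)]
      simp
    · rw [Set.indicator_of_notMem (fun h' => h h'.2),
        Set.indicator_of_notMem (show t⁻¹ ∉ Set.Ici (1:ℝ) from fun h' => h ((one_le_inv₀ ht).1 h'))]
      simp
  refine ⟨?_, ?_⟩
  · refine (integrableOn_congr_fun (fun t ht => ?_) measurableSet_Ioi).1 hadd.1
    simp only
    rw [key t ht]
  · rw [mellin, ← setIntegral_congr_fun measurableSet_Ioi (fun t ht => ?_), ← mellin, hadd.2]
    · ring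
    · rw [key t ht]

/-- The Mellin transform of the increment of `fractSumStep` over `(x e^{-h}, x]`. -/
theorem hasMellin_fractSumStep_increment (hd : ∀ i ∈ B, 0 < d i) (h : ℝ) {s : ℂ} (hs0 : 0 < s.re)
    (hs1 : s.re < 1) :
    HasMellin (fun t : ℝ => ((fractSumStep B d c t⁻¹ - fractSumStep B d c (t⁻¹ * Real.exp (-h)) : ℝ) : ℂ)) s
      ((1 - Complex.exp (-h * s)) * ((1 - riemannZeta s * dirichletPoly B d c s) / s)) := by
  have h0 := hasMellin_fractSumStep_inv (c := c) hd hs0 hs1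
  have hp := Real.exp_pos h
  have h1 := hasMellin_sub h0.1
    ((MellinConvergent.comp_mul_left (f := fun t : ℝ => ((fractSumStep B d c t⁻¹ : ℝ) : ℂ)) hp).2 h0.1)
  rw [mellin_comp_mul_left (fun t : ℝ => ((fractSumStep B d c t⁻¹ : ℝ) : ℂ)) s hp, h0.2] at h1
  have e : (((Real.exp h : ℝ) : ℂ)) ^ (-s) = Complex.exp (-h * s) := by
    rw [Complex.cpow_def_of_ne_zero (by exact_mod_cast hp.ne'), ← Complex.ofReal_log hp.le, Real.log_exp]
    congr 1; ring
  rw [e, smul_eq_mul] at h1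
  have e2 : ∀ t : ℝ, (Real.exp h * t)⁻¹ = t⁻¹ * Real.exp (-h) := fun t => by
    rw [mul_inv, Real.exp_neg, mul_comm]
  simp only [e2] at h1
  rw [one_sub_mul]
  refine Eq.mp ?_ h1
  congr 1
  ext t
  push_cast
  rfl

/-- On the segment `T ≤ t ≤ 2T` the factor `(1 - e^{-s/T}) / s` has size about `1 / T`. -/
theorem one_le_norm_increment_factor {σ T t : ℝ} (hσ0 : 0 < σ) (hσ1 : σ < 1) (hT : 2 ≤ T)
    (ht : t ∈ Set.Icc T (2 * T)) :
    1 ≤ 12 * T * ‖(1 - Complex.exp (-(T⁻¹ : ℝ) * (σ + Complex.I * t))) / (σ + Complex.I * t)‖ := by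
  have hT0 : 0 < T := by linarith
  set s : ℂ := σ + Complex.I * t with hs
  have hre : s.re = σ := by simp [hs]
  have him : s.im = t := by simp [hs]
  have hs0 : s ≠ 0 := by
    intro h
    rw [h] at hre
    simp at hre; linarith
  have hnorm : ‖s‖ ≤ 3 * T := by
    have := Complex.norm_le_abs_re_add_abs_im s
    rw [hre, him, abs_of_pos hσ0, abs_of_nonneg (by linarith [ht.1])] at this
    linarith [ht.2]
  have hθ1 : 1 ≤ t * T⁻¹ := by rw [← div_eq_mul_inv, le_div_iff₀ hT0]; linarith [ht.1]
  have hθ2 : t * T⁻¹ ≤ 2 := by rw [← div_eq_mul_inv, div_le_iff₀ hT0]; linarith [ht.2]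
  -- As `1 ≤ t / T ≤ 2`, the point lies between `π / 6` and `5 π / 6`, where the sine is at least `1 / 2`.
  have hsin : 1 / 2 ≤ Real.sin (t * T⁻¹) := by
    have := Real.pi_gt_three
    have := Real.pi_lt_d2
    rw [← Real.sin_pi_div_six]
    rcases le_or_gt (t * T⁻¹) (Real.pi / 2) with h | h
    · exact Real.sin_le_sin_of_le_of_le_pi_div_two (by linarith) h (by linarith)
    · rw [← Real.sin_pi_sub (t * T⁻¹)]
      exact Real.sin_le_sin_of_le_of_le_pi_div_two (by linarith) (by linarith) (by linarith)
  have hexp : 1 / 2 ≤ Real.exp (-(T⁻¹ * σ)) := by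
    have h1 : T⁻¹ ≤ 1 / 2 := by rw [one_div]; exact inv_anti₀ (by norm_num) hT
    have h2 : T⁻¹ * σ ≤ 1 / 2 * 1 := mul_le_mul h1 hσ1.le hσ0.le (by norm_num)
    have := Real.add_one_le_exp (-(T⁻¹ * σ))
    linarith
  have himp : (1 - Complex.exp (-(T⁻¹ : ℝ) * s)).im = Real.exp (-(T⁻¹ * σ)) * Real.sin (t * T⁻¹) := by
    rw [Complex.sub_im, Complex.exp_im]
    simp [hre, him]
    rw [mul_comm t]
  have hnum : 1 / 4 ≤ ‖1 - Complex.exp (-(T⁻¹ : ℝ) * s)‖ := by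
    refine le_trans ?_ (Complex.abs_im_le_norm _)
    rw [himp]
    refine le_trans ?_ (le_abs_self _)
    nlinarith
  rw [norm_div, mul_div_assoc', le_div_iff₀ (norm_pos_iff.2 hs0)]
  nlinarith

/-- The mean square of `1 - ζ M` over `[T, 2T]` is controlled by the mean square of the increments
of `fractSumStep` over the short intervals `(x e^{-1/T}, x]`. -/
theorem lintegral_one_sub_zeta_mul_sq_le (hd : ∀ i ∈ B, 0 < d i) {σ T : ℝ} (hσ0 : 0 < σ) (hσ1 : σ < 1)
    (hT : 2 ≤ T) :
    ∫⁻ t in Set.Icc T (2 * T), ENNReal.ofReal (‖1 - riemannZeta (σ + Complex.I * t) *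
        dirichletPoly B d c (σ + Complex.I * t)‖ ^ 2) ≤
      ENNReal.ofReal (288 * Real.pi * T ^ 2) * ∫⁻ x in Set.Ioi (0 : ℝ),
        ENNReal.ofReal ((fractSumStep B d c x - fractSumStep B d c (x * Real.exp (-T⁻¹))) ^ 2
          * x ^ (-2 * σ - 1)) := by
  have hT0 : 0 < T := by linarith
  set F : ℝ → ℂ := fun t => ((fractSumStep B d c t⁻¹ - fractSumStep B d c (t⁻¹ * Real.exp (-T⁻¹)) : ℝ) : ℂ) with hF
  have hm : ∀ t : ℝ, HasMellin F (σ + Complex.I * t) ((1 - Complex.exp (-(T⁻¹ : ℝ) * (σ + Complex.I * t))) *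
      ((1 - riemannZeta (σ + Complex.I * t) * dirichletPoly B d c (σ + Complex.I * t)) / (σ + Complex.I * t))) :=
    fun t => hasMellin_fractSumStep_increment hd _ (by simpa using hσ0) (by simpa using hσ1)
  have hconv : MellinConvergent F σ := by simpa using (hm 0).1
  have h1 := lintegral_enorm_mellin_sq_le hconv
  have h2 : ∫⁻ x in Set.Ioi (0 : ℝ), ‖F x‖ₑ ^ 2 * ENNReal.ofReal (x ^ (2 * σ - 1)) =
      ∫⁻ x in Set.Ioi (0 : ℝ), ENNReal.ofReal ((fractSumStep B d c x -
        fractSumStep B d c (x * Real.exp (-T⁻¹))) ^ 2 * x ^ (-2 * σ - 1)) := by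
    have himg : (fun x : ℝ => x⁻¹) '' Set.Ioi 0 = Set.Ioi 0 := by
      ext y
      simp only [Set.mem_image, Set.mem_Ioi]
      exact ⟨by rintro ⟨x, hx, rfl⟩; exact inv_pos.2 hx, fun hy => ⟨y⁻¹, inv_pos.2 hy, inv_inv y⟩⟩
    conv_rhs => rw [← himg]
    rw [lintegral_image_eq_lintegral_abs_deriv_mul measurableSet_Ioi
      (fun x hx => (hasDerivAt_inv (ne_of_gt hx)).hasDerivWithinAt) inv_injective.injOn]
    refine setLIntegral_congr_fun measurableSet_Ioi fun x hx => ?_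
    have hx' : (0:ℝ) < x := hx
    simp only [hF]
    rw [← ofReal_norm, Complex.norm_real, ← ENNReal.ofReal_pow (norm_nonneg _), Real.norm_eq_abs, sq_abs,
      ← ENNReal.ofReal_mul (sq_nonneg _), ← ENNReal.ofReal_mul (abs_nonneg _), abs_neg,
      abs_of_pos (by positivity), mul_left_comm, Real.inv_rpow hx'.le, ← Real.rpow_neg hx'.le,
      ← Real.rpow_natCast x 2, ← Real.rpow_neg hx'.le, ← Real.rpow_add hx']
    congr 3
    push_cast
    ring
  rw [h2] at h1
  calc ∫⁻ t in Set.Icc T (2 * T), ENNReal.ofReal (‖1 - riemannZeta (σ + Complex.I * t) *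
        dirichletPoly B d c (σ + Complex.I * t)‖ ^ 2)
      ≤ ∫⁻ t in Set.Icc T (2 * T), ENNReal.ofReal ((12 * T) ^ 2) * ‖mellin F (σ + Complex.I * t)‖ₑ ^ 2 := by
        refine setLIntegral_mono' measurableSet_Icc fun t ht => ?_
        rw [← ofReal_norm, ← ENNReal.ofReal_pow (norm_nonneg _), ← ENNReal.ofReal_mul (by positivity)]
        refine ENNReal.ofReal_le_ofReal ?_
        rw [← mul_pow]
        refine pow_le_pow_left₀ (norm_nonneg _) ?_ 2
        have h3 := one_le_norm_increment_factor hσ0 hσ1 hT ht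
        rw [(hm t).2, mul_div_assoc', mul_div_right_comm, norm_mul, ← mul_assoc]
        exact le_mul_of_one_le_left (norm_nonneg _) h3
    _ ≤ ENNReal.ofReal ((12 * T) ^ 2) * ∫⁻ t : ℝ, ‖mellin F (σ + Complex.I * t)‖ₑ ^ 2 := by
        rw [lintegral_const_mul' _ _ ENNReal.ofReal_ne_top]
        exact mul_le_mul_right (setLIntegral_le_lintegral _ _) _
    _ ≤ _ := by
        refine (mul_le_mul_right h1 _).trans_eq ?_
        rw [← mul_assoc, ← ENNReal.ofReal_mul (by positivity)]
        congr 2; ring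

end DirichletPolynomial

/-! ### Short intervals that isolate single integers -/

section ShortIntervals

variable {ι : Type*}

/-- The coefficient of `n^{-s}` in `ζ(s) ∑ c_i d_i^{-s}`. -/
noncomputable def divisorSum (B : Finset ι) (d : ι → ℕ) (c : ι → ℝ) (n : ℕ) : ℝ :=
  ∑ i ∈ B with d i ∣ n, c i

variable {B : Finset ι} {d : ι → ℕ} {c : ι → ℝ}

theorem fractSum_eq_sub_sum_divisorSum {x : ℝ} (hx : 0 ≤ x) :
    fractSum B d c x = (∑ i ∈ B, c i / d i) * x - ∑ n ∈ Finset.Ioc 0 ⌊x⌋₊, divisorSum B d c n := by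
  have h1 : ∀ i ∈ B, (∑ n ∈ Finset.Ioc 0 ⌊x⌋₊, if d i ∣ n then c i else 0) = c i * (⌊x / d i⌋₊ : ℝ) := by
    intro i _
    rw [← Finset.sum_filter, Finset.sum_const, Nat.Ioc_filter_dvd_card_eq_div, ← Nat.floor_div_natCast,
      nsmul_eq_mul, mul_comm]
  have h2 : ∑ n ∈ Finset.Ioc 0 ⌊x⌋₊, divisorSum B d c n = ∑ i ∈ B, c i * (⌊x / d i⌋₊ : ℝ) := by
    rw [← Finset.sum_congr rfl h1, Finset.sum_comm]
    simp only [divisorSum, Finset.sum_filter]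
  rw [h2, fractSum, Finset.sum_mul, ← Finset.sum_sub_distrib]
  refine Finset.sum_congr rfl fun i _ => ?_
  have : (⌊x / d i⌋₊ : ℝ) = x / d i - Int.fract (x / d i) := by
    rw [natCast_floor_eq_intCast_floor (by positivity), Int.self_sub_fract]
  rw [this]; ring

theorem fractSumStep_eq_sub_sum_divisorSum (h1 : divisorSum B d c 1 = 1) {x : ℝ} (hx : 0 ≤ x) :
    fractSumStep B d c x =
      (∑ i ∈ B, c i / d i) * x - ∑ n ∈ Finset.Ioc 1 ⌊x⌋₊, divisorSum B d c n := by
  rw [fractSumStep, fractSum_eq_sub_sum_divisorSum hx]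
  by_cases h : 1 ≤ x
  · have hf : 1 ≤ ⌊x⌋₊ := Nat.one_le_floor_iff _ |>.2 h
    rw [Set.indicator_of_mem (Set.mem_Ici.2 h), ← Finset.insert_Ioc_add_one_left_eq_Ioc (Nat.lt_of_succ_le hf),
      Finset.sum_insert (by simp), zero_add, h1]
    simp
    ring
  · have hf : ⌊x⌋₊ = 0 := Nat.floor_eq_zero.2 (not_le.1 h)
    rw [Set.indicator_of_notMem (by simpa using h), hf]
    simp

/-- For `x < T` the interval `(x e^{-1/T}, x]` holds at most one integer. -/
theorem sq_fractSumStep_increment_le (h1 : divisorSum B d c 1 = 1) {T x : ℝ} (hT : 1 ≤ T)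
    (hx : x ∈ Set.Ioo 0 T) :
    (fractSumStep B d c x - fractSumStep B d c (x * Real.exp (-T⁻¹))) ^ 2 ≤
        2 * (∑ i ∈ B, c i / d i) ^ 2 * (x / T) ^ 2 ∨
      ∃ n : ℕ, 2 ≤ n ∧ x ∈ Set.Ico (n : ℝ) (n * Real.exp T⁻¹) ∧
        (fractSumStep B d c x - fractSumStep B d c (x * Real.exp (-T⁻¹))) ^ 2 ≤
        2 * (∑ i ∈ B, c i / d i) ^ 2 * (x / T) ^ 2 + 2 * divisorSum B d c n ^ 2 := by
  have hT0 : 0 < T := by linarith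
  set κ := ∑ i ∈ B, c i / d i
  set y := x * Real.exp (-T⁻¹) with hy
  have hy0 : 0 < y := mul_pos hx.1 (Real.exp_pos _)
  have hexp := Real.add_one_le_exp (-T⁻¹)
  have hexp1 : Real.exp (-T⁻¹) < 1 := by
    rw [← Real.exp_zero]; exact Real.exp_lt_exp.2 (by simpa using hT0)
  have hyx : y < x := by rw [hy]; exact mul_lt_of_lt_one_right hx.1 hexp1
  have hd1 : x - y ≤ x / T := by
    rw [hy, div_eq_mul_inv]; nlinarith [hx.1]
  have hd2 : x / T < 1 := (div_lt_one hT0).2 hx.2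
  have hsq : (κ * (x - y)) ^ 2 ≤ κ ^ 2 * (x / T) ^ 2 := by
    rw [mul_pow]
    exact mul_le_mul_of_nonneg_left (pow_le_pow_left₀ (by linarith) hd1 2) (sq_nonneg _)
  rw [fractSumStep_eq_sub_sum_divisorSum h1 hx.1.le, fractSumStep_eq_sub_sum_divisorSum h1 hy0.le]
  have hfl : ⌊y⌋₊ ≤ ⌊x⌋₊ := Nat.floor_le_floor hyx.le
  have hfl2 : ⌊x⌋₊ ≤ ⌊y⌋₊ + 1 := by
    have h3 := Nat.lt_floor_add_one y
    have h4 : x < ((⌊y⌋₊ + 2 : ℕ) : ℝ) := by push_cast; linarith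
    have := (Nat.floor_lt hx.1.le).2 h4
    omega
  rcases eq_or_lt_of_le hfl with he | he
  · left
    rw [he]
    have : κ * x - ∑ n ∈ Finset.Ioc 1 ⌊x⌋₊, divisorSum B d c n - (κ * y - ∑ n ∈ Finset.Ioc 1 ⌊x⌋₊, divisorSum B d c n)
        = κ * (x - y) := by ring
    rw [this]
    nlinarith [sq_nonneg (κ * (x - y))]
  · have he' : ⌊x⌋₊ = ⌊y⌋₊ + 1 := by omega
    by_cases h0 : ⌊y⌋₊ = 0
    · left
      rw [he', h0]
      simp only [zero_add, Finset.Ioc_self, Finset.sum_empty, sub_zero]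
      have : Finset.Ioc 1 0 = (∅ : Finset ℕ) := by simp
      rw [this, Finset.sum_empty, sub_zero, ← mul_sub]
      nlinarith [sq_nonneg (κ * (x - y))]
    · right
      refine ⟨⌊x⌋₊, by omega, ⟨Nat.floor_le hx.1.le, ?_⟩, ?_⟩
      · have h3 := Nat.lt_floor_add_one y
        have h4 : ((⌊y⌋₊ : ℝ) + 1) = (⌊x⌋₊ : ℝ) := by rw [he']; push_cast; rfl
        rw [h4, hy, Real.exp_neg, ← div_eq_mul_inv, div_lt_iff₀ (Real.exp_pos _)] at h3
        exact h3
      · rw [he', Finset.sum_Ioc_succ_top (by omega : 1 ≤ ⌊y⌋₊)]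
        set b := divisorSum B d c (⌊y⌋₊ + 1)
        set S := ∑ n ∈ Finset.Ioc 1 ⌊y⌋₊, divisorSum B d c n
        have : κ * x - (S + b) - (κ * y - S) = κ * (x - y) - b := by ring
        rw [this]
        nlinarith [sq_nonneg (κ * (x - y) + b)]

/-- The contribution of `x < T`, where the short intervals isolate single coefficients. -/
theorem lintegral_increment_Ioo_le (h1 : divisorSum B d c 1 = 1) {σ T E : ℝ} (hσ : σ ≤ 3 / 4) (hσ0 : 0 < σ)
    (hT : 1 ≤ T) (hE : ∀ N : ℕ, ∑ n ∈ Finset.Ico 2 N, divisorSum B d c n ^ 2 * (n : ℝ) ^ (-2 * σ) ≤ E) :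
    ∫⁻ x in Set.Ioo (0 : ℝ) T, ENNReal.ofReal ((fractSumStep B d c x -
        fractSumStep B d c (x * Real.exp (-T⁻¹))) ^ 2 * x ^ (-2 * σ - 1)) ≤
      ENNReal.ofReal (4 * (∑ i ∈ B, c i / d i) ^ 2 * T ^ (-2 * σ) + 4 * T⁻¹ * E) := by
  have hT0 : 0 < T := by linarith
  set κ := ∑ i ∈ B, c i / d i
  set β : ℕ → ℝ := fun n => if 2 ≤ n then divisorSum B d c n ^ 2 else 0 with hβ
  have hβ0 : ∀ n, 0 ≤ β n := fun n => by simp only [hβ]; split_ifs <;> positivity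
  have hpt : ∀ x ∈ Set.Ioo (0:ℝ) T, ENNReal.ofReal ((fractSumStep B d c x -
        fractSumStep B d c (x * Real.exp (-T⁻¹))) ^ 2 * x ^ (-2 * σ - 1)) ≤
      ENNReal.ofReal (2 * κ ^ 2 * T⁻¹ ^ 2 * x ^ (1 - 2 * σ)) +
      ∑' n : ℕ, (Set.Ico (n : ℝ) (n * Real.exp T⁻¹)).indicator
        (fun _ => ENNReal.ofReal (2 * β n * (n : ℝ) ^ (-2 * σ - 1))) x := by
    intro x hx
    have hx0 := hx.1
    have e1 : (2 * κ ^ 2 * (x / T) ^ 2) * x ^ (-2 * σ - 1) = 2 * κ ^ 2 * T⁻¹ ^ 2 * x ^ (1 - 2 * σ) := by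
      rw [show (1 - 2 * σ : ℝ) = (2 : ℕ) + (-2 * σ - 1) by push_cast; ring, Real.rpow_add hx0, Real.rpow_natCast]
      ring
    rcases sq_fractSumStep_increment_le h1 hT hx with h | ⟨n, hn, hxn, h⟩
    · refine le_add_right (ENNReal.ofReal_le_ofReal ?_)
      rw [← e1]
      gcongr
    · have hn0 : (0:ℝ) < n := by positivity
      have hle : (fractSumStep B d c x - fractSumStep B d c (x * Real.exp (-T⁻¹))) ^ 2 * x ^ (-2 * σ - 1) ≤
          2 * κ ^ 2 * T⁻¹ ^ 2 * x ^ (1 - 2 * σ) + 2 * β n * (n : ℝ) ^ (-2 * σ - 1) := by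
        have h2 : x ^ (-2 * σ - 1) ≤ (n : ℝ) ^ (-2 * σ - 1) :=
          Real.rpow_le_rpow_of_nonpos hn0 hxn.1 (by linarith)
        have h3 : β n = divisorSum B d c n ^ 2 := by simp [hβ, hn]
        rw [← e1, h3]
        calc _ ≤ (2 * κ ^ 2 * (x / T) ^ 2 + 2 * divisorSum B d c n ^ 2) * x ^ (-2 * σ - 1) := by gcongr
          _ = (2 * κ ^ 2 * (x / T) ^ 2) * x ^ (-2 * σ - 1) + 2 * divisorSum B d c n ^ 2 * x ^ (-2 * σ - 1) := by ring
          _ ≤ _ := by gcongr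
      refine (ENNReal.ofReal_le_ofReal hle).trans ?_
      rw [ENNReal.ofReal_add (by positivity) (by have := hβ0 n; positivity)]
      gcongr
      refine le_trans ?_ (ENNReal.le_tsum n)
      rw [Set.indicator_of_mem hxn]
  have hint1 : ∫⁻ x in Set.Ioo (0:ℝ) T, ENNReal.ofReal (2 * κ ^ 2 * T⁻¹ ^ 2 * x ^ (1 - 2 * σ)) ≤
      ENNReal.ofReal (4 * κ ^ 2 * T ^ (-2 * σ)) := by
    have hi : IntervalIntegrable (fun x : ℝ => x ^ (1 - 2 * σ)) volume 0 T :=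
      intervalIntegral.intervalIntegrable_rpow' (by linarith)
    have hi2 : IntegrableOn (fun x : ℝ => 2 * κ ^ 2 * T⁻¹ ^ 2 * x ^ (1 - 2 * σ)) (Set.Ioc 0 T) :=
      ((intervalIntegrable_iff_integrableOn_Ioc_of_le hT0.le).1 hi).const_mul _
    rw [← Measure.restrict_congr_set Ioo_ae_eq_Ioc.symm]
    rw [← ofReal_integral_eq_lintegral_ofReal hi2]
    · refine ENNReal.ofReal_le_ofReal ?_
      rw [← intervalIntegral.integral_of_le hT0.le, intervalIntegral.integral_const_mul,
        integral_rpow (Or.inl (by linarith)), Real.zero_rpow (by linarith), sub_zero]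
      have e2 : T ^ (1 - 2 * σ + 1) = T ^ 2 * T ^ (-2 * σ) := by
        rw [show (1 - 2 * σ + 1 : ℝ) = (2 : ℕ) + (-2 * σ) by push_cast; ring, Real.rpow_add hT0, Real.rpow_natCast]
      rw [e2, mul_div_assoc', div_le_iff₀ (by linarith)]
      have hp : 0 ≤ κ ^ 2 * T ^ (-2 * σ) := by positivity
      have : 2 * κ ^ 2 * T⁻¹ ^ 2 * (T ^ 2 * T ^ (-2 * σ)) = 2 * (κ ^ 2 * T ^ (-2 * σ)) := by field_simp
      rw [this]
      nlinarith
    · filter_upwards [ae_restrict_mem measurableSet_Ioc] with x hx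
      have := hx.1
      positivity
  have hint2 : ∫⁻ x in Set.Ioo (0:ℝ) T, ∑' n : ℕ, (Set.Ico (n : ℝ) (n * Real.exp T⁻¹)).indicator
        (fun _ => ENNReal.ofReal (2 * β n * (n : ℝ) ^ (-2 * σ - 1))) x ≤ ENNReal.ofReal (4 * T⁻¹ * E) := by
    rw [lintegral_tsum fun n => (measurable_const.indicator measurableSet_Ico).aemeasurable]
    have hE0 : 0 ≤ E := by simpa using hE 0
    have hexp : Real.exp T⁻¹ - 1 ≤ 2 * T⁻¹ := by
      have hT1 : |T⁻¹| ≤ 1 := by rw [abs_of_pos (by positivity)]; exact inv_le_one_of_one_le₀ hT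
      have := Real.abs_exp_sub_one_le hT1
      rw [abs_of_pos (by positivity : 0 < T⁻¹)] at this
      exact (le_abs_self _).trans this
    refine ENNReal.tsum_le_of_sum_range_le fun N => ?_
    have hterm : ∀ n ∈ Finset.range N, ∫⁻ x in Set.Ioo (0:ℝ) T, (Set.Ico (n : ℝ) (n * Real.exp T⁻¹)).indicator
        (fun _ => ENNReal.ofReal (2 * β n * (n : ℝ) ^ (-2 * σ - 1))) x ≤
        ENNReal.ofReal (4 * T⁻¹ * (β n * (n : ℝ) ^ (-2 * σ))) := by
      intro n _
      refine (setLIntegral_le_lintegral _ _).trans ?_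
      rw [lintegral_indicator_const measurableSet_Ico, Real.volume_Ico, ← ENNReal.ofReal_mul
        (by have := hβ0 n; positivity)]
      refine ENNReal.ofReal_le_ofReal ?_
      rcases Nat.eq_zero_or_pos n with rfl | hn
      · simp [hβ]
      have hn0 : (0:ℝ) < n := by exact_mod_cast hn
      have e3 : (n : ℝ) ^ (-2 * σ) = (n : ℝ) ^ (-2 * σ - 1) * n := by
        rw [Real.rpow_sub_one hn0.ne']; field_simp
      rw [e3]
      have hp : 0 ≤ β n * (n : ℝ) ^ (-2 * σ - 1) * n := by have := hβ0 n; positivity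
      nlinarith
    refine (Finset.sum_le_sum hterm).trans ?_
    rw [← ENNReal.ofReal_sum_of_nonneg fun n _ => by have := hβ0 n; positivity]
    refine ENNReal.ofReal_le_ofReal ?_
    rw [← Finset.mul_sum]
    refine mul_le_mul_of_nonneg_left ?_ (by positivity)
    refine le_trans (le_of_eq ?_) (hE N)
    rw [Finset.range_eq_Ico]
    have : Finset.Ico 2 N = (Finset.Ico 0 N).filter (fun n => 2 ≤ n) := by ext n; simp; omega
    rw [this, Finset.sum_filter]
    refine Finset.sum_congr rfl fun n _ => ?_
    simp only [hβ]; split_ifs <;> simp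
  have hE0 : 0 ≤ E := by simpa using hE 0
  refine (setLIntegral_mono' measurableSet_Ioo hpt).trans ?_
  rw [lintegral_add_left (by fun_prop), ENNReal.ofReal_add (by positivity) (by positivity)]
  exact add_le_add hint1 hint2

end ShortIntervals

/-! ### Correlations of increments of fractional parts -/

section PeriodicCorrelation

/-- The increment `{x / d} - {(x - y) / d}` of the `d`-periodic fractional part. -/
noncomputable def fractIncrement (d : ℕ) (y x : ℝ) : ℝ :=
  Int.fract (x / d) - Int.fract ((x - y) / d)

theorem measurable_fractIncrement (d : ℕ) (y : ℝ) : Measurable (fractIncrement d y) :=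
  (measurable_fract.comp (measurable_id.div_const _)).sub
    (measurable_fract.comp ((measurable_id.sub_const _).div_const _))

theorem abs_fractIncrement_le (d : ℕ) (y x : ℝ) : |fractIncrement d y x| ≤ 1 := by
  have h1 := Int.fract_nonneg (x / d)
  have h2 := Int.fract_lt_one (x / d)
  have h3 := Int.fract_nonneg ((x - y) / d)
  have h4 := Int.fract_lt_one ((x - y) / d)
  rw [fractIncrement, abs_le]
  constructor <;> linarith

theorem periodic_fract_div {d : ℕ} (hd : 0 < d) : Function.Periodic (fun x : ℝ => Int.fract (x / d)) d := by
  intro x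
  have : (d : ℝ) ≠ 0 := by positivity
  simp only
  rw [add_div, div_self this, Int.fract_add_one]

theorem periodic_fractIncrement {d : ℕ} (hd : 0 < d) (y : ℝ) :
    Function.Periodic (fractIncrement d y) d := by
  intro x
  have h1 := periodic_fract_div hd x
  have h2 := periodic_fract_div hd (x - y)
  simp only at h1 h2
  rw [fractIncrement, fractIncrement, h1, show x + d - y = x - y + d by ring, h2]

theorem sum_range_add_ediv {a : ℕ} (ha : 0 < a) (N : ℤ) :
    ∑ j ∈ Finset.range a, (N + j) / (a : ℤ) = N := by
  have ha' : (a : ℤ) ≠ 0 := by positivity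
  have hstep : ∀ N : ℤ, ∑ j ∈ Finset.range a, (N + 1 + j) / (a : ℤ) =
      ∑ j ∈ Finset.range a, (N + j) / (a : ℤ) + 1 := by
    intro N
    have h1 := Finset.sum_range_succ' (fun j : ℕ => (N + j) / (a : ℤ)) a
    have h2 := Finset.sum_range_succ (fun j : ℕ => (N + j) / (a : ℤ)) a
    rw [h2] at h1
    have h3 : (N + a) / (a : ℤ) = N / a + 1 := by
      rw [Int.add_ediv_of_dvd_right dvd_rfl, Int.ediv_self ha']
    have h4 : ∀ j : ℕ, N + 1 + (j : ℤ) = N + ((j + 1 : ℕ) : ℤ) := fun j => by push_cast; ring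
    simp only [h4]
    rw [h3] at h1
    simp only [Nat.cast_zero, add_zero] at h1
    linarith
  have h0 : ∑ j ∈ Finset.range a, ((0:ℤ) + j) / (a : ℤ) = 0 := by
    refine Finset.sum_eq_zero fun j hj => ?_
    rw [zero_add]
    exact Int.ediv_eq_zero_of_lt (by positivity) (by exact_mod_cast Finset.mem_range.1 hj)
  induction N using Int.induction_on with
  | zero => exact h0
  | succ n ih => rw [hstep, ih]
  | pred n ih =>
    have := hstep (-(n : ℤ) - 1)
    rw [sub_add_cancel, ih] at this
    linarith

/-- Hermite's identity in the form used for translates of the fractional part. -/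
theorem sum_range_floor_add_div {a : ℕ} (ha : 0 < a) (v : ℝ) :
    ∑ j ∈ Finset.range a, ⌊(v + j) / (a : ℝ)⌋ = ⌊v⌋ := by
  rw [← sum_range_add_ediv ha ⌊v⌋]
  refine Finset.sum_congr rfl fun j _ => ?_
  rw [Int.floor_div_natCast, Int.floor_add_natCast]

/-- The distribution relation: the translates by multiples of `g` of the increment with period `g a` add up
to the increment with period `g`. -/
theorem sum_range_fractIncrement {g a : ℕ} (hg : 0 < g) (ha : 0 < a) (y x : ℝ) :
    ∑ j ∈ Finset.range a, fractIncrement (g * a) y (x + j * g) = fractIncrement g y x := by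
  have hg' : (g : ℝ) ≠ 0 := by positivity
  have ha' : (a : ℝ) ≠ 0 := by positivity
  have h1 : ∀ j : ℕ, fractIncrement (g * a) y (x + j * g) =
      y / (g * a) - (⌊(x / g + j) / (a : ℝ)⌋ - ⌊((x - y) / g + j) / (a : ℝ)⌋ : ℝ) := by
    intro j
    have e1 : (x + j * g) / ((g * a : ℕ) : ℝ) = (x / g + j) / a := by push_cast; field_simp
    have e2 : (x + j * g - y) / ((g * a : ℕ) : ℝ) = ((x - y) / g + j) / a := by push_cast; field_simp; ring
    rw [fractIncrement, e1, e2, Int.fract, Int.fract]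
    field_simp
    ring
  simp only [h1]
  rw [Finset.sum_sub_distrib, Finset.sum_sub_distrib, ← Int.cast_sum, ← Int.cast_sum,
    sum_range_floor_add_div ha, sum_range_floor_add_div ha, fractIncrement, Int.fract, Int.fract,
    Finset.sum_const, Finset.card_range, nsmul_eq_mul]
  field_simp
  ring

/-- The Chinese remainder theorem as a factorization of sums of periodic functions. -/
theorem sum_range_mul_of_periodic {a b : ℕ} (ha : 0 < a) (hb : 0 < b) (hab : a.Coprime b) {u v : ℕ → ℝ}
    (hu : Function.Periodic u a) (hv : Function.Periodic v b) :
    ∑ k ∈ Finset.range (a * b), u k * v k =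
      (∑ i ∈ Finset.range a, u i) * ∑ j ∈ Finset.range b, v j := by
  rw [Finset.sum_mul_sum, ← Finset.sum_product']
  refine Finset.sum_nbij (fun k => (k % a, k % b)) ?_ ?_ ?_ ?_
  · intro k _
    simp [Nat.mod_lt _ ha, Nat.mod_lt _ hb]
  · intro k hk l hl h
    simp only [Prod.mk.injEq] at h
    have h1 : k ≡ l [MOD a * b] := (Nat.modEq_and_modEq_iff_modEq_mul hab).1 h
    simp only [Finset.coe_range, Set.mem_Iio] at hk hl
    exact Nat.ModEq.eq_of_lt_of_lt h1 hk hl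
  · rintro ⟨i, j⟩ hij
    simp only [Finset.coe_product, Finset.coe_range, Set.mem_prod, Set.mem_Iio] at hij
    obtain ⟨k, hk1, hk2⟩ := Nat.chineseRemainder hab i j
    refine ⟨k % (a * b), ?_, ?_⟩
    · simpa using Nat.mod_lt _ (Nat.mul_pos ha hb)
    · simp only [Nat.mod_mul_right_mod, Nat.mod_mul_left_mod]
      rw [Prod.mk.injEq]
      exact ⟨Eq.trans hk1 (Nat.mod_eq_of_lt hij.1), Eq.trans hk2 (Nat.mod_eq_of_lt hij.2)⟩
  · intro k _
    simp only [hu.map_mod_nat, hv.map_mod_nat]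

theorem intervalIntegrable_of_measurable_of_abs_le {f : ℝ → ℝ} (hf : Measurable f) {C : ℝ}
    (hC : ∀ x, |f x| ≤ C) (a b : ℝ) : IntervalIntegrable f volume a b := by
  refine (intervalIntegrable_const (c := C)).mono_fun hf.aestronglyMeasurable (Eventually.of_forall fun x => ?_)
  simp only [Real.norm_eq_abs]
  exact (hC x).trans (le_abs_self C)

/-- The correlation of two increments over a common period depends only on the gcd of the periods. -/
theorem integral_fractIncrement_mul {g a b : ℕ} (hg : 0 < g) (ha : 0 < a) (hb : 0 < b) (hab : a.Coprime b)
    (y : ℝ) :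
    ∫ x in (0:ℝ)..((g * (a * b) : ℕ) : ℝ), fractIncrement (g * a) y x * fractIncrement (g * b) y x =
      ∫ x in (0:ℝ)..(g : ℝ), fractIncrement g y x ^ 2 := by
  set F : ℝ → ℝ := fun x => fractIncrement (g * a) y x * fractIncrement (g * b) y x with hF
  have hFm : Measurable F := (measurable_fractIncrement _ _).mul (measurable_fractIncrement _ _)
  have hFb : ∀ x, |F x| ≤ 1 := fun x => by
    simp only [hF]
    rw [abs_mul]
    exact mul_le_one₀ (abs_fractIncrement_le _ _ _) (abs_nonneg _) (abs_fractIncrement_le _ _ _)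
  have hFi := intervalIntegrable_of_measurable_of_abs_le hFm hFb
  -- A common period splits into `a b` translates of `[0, g]`. The translates are numbered by residues
  -- mod `a b`, over which the product of the two increments sums to a product of sums.
  have h1 := intervalIntegral.sum_integral_adjacent_intervals (μ := volume) (f := F)
    (a := fun k : ℕ => (k : ℝ) * g) (n := a * b) (fun k _ => hFi _ _)
  have e0 : ((a * b : ℕ) : ℝ) * g = ((g * (a * b) : ℕ) : ℝ) := by push_cast; ring
  simp only [Nat.cast_zero, zero_mul, e0] at h1
  rw [← h1]
  have h2 : ∀ k : ℕ, ∫ x in ((k : ℝ) * g)..(((k + 1 : ℕ) : ℝ) * g), F x = ∫ x in (0:ℝ)..(g:ℝ), F (x + k * g) := by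
    intro k
    rw [intervalIntegral.integral_comp_add_right]
    congr 1 <;> push_cast <;> ring
  simp only [h2]
  have hFi' : ∀ k ∈ Finset.range (a * b), IntervalIntegrable (fun x => F (x + (k : ℝ) * g)) volume 0 g :=
    fun k _ => intervalIntegrable_of_measurable_of_abs_le (hFm.comp (measurable_id.add_const _))
      (fun x => hFb _) _ _
  rw [← intervalIntegral.integral_finsetSum hFi']
  refine intervalIntegral.integral_congr fun x _ => ?_
  simp only [hF]
  rw [sum_range_mul_of_periodic ha hb hab (u := fun k : ℕ => fractIncrement (g * a) y (x + k * g))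
    (v := fun k : ℕ => fractIncrement (g * b) y (x + k * g)), sum_range_fractIncrement hg ha,
    sum_range_fractIncrement hg hb, sq]
  · intro k
    have := periodic_fractIncrement (Nat.mul_pos hg ha) y (x + k * g)
    simp only
    rw [← this]
    congr 1; push_cast; ring
  · intro k
    have := periodic_fractIncrement (Nat.mul_pos hg hb) y (x + k * g)
    simp only
    rw [← this]
    congr 1; push_cast; ring

theorem integral_fractIncrement_eq_zero {g : ℕ} (hg : 0 < g) (y : ℝ) :
    ∫ x in (0:ℝ)..(g : ℝ), fractIncrement g y x = 0 := by
  have hm : Measurable fun x : ℝ => Int.fract (x / g) := measurable_fract.comp (measurable_id.div_const _)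
  have hb : ∀ x : ℝ, |Int.fract (x / g)| ≤ 1 := fun x => by
    rw [abs_of_nonneg (Int.fract_nonneg _)]; exact (Int.fract_lt_one _).le
  have hp := periodic_fract_div hg
  unfold fractIncrement
  have hi : IntervalIntegrable (fun x : ℝ => Int.fract ((x - y) / g)) volume 0 g :=
    intervalIntegrable_of_measurable_of_abs_le (hm.comp (measurable_id.sub_const y)) (fun x => hb _) _ _
  rw [intervalIntegral.integral_sub (intervalIntegrable_of_measurable_of_abs_le hm hb _ _) hi,
    intervalIntegral.integral_comp_sub_right (fun x : ℝ => Int.fract (x / g)) y, sub_eq_zero]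
  have := hp.intervalIntegral_add_eq 0 (0 - y)
  rw [zero_add] at this
  rw [this]
  congr 1; ring

theorem integral_fractIncrement_sq_le {g : ℕ} (hg : 0 < g) {y : ℝ} (hy : 0 ≤ y) :
    ∫ x in (0:ℝ)..(g : ℝ), fractIncrement g y x ^ 2 ≤ 2 * y := by
  have hg' : (0:ℝ) < g := by positivity
  have hm := measurable_fractIncrement g y
  have hb := abs_fractIncrement_le g y
  have hi := intervalIntegrable_of_measurable_of_abs_le hm hb 0 g
  -- The increment is at most `y / g`, at most `1` in size, and has mean zero, so its square is dominated by
  -- an affine function of it.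
  have hpt : ∀ x, fractIncrement g y x ^ 2 ≤ 2 * y / g - fractIncrement g y x := by
    intro x
    have h1 : fractIncrement g y x = y / g - (⌊x / g⌋ - ⌊(x - y) / g⌋ : ℝ) := by
      rw [fractIncrement, Int.fract, Int.fract]; ring
    have h2 : (⌊(x - y) / g⌋ : ℝ) ≤ ⌊x / g⌋ := by
      have : ⌊(x - y) / g⌋ ≤ ⌊x / g⌋ := Int.floor_le_floor (by gcongr; linarith)
      exact_mod_cast this
    have h3 : 0 ≤ y / g := by positivity
    have h4 : fractIncrement g y x ^ 2 ≤ |fractIncrement g y x| := by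
      rw [← sq_abs, sq]; exact mul_le_of_le_one_left (abs_nonneg _) (hb x)
    have h5 : |fractIncrement g y x| ≤ 2 * y / g - fractIncrement g y x := by
      rw [mul_div_assoc, abs_le]
      constructor <;> linarith
    exact h4.trans h5
  calc ∫ x in (0:ℝ)..(g : ℝ), fractIncrement g y x ^ 2
      ≤ ∫ x in (0:ℝ)..(g : ℝ), (2 * y / g - fractIncrement g y x) := by
        refine intervalIntegral.integral_mono hg'.le ?_ (intervalIntegrable_const.sub hi) hpt
        refine intervalIntegrable_of_measurable_of_abs_le (hm.pow_const 2) (C := 1) (fun x => ?_) _ _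
        rw [abs_pow]; exact pow_le_one₀ (abs_nonneg _) (hb x)
    _ = 2 * y := by
        rw [intervalIntegral.integral_sub intervalIntegrable_const hi, integral_fractIncrement_eq_zero hg,
          intervalIntegral.integral_const]
        simp
        field_simp

/-- The integral of a bounded periodic function over a long interval. -/
theorem abs_integral_periodic_sub_le {F : ℝ → ℝ} (hm : Measurable F) (hb : ∀ x, |F x| ≤ 1) {P : ℝ}
    (hP : 0 < P) (hp : Function.Periodic F P) (x : ℝ) {L : ℝ} (hL : 0 ≤ L) :
    |(∫ z in (0:ℝ)..L, F (x + z)) - L / P * ∫ z in (0:ℝ)..P, F z| ≤ 2 * P := by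
  have hFi := intervalIntegrable_of_measurable_of_abs_le hm hb
  set n := ⌊L / P⌋₊
  have hn1 : (n : ℝ) * P ≤ L := by
    rw [← le_div_iff₀ hP]; exact Nat.floor_le (by positivity)
  have hn2 : L < (n + 1) * P := by
    rw [← div_lt_iff₀ hP]; exact Nat.lt_floor_add_one _
  have h1 : ∫ z in (0:ℝ)..L, F (x + z) = (∫ z in x..(x + n * P), F z) + ∫ z in (x + n * P)..(x + L), F z := by
    rw [intervalIntegral.integral_comp_add_left, add_zero,
      intervalIntegral.integral_add_adjacent_intervals (hFi _ _) (hFi _ _)]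
  have h2 : ∫ z in x..(x + n * P), F z = n * ∫ z in (0:ℝ)..P, F z := by
    have := hp.intervalIntegral_add_zsmul_eq n x (fun _ _ => hFi _ _)
    simp only [natCast_zsmul, nsmul_eq_mul] at this
    rw [this, hp.intervalIntegral_add_eq x 0, zero_add]
  have h3 : |∫ z in (x + n * P)..(x + L), F z| ≤ P := by
    have := intervalIntegral.norm_integral_le_of_norm_le_const (f := F) (C := 1) (a := x + n * P) (b := x + L)
      (fun z _ => hb z)
    rw [Real.norm_eq_abs, one_mul, abs_of_nonneg (by linarith : 0 ≤ x + L - (x + n * P))] at this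
    linarith
  have h4 : |∫ z in (0:ℝ)..P, F z| ≤ P := by
    have := intervalIntegral.norm_integral_le_of_norm_le_const (f := F) (C := 1) (a := 0) (b := P)
      (fun z _ => hb z)
    rwa [Real.norm_eq_abs, one_mul, sub_zero, abs_of_pos hP] at this
  have h5 : |(L / P - n) * ∫ z in (0:ℝ)..P, F z| ≤ 1 * P := by
    rw [abs_mul]
    refine mul_le_mul ?_ h4 (abs_nonneg _) zero_le_one
    rw [abs_of_nonneg (by rw [sub_nonneg]; exact Nat.floor_le (by positivity))]
    have := Nat.lt_floor_add_one (L / P)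
    linarith
  rw [h1, h2]
  have e : (n * ∫ z in (0:ℝ)..P, F z) + (∫ z in (x + n * P)..(x + L), F z) - L / P * (∫ z in (0:ℝ)..P, F z) =
    (∫ z in (x + n * P)..(x + L), F z) - (L / P - n) * ∫ z in (0:ℝ)..P, F z := by ring
  rw [e]
  refine (abs_sub _ _).trans ?_
  linarith

end PeriodicCorrelation

/-! ### The variance over a window -/

section ShortIntervalVariance

variable {ι : Type*}

/-- `Q` bounds the quadratic form of the coefficients `c_i / d_i` against every function of the
greatest common divisor that lies between `0` and `Z` times the identity, relative to `Z`. The function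
to which it is applied is `e ↦ e ∫_0^e (fractIncrement e y x)² dx`, with `Z = 2 y`. -/
def GcdFormBound (B : Finset ι) (d : ι → ℕ) (c : ι → ℝ) (Q : ℝ) : Prop :=
  ∀ (G : ℕ → ℝ) (Z : ℝ), 0 ≤ Z → (∀ e, 0 < e → 0 ≤ G e ∧ G e ≤ e * Z) →
    ∑ i ∈ B, ∑ j ∈ B, c i / d i * (c j / d j) * G ((d i).gcd (d j)) ≤ Z * Q

variable {B : Finset ι} {d : ι → ℕ} {c : ι → ℝ}

/-- Over a window of length `L` the correlations of the increments are those over a full period, up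
to an error controlled by the periods. -/
theorem integral_sq_sum_fractIncrement_le (hd : ∀ i ∈ B, 0 < d i) {D N Q : ℝ} (hD : ∀ i ∈ B, (d i : ℝ) ≤ D)
    (hN : ∑ i ∈ B, |c i| ≤ N) (hQ : GcdFormBound B d c Q) {y L : ℝ} (hy : 0 ≤ y) (hL : 0 ≤ L) (x : ℝ) :
    ∫ z in (0:ℝ)..L, (∑ i ∈ B, c i * fractIncrement (d i) y (x + z)) ^ 2 ≤
      L * (2 * y * Q) + 2 * N ^ 2 * D ^ 2 := by
  set I : ℕ → ℝ := fun g => ∫ x in (0:ℝ)..(g : ℝ), fractIncrement g y x ^ 2 with hI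
  have hpair : ∀ i ∈ B, ∀ j ∈ B, |(∫ z in (0:ℝ)..L, fractIncrement (d i) y (x + z) * fractIncrement (d j) y (x + z)) -
      L * ((d i : ℝ)⁻¹ * (d j : ℝ)⁻¹ * (((d i).gcd (d j) : ℕ) * I ((d i).gcd (d j))))| ≤ 2 * D ^ 2 := by
    intro i hi j hj
    have hdi := hd i hi
    have hdj := hd j hj
    obtain ⟨g, a, b, hg0, hab, hda, hdb⟩ := Nat.exists_coprime' (m := d i) (n := d j) (Nat.gcd_pos_of_pos_left _ hdi)
    have ha : 0 < a := Nat.pos_of_ne_zero (by rintro rfl; simp at hda; omega)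
    have hb : 0 < b := Nat.pos_of_ne_zero (by rintro rfl; simp at hdb; omega)
    have hgcd : (d i).gcd (d j) = g := by
      rw [hda, hdb, Nat.gcd_mul_right, hab.gcd_eq_one, one_mul]
    have e1 : d i = g * a := by rw [hda, mul_comm]
    have e2 : d j = g * b := by rw [hdb, mul_comm]
    have hP : (0:ℝ) < ((g * (a * b) : ℕ) : ℝ) := by positivity
    have hp : Function.Periodic (fun z => fractIncrement (d i) y z * fractIncrement (d j) y z) ((g * (a * b) : ℕ) : ℝ) := by
      have h1 := (periodic_fractIncrement hdi y).nat_mul b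
      have h2 := (periodic_fractIncrement hdj y).nat_mul a
      have h1' : Function.Periodic (fractIncrement (d i) y) ((g * (a * b) : ℕ) : ℝ) := by
        rwa [show ((g * (a * b) : ℕ) : ℝ) = (b : ℝ) * (d i : ℝ) by rw [e1]; push_cast; ring]
      have h2' : Function.Periodic (fractIncrement (d j) y) ((g * (a * b) : ℕ) : ℝ) := by
        rwa [show ((g * (a * b) : ℕ) : ℝ) = (a : ℝ) * (d j : ℝ) by rw [e2]; push_cast; ring]
      exact h1'.mul h2'
    have hb' : ∀ z, |fractIncrement (d i) y z * fractIncrement (d j) y z| ≤ 1 := fun z => by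
      rw [abs_mul]
      exact mul_le_one₀ (abs_fractIncrement_le _ _ _) (abs_nonneg _) (abs_fractIncrement_le _ _ _)
    have h := abs_integral_periodic_sub_le ((measurable_fractIncrement (d i) y).mul
      (measurable_fractIncrement (d j) y)) hb' hP hp x hL
    have hint := integral_fractIncrement_mul hg0 ha hb hab y
    rw [← e1, ← e2] at hint
    simp only [Pi.mul_apply] at h
    rw [hint] at h
    have e3 : L / ((g * (a * b) : ℕ) : ℝ) = L * ((d i : ℝ)⁻¹ * (d j : ℝ)⁻¹ * g) := by
      rw [e1, e2]
      have : (g : ℝ) ≠ 0 := by positivity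
      have : (a : ℝ) ≠ 0 := by positivity
      have : (b : ℝ) ≠ 0 := by positivity
      push_cast
      field_simp
    have e4 : ((g * (a * b) : ℕ) : ℝ) ≤ D ^ 2 := by
      have h1 : (1:ℝ) ≤ g := by exact_mod_cast hg0
      have h2 : ((g * (a * b) : ℕ) : ℝ) ≤ (d i : ℝ) * d j := by
        rw [e1, e2]; push_cast
        have : (0:ℝ) ≤ g * (a * b) := by positivity
        nlinarith
      have h3 : (0:ℝ) ≤ d j := by positivity
      calc _ ≤ (d i : ℝ) * d j := h2
        _ ≤ D * D := mul_le_mul (hD i hi) (hD j hj) h3 (le_trans (by positivity) (hD i hi))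
        _ = D ^ 2 := by ring
    rw [hgcd]
    rw [e3] at h
    refine le_trans (le_of_eq ?_) (h.trans (by linarith))
    congr 1
    simp only [hI]; ring
  have hexp : ∫ z in (0:ℝ)..L, (∑ i ∈ B, c i * fractIncrement (d i) y (x + z)) ^ 2 =
      ∑ i ∈ B, ∑ j ∈ B, c i * c j * ∫ z in (0:ℝ)..L, fractIncrement (d i) y (x + z) * fractIncrement (d j) y (x + z) := by
    have hii : ∀ i j, IntervalIntegrable (fun z => c i * c j * (fractIncrement (d i) y (x + z) * fractIncrement (d j) y (x + z)))
        volume 0 L := fun i j => by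
      refine (intervalIntegrable_of_measurable_of_abs_le (C := 1) ?_ (fun z => ?_) _ _).const_mul _
      · exact ((measurable_fractIncrement _ _).comp (measurable_id.const_add x)).mul
          ((measurable_fractIncrement _ _).comp (measurable_id.const_add x))
      · rw [abs_mul]
        exact mul_le_one₀ (abs_fractIncrement_le _ _ _) (abs_nonneg _) (abs_fractIncrement_le _ _ _)
    simp only [← intervalIntegral.integral_const_mul]
    have e1 : ∀ i ∈ B, ∑ j ∈ B, ∫ z in (0:ℝ)..L, c i * c j * (fractIncrement (d i) y (x + z) * fractIncrement (d j) y (x + z)) =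
        ∫ z in (0:ℝ)..L, ∑ j ∈ B, c i * c j * (fractIncrement (d i) y (x + z) * fractIncrement (d j) y (x + z)) :=
      fun i _ => (intervalIntegral.integral_finsetSum fun j _ => hii i j).symm
    have hii' : ∀ i ∈ B, IntervalIntegrable (fun z => ∑ j ∈ B, c i * c j *
        (fractIncrement (d i) y (x + z) * fractIncrement (d j) y (x + z))) volume 0 L := fun i _ => by
      have h := IntervalIntegrable.sum B fun j _ => hii i j
      rwa [show (∑ j ∈ B, fun z => c i * c j * (fractIncrement (d i) y (x + z) * fractIncrement (d j) y (x + z))) =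
        fun z => ∑ j ∈ B, c i * c j * (fractIncrement (d i) y (x + z) * fractIncrement (d j) y (x + z)) by
          ext z; simp only [Finset.sum_apply]] at h
    rw [Finset.sum_congr rfl e1, ← intervalIntegral.integral_finsetSum hii']
    refine intervalIntegral.integral_congr fun z _ => ?_
    rw [sq, Finset.sum_mul_sum]
    refine Finset.sum_congr rfl fun i _ => Finset.sum_congr rfl fun j _ => ?_
    ring
  rw [hexp]
  have hform := hQ (fun e => e * I e) (2 * y) (by positivity) (fun e he => by
    have h1 : 0 ≤ I e := intervalIntegral.integral_nonneg (by positivity) fun x _ => sq_nonneg _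
    exact ⟨by positivity, mul_le_mul_of_nonneg_left (integral_fractIncrement_sq_le he hy) (by positivity)⟩)
  have hterm : ∀ i ∈ B, ∀ j ∈ B,
      c i * c j * ∫ z in (0:ℝ)..L, fractIncrement (d i) y (x + z) * fractIncrement (d j) y (x + z) ≤
      L * (c i / d i * (c j / d j) * (((d i).gcd (d j) : ℕ) * I ((d i).gcd (d j)))) + |c i| * |c j| * (2 * D ^ 2) := by
    intro i hi j hj
    have h := hpair i hi j hj
    set A := ∫ z in (0:ℝ)..L, fractIncrement (d i) y (x + z) * fractIncrement (d j) y (x + z)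
    set A' := L * ((d i : ℝ)⁻¹ * (d j : ℝ)⁻¹ * (((d i).gcd (d j) : ℕ) * I ((d i).gcd (d j))))
    have h1 : c i * c j * (A - A') ≤ |c i| * |c j| * (2 * D ^ 2) := by
      refine (le_abs_self _).trans ?_
      rw [abs_mul, abs_mul]
      exact mul_le_mul_of_nonneg_left h (by positivity)
    have h2 : L * (c i / d i * (c j / d j) * (((d i).gcd (d j) : ℕ) * I ((d i).gcd (d j)))) = c i * c j * A' := by
      simp only [A', div_eq_mul_inv]; ring
    rw [h2]
    linarith
  refine (Finset.sum_le_sum fun i hi => Finset.sum_le_sum fun j hj => hterm i hi j hj).trans ?_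
  simp only [Finset.sum_add_distrib]
  refine add_le_add ?_ ?_
  · simp only [← Finset.mul_sum]
    exact mul_le_mul_of_nonneg_left hform hL
  · have e : ∑ i ∈ B, ∑ j ∈ B, |c i| * |c j| * (2 * D ^ 2) = (∑ i ∈ B, |c i|) ^ 2 * (2 * D ^ 2) := by
      rw [sq (∑ i ∈ B, |c i|), Finset.sum_mul_sum, Finset.sum_mul]
      refine Finset.sum_congr rfl fun i _ => ?_
      rw [Finset.sum_mul]
    rw [e]
    have h0 : 0 ≤ ∑ i ∈ B, |c i| := Finset.sum_nonneg fun i _ => abs_nonneg _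
    have := pow_le_pow_left₀ h0 hN 2
    nlinarith [sq_nonneg D]

/-- A short shift changes `∑ c_i {u / d_i}` much only when it crosses an integer. -/
theorem abs_fractSum_sub_le (hd : ∀ i ∈ B, 0 < d i) {N : ℝ} (hN : ∑ i ∈ B, |c i| ≤ N) {u δ δ' : ℝ}
    (h0 : 0 ≤ δ) (h1 : δ ≤ δ') :
    |fractSum B d c u - fractSum B d c (u - δ)| ≤ N * (δ' + {v : ℝ | Int.fract v < δ'}.indicator 1 u) := by
  have hterm : ∀ i ∈ B, |Int.fract (u / d i) - Int.fract ((u - δ) / d i)| ≤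
      δ' + {v : ℝ | Int.fract v < δ'}.indicator 1 u := by
    intro i hi
    have hdi : (1:ℝ) ≤ d i := by exact_mod_cast hd i hi
    by_cases h : u ∈ {v : ℝ | Int.fract v < δ'}
    · rw [Set.indicator_of_mem h, Pi.one_apply]
      have := abs_fractIncrement_le (d i) δ u
      rw [fractIncrement] at this
      linarith
    · rw [Set.indicator_of_notMem h, add_zero]
      rw [Set.mem_ofPred_eq, not_lt] at h
      have hfl : ⌊u - δ⌋ = ⌊u⌋ := by
        rw [Int.floor_eq_iff]
        have h2 := Int.floor_add_fract u
        have h3 := Int.fract_lt_one u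
        constructor <;> linarith
      have hfl2 : ⌊u / d i⌋ = ⌊(u - δ) / d i⌋ := by
        rw [Int.floor_div_natCast, Int.floor_div_natCast, hfl]
      rw [Int.fract, Int.fract, hfl2, show u / (d i : ℝ) - ⌊(u - δ) / (d i : ℝ)⌋ - ((u - δ) / d i - ⌊(u - δ) / (d i : ℝ)⌋)
        = δ / d i by ring, abs_of_nonneg (by positivity)]
      exact (div_le_self h0 hdi).trans h1
  have hnn : 0 ≤ δ' + {v : ℝ | Int.fract v < δ'}.indicator (1 : ℝ → ℝ) u :=
    add_nonneg (h0.trans h1) (Set.indicator_nonneg (fun _ _ => zero_le_one) _)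
  calc |fractSum B d c u - fractSum B d c (u - δ)|
      = |∑ i ∈ B, c i * (Int.fract (u / d i) - Int.fract ((u - δ) / d i))| := by
        rw [fractSum, fractSum, ← Finset.sum_sub_distrib]
        congr 1
        exact Finset.sum_congr rfl fun i _ => by ring
    _ ≤ ∑ i ∈ B, |c i| * (δ' + {v : ℝ | Int.fract v < δ'}.indicator 1 u) := by
        refine (Finset.abs_sum_le_sum_abs _ _).trans (Finset.sum_le_sum fun i hi => ?_)
        rw [abs_mul]
        exact mul_le_mul_of_nonneg_left (hterm i hi) (abs_nonneg _)
    _ ≤ _ := by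
        rw [← Finset.sum_mul]
        exact mul_le_mul_of_nonneg_right hN hnn

theorem measurableSet_fract_lt (δ : ℝ) : MeasurableSet {v : ℝ | Int.fract v < δ} :=
  measurableSet_lt measurable_fract measurable_const

theorem integral_indicator_fract_lt (L : ℕ) {δ : ℝ} (hδ0 : 0 ≤ δ) (hδ1 : δ ≤ 1) (u : ℝ) :
    ∫ z in (0:ℝ)..(L : ℝ), {v : ℝ | Int.fract v < δ}.indicator (1 : ℝ → ℝ) (u + z) = L * δ := by
  set F : ℝ → ℝ := {v : ℝ | Int.fract v < δ}.indicator 1 with hF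
  have hm : Measurable F := measurable_one.indicator (measurableSet_fract_lt δ)
  have hb : ∀ x, |F x| ≤ 1 := fun x => by
    simp only [hF]
    by_cases h : x ∈ {v : ℝ | Int.fract v < δ}
    · rw [Set.indicator_of_mem h]; simp
    · rw [Set.indicator_of_notMem h]; simp
  have hp : Function.Periodic F 1 := fun x => by
    simp only [hF]
    by_cases h : x ∈ {v : ℝ | Int.fract v < δ}
    · have h' : x + 1 ∈ {v : ℝ | Int.fract v < δ} := by simpa using h
      rw [Set.indicator_of_mem h, Set.indicator_of_mem h']; rfl
    · have h' : x + 1 ∉ {v : ℝ | Int.fract v < δ} := by simpa using h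
      rw [Set.indicator_of_notMem h, Set.indicator_of_notMem h']
  rw [intervalIntegral.integral_comp_add_left, add_zero]
  have := hp.intervalIntegral_add_zsmul_eq L u (fun _ _ => intervalIntegrable_of_measurable_of_abs_le hm hb _ _)
  simp only [natCast_zsmul, nsmul_eq_mul, mul_one] at this
  rw [this, hp.intervalIntegral_add_eq u 0, zero_add]
  congr 1
  have hae : ∫ x in (0:ℝ)..1, F x = ∫ x in (0:ℝ)..1, (Set.Iio δ).indicator (1 : ℝ → ℝ) x := by
    rw [intervalIntegral.integral_of_le zero_le_one, intervalIntegral.integral_of_le zero_le_one,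
      ← integral_Ico_eq_integral_Ioc, ← integral_Ico_eq_integral_Ioc]
    refine setIntegral_congr_fun measurableSet_Ico fun x hx => ?_
    have hfx : Int.fract x = x := Int.fract_eq_self.2 hx
    simp only [hF, Set.indicator_apply, Set.mem_ofPred_eq, Set.mem_Iio, hfx]
  rw [hae, intervalIntegral.integral_of_le zero_le_one, ← integral_Ico_eq_integral_Ioc,
    setIntegral_indicator measurableSet_Iio]
  have : Set.Ico (0:ℝ) 1 ∩ Set.Iio δ = Set.Ico 0 δ := by
    ext v; simp only [Set.mem_inter_iff, Set.mem_Ico, Set.mem_Iio]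
    exact ⟨fun h => ⟨h.1.1, h.2⟩, fun h => ⟨⟨h.1, h.2.trans_le hδ1⟩, h.2⟩⟩
  rw [this]
  simp [hδ0]

/-- The mean square over a window of the increments of `∑ c_i {x / d_i}` over multiplicatively short
intervals. -/
theorem integral_sq_fractSum_increment_le (hd : ∀ i ∈ B, 0 < d i) {D N Q : ℝ} (hD : ∀ i ∈ B, (d i : ℝ) ≤ D)
    (hN : ∑ i ∈ B, |c i| ≤ N) (hQ : GcdFormBound B d c Q) {η : ℝ} (hη : 0 ≤ η) (L : ℕ) (hLη : L * η ≤ 1)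
    {x : ℝ} (hx : 0 ≤ x) :
    ∫ z in (0:ℝ)..(L : ℝ), (fractSum B d c (x + z) - fractSum B d c ((x + z) * (1 - η))) ^ 2 ≤
      L * (4 * (x * η) * Q) + 4 * N ^ 2 * D ^ 2 + 8 * N ^ 2 * (L * (L * η)) := by
  -- The shift by `(x + z) η` is replaced by the constant shift `y = x η`. The difference `z η ≤ L η` of the two
  -- matters only near integers.
  set y := x * η with hy
  have hN0 : 0 ≤ N := le_trans (Finset.sum_nonneg fun i _ => abs_nonneg _) hN
  set δ' : ℝ := L * η with hδ'
  have hδ0 : 0 ≤ δ' := by positivity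
  set J : ℝ → ℝ := {v : ℝ | Int.fract v < δ'}.indicator 1 with hJ
  have hJm : Measurable J := measurable_one.indicator (measurableSet_fract_lt δ')
  have hJ01 : ∀ v, J v = 0 ∨ J v = 1 := fun v => by
    simp only [hJ]
    by_cases h : v ∈ {v : ℝ | Int.fract v < δ'}
    · right; rw [Set.indicator_of_mem h]; rfl
    · left; rw [Set.indicator_of_notMem h]
  have hfb : ∀ v, |fractSum B d c v| ≤ N := fun v => by
    refine (Finset.abs_sum_le_sum_abs _ _).trans (le_trans (Finset.sum_le_sum fun i _ => ?_) hN)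
    rw [abs_mul, abs_of_nonneg (Int.fract_nonneg (v / (d i : ℝ)))]
    exact mul_le_of_le_one_right (abs_nonneg _) (Int.fract_lt_one _).le
  have hpt : ∀ z ∈ Set.Icc (0:ℝ) L, (fractSum B d c (x + z) - fractSum B d c ((x + z) * (1 - η))) ^ 2 ≤
      2 * (∑ i ∈ B, c i * fractIncrement (d i) y (x + z)) ^ 2 + 4 * N ^ 2 * (δ' ^ 2 + J ((x - y) + z)) := by
    intro z hz
    have h1 : fractSum B d c (x + z) - fractSum B d c (x + z - y) = ∑ i ∈ B, c i * fractIncrement (d i) y (x + z) := by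
      rw [fractSum, fractSum, ← Finset.sum_sub_distrib]
      exact Finset.sum_congr rfl fun i _ => by rw [fractIncrement]; ring
    have h2 := abs_fractSum_sub_le hd hN (u := x - y + z) (δ := z * η) (δ' := δ') (mul_nonneg hz.1 hη)
      (mul_le_mul_of_nonneg_right hz.2 hη)
    have e1 : (x + z) * (1 - η) = x - y + z - z * η := by simp only [hy]; ring
    have e2 : x + z - y = x - y + z := by ring
    rw [e2] at h1
    rw [e1]
    have h3 : (fractSum B d c (x - y + z) - fractSum B d c (x - y + z - z * η)) ^ 2 ≤ (N * (δ' + J (x - y + z))) ^ 2 := by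
      rw [← sq_abs]
      exact pow_le_pow_left₀ (abs_nonneg _) h2 2
    have h4 : (N * (δ' + J (x - y + z))) ^ 2 ≤ N ^ 2 * (2 * (δ' ^ 2 + J (x - y + z))) := by
      rw [mul_pow]
      refine mul_le_mul_of_nonneg_left ?_ (sq_nonneg _)
      rcases hJ01 (x - y + z) with h | h <;> rw [h] <;> nlinarith [sq_nonneg (δ' - 1), sq_nonneg δ']
    rw [← h1]
    set p := fractSum B d c (x + z)
    set q := fractSum B d c (x - y + z)
    set r := fractSum B d c (x - y + z - z * η)
    nlinarith [sq_nonneg ((p - q) - (q - r))]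
  have hi1 : IntervalIntegrable (fun z => (fractSum B d c (x + z) - fractSum B d c ((x + z) * (1 - η))) ^ 2) volume 0 L := by
    refine intervalIntegrable_of_measurable_of_abs_le (C := (2 * N) ^ 2) ?_ (fun z => ?_) _ _
    · exact ((measurable_fractSum.comp (measurable_id.const_add x)).sub
        (measurable_fractSum.comp ((measurable_id.const_add x).mul_const _))).pow_const 2
    · rw [abs_pow]
      refine pow_le_pow_left₀ (abs_nonneg _) ?_ 2
      refine (abs_sub _ _).trans ?_
      linarith [hfb (x + z), hfb ((x + z) * (1 - η))]
  have hi2 : IntervalIntegrable (fun z => (∑ i ∈ B, c i * fractIncrement (d i) y (x + z)) ^ 2) volume 0 L := by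
    refine intervalIntegrable_of_measurable_of_abs_le (C := N ^ 2) ?_ (fun z => ?_) _ _
    · exact (Finset.measurable_sum _ fun i _ => ((measurable_fractIncrement _ _).comp
        (measurable_id.const_add x)).const_mul _).pow_const 2
    · rw [abs_pow]
      refine pow_le_pow_left₀ (abs_nonneg _) ?_ 2
      refine (Finset.abs_sum_le_sum_abs _ _).trans (le_trans (Finset.sum_le_sum fun i _ => ?_) hN)
      rw [abs_mul]
      exact mul_le_of_le_one_right (abs_nonneg _) (abs_fractIncrement_le _ _ _)
  have hi3 : IntervalIntegrable (fun z => J ((x - y) + z)) volume 0 L := by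
    refine intervalIntegrable_of_measurable_of_abs_le (C := 1) (hJm.comp (measurable_id.const_add _)) (fun z => ?_) _ _
    rcases hJ01 ((x - y) + z) with h | h
    · simp [h]
    · simp [h]
  have hL0 : (0:ℝ) ≤ L := by positivity
  calc ∫ z in (0:ℝ)..(L : ℝ), (fractSum B d c (x + z) - fractSum B d c ((x + z) * (1 - η))) ^ 2
      ≤ ∫ z in (0:ℝ)..(L : ℝ), (2 * (∑ i ∈ B, c i * fractIncrement (d i) y (x + z)) ^ 2
          + 4 * N ^ 2 * (δ' ^ 2 + J ((x - y) + z))) :=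
        intervalIntegral.integral_mono_on hL0 hi1
          ((hi2.const_mul 2).add ((intervalIntegrable_const.add hi3).const_mul _)) hpt
    _ = 2 * (∫ z in (0:ℝ)..(L : ℝ), (∑ i ∈ B, c i * fractIncrement (d i) y (x + z)) ^ 2) +
          4 * N ^ 2 * (L * δ' ^ 2 + L * δ') := by
        rw [intervalIntegral.integral_add (hi2.const_mul 2) ((intervalIntegrable_const.add hi3).const_mul _),
          intervalIntegral.integral_const_mul, intervalIntegral.integral_const_mul,
          intervalIntegral.integral_add intervalIntegrable_const hi3,
          integral_indicator_fract_lt L hδ0 hLη, intervalIntegral.integral_const]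
        simp
    _ ≤ _ := by
        have h1 := integral_sq_sum_fractIncrement_le hd hD hN hQ (y := y) (by positivity) hL0 x
        have h2 : (L : ℝ) * δ' ^ 2 ≤ L * δ' := mul_le_mul_of_nonneg_left (by nlinarith) hL0
        have h3 : 4 * N ^ 2 * (L * δ' ^ 2 + L * δ') ≤ 4 * N ^ 2 * (2 * (L * δ')) :=
          mul_le_mul_of_nonneg_left (by linarith) (by positivity)
        linarith

end ShortIntervalVariance

/-! ### The mean square of `1 - ζ M` for a short Dirichlet polynomial -/

section MeanSquare

variable {ι : Type*} {B : Finset ι} {d : ι → ℕ} {c : ι → ℝ}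

/-- Averaging over translates: a bound for the mean of `H` over windows `[x, x + L]` gives a bound for
`∫ H w` with a decreasing weight `w`. -/
theorem lintegral_mul_antitone_le {H w R : ℝ → ℝ} (hHm : Measurable H) (hH0 : ∀ x, 0 ≤ H x)
    (hHb : ∃ C, ∀ x, |H x| ≤ C) (hwm : Measurable w) {T L : ℝ} (hL : 0 < L)
    (hw0 : ∀ x, T - L ≤ x → 0 ≤ w x) (hw : ∀ x x', T - L ≤ x → x ≤ x' → w x' ≤ w x)
    (hR : ∀ x, T - L ≤ x → ∫ z in (0:ℝ)..L, H (x + z) ≤ L * R x) :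
    ∫⁻ x in Set.Ici T, ENNReal.ofReal (H x * w x) ≤
      ∫⁻ x in Set.Ici (T - L), ENNReal.ofReal (R x * w x) := by
  obtain ⟨C, hC⟩ := hHb
  have hshift : ∀ z ∈ Set.Icc (0:ℝ) L, ∫⁻ x in Set.Ici T, ENNReal.ofReal (H x * w x) ≤
      ∫⁻ x in Set.Ici (T - L), ENNReal.ofReal (H (x + z)) * ENNReal.ofReal (w x) := by
    intro z hz
    have e : ∫⁻ x in Set.Ici T, ENNReal.ofReal (H x * w x) =
        ∫⁻ x in Set.Ici (T - z), ENNReal.ofReal (H (x + z) * w (x + z)) := by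
      rw [← lintegral_indicator measurableSet_Ici, ← lintegral_indicator measurableSet_Ici,
        ← lintegral_add_right_eq_self _ z]
      refine lintegral_congr fun x => ?_
      by_cases h : T - z ≤ x
      · rw [Set.indicator_of_mem (Set.mem_Ici.2 h), Set.indicator_of_mem (show x + z ∈ Set.Ici T by
          rw [Set.mem_Ici]; linarith)]
      · rw [Set.indicator_of_notMem (show x + z ∉ Set.Ici T by
          rw [Set.mem_Ici]; intro h'; exact h (by linarith)), Set.indicator_of_notMem (by simpa using h)]
    rw [e]
    refine (setLIntegral_mono' measurableSet_Ici fun x hx => ?_).trans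
      (lintegral_mono_set (Set.Ici_subset_Ici.2 (by linarith [hz.2] : T - L ≤ T - z)))
    rw [Set.mem_Ici] at hx
    rw [← ENNReal.ofReal_mul (hH0 _)]
    exact ENNReal.ofReal_le_ofReal (mul_le_mul_of_nonneg_left
      (hw _ _ (by linarith [hz.2]) (by linarith [hz.1])) (hH0 _))
  have hL' : ENNReal.ofReal L ≠ 0 := by simpa using hL
  rw [← ENNReal.mul_le_mul_iff_right hL' ENNReal.ofReal_ne_top]
  calc ENNReal.ofReal L * ∫⁻ x in Set.Ici T, ENNReal.ofReal (H x * w x)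
      = ∫⁻ _z in Set.Icc (0:ℝ) L, ∫⁻ x in Set.Ici T, ENNReal.ofReal (H x * w x) := by
        rw [setLIntegral_const, Real.volume_Icc, sub_zero, mul_comm]
    _ ≤ ∫⁻ z in Set.Icc (0:ℝ) L, ∫⁻ x in Set.Ici (T - L), ENNReal.ofReal (H (x + z)) * ENNReal.ofReal (w x) :=
        setLIntegral_mono' measurableSet_Icc hshift
    _ = ∫⁻ x in Set.Ici (T - L), ∫⁻ z in Set.Icc (0:ℝ) L, ENNReal.ofReal (H (x + z)) * ENNReal.ofReal (w x) := by
        refine lintegral_lintegral_swap (Measurable.aemeasurable ?_)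
        simp only [Function.uncurry_def]
        fun_prop
    _ ≤ ∫⁻ x in Set.Ici (T - L), ENNReal.ofReal L * ENNReal.ofReal (R x * w x) := by
        refine setLIntegral_mono' measurableSet_Ici fun x hx => ?_
        rw [lintegral_mul_const _ (by fun_prop)]
        have hint : IntegrableOn (fun z => H (x + z)) (Set.Ioc 0 L) :=
          (intervalIntegrable_iff_integrableOn_Ioc_of_le hL.le).1
            (intervalIntegrable_of_measurable_of_abs_le (hHm.comp (measurable_id.const_add x)) (fun z => hC _) _ _)
        have e : ∫⁻ z in Set.Icc (0:ℝ) L, ENNReal.ofReal (H (x + z)) = ENNReal.ofReal (∫ z in (0:ℝ)..L, H (x + z)) := by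
          rw [intervalIntegral.integral_of_le hL.le, ofReal_integral_eq_lintegral_ofReal hint
            (Eventually.of_forall fun z => hH0 _), Measure.restrict_congr_set Ioc_ae_eq_Icc]
        rw [e, ← ENNReal.ofReal_mul (intervalIntegral.integral_nonneg hL.le fun z _ => hH0 _), ← ENNReal.ofReal_mul hL.le]
        refine ENNReal.ofReal_le_ofReal ?_
        rw [← mul_assoc]
        exact mul_le_mul_of_nonneg_right (hR x hx) (hw0 x hx)
    _ = _ := by rw [lintegral_const_mul' _ _ ENNReal.ofReal_ne_top]

theorem lintegral_Ici_rpow {a p : ℝ} (ha : 0 < a) (hp : p < -1) :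
    ∫⁻ x in Set.Ici a, ENNReal.ofReal (x ^ p) = ENNReal.ofReal (a ^ (p + 1) / (-p - 1)) := by
  rw [Measure.restrict_congr_set Ioi_ae_eq_Ici.symm, ← ofReal_integral_eq_lintegral_ofReal
    (integrableOn_Ioi_rpow_of_lt hp ha), integral_Ioi_rpow_of_lt hp ha]
  · congr 1
    rw [neg_div, ← div_neg]; congr 1; ring
  · filter_upwards [ae_restrict_mem measurableSet_Ioi] with x hx
    exact Real.rpow_nonneg (ha.trans hx).le _

/-- The contribution of `x ≥ T`. -/
theorem lintegral_increment_Ici_le (hd : ∀ i ∈ B, 0 < d i) {D N Q σ T : ℝ} (hD : ∀ i ∈ B, (d i : ℝ) ≤ D)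
    (hD1 : 1 ≤ D) (hN : ∑ i ∈ B, |c i| ≤ N) (hQ : GcdFormBound B d c Q) (hQ0 : 0 ≤ Q) (hT : 16 ≤ T)
    (hσ0 : 1 / 2 < σ) (hσ1 : σ ≤ 3 / 4) :
    ∫⁻ x in Set.Ici T, ENNReal.ofReal ((fractSumStep B d c x -
        fractSumStep B d c (x * Real.exp (-T⁻¹))) ^ 2 * x ^ (-2 * σ - 1)) ≤
      ENNReal.ofReal (8 * Q * T ^ (-2 * σ) / (2 * σ - 1) + 60 * N ^ 2 * D ^ 2 * (√T)⁻¹ * T ^ (-2 * σ)) := by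
  have hT0 : 0 < T := by linarith
  set η : ℝ := 1 - Real.exp (-T⁻¹) with hη
  have hη0 : 0 ≤ η := by
    have : Real.exp (-T⁻¹) ≤ 1 := by rw [← Real.exp_zero]; exact Real.exp_le_exp.2 (by simpa using hT0.le)
    linarith
  have hη1 : η ≤ T⁻¹ := by have := Real.add_one_le_exp (-T⁻¹); linarith
  -- The window must be long compared with the squares of the periods and short compared with `T`.
  set L : ℕ := ⌈√T⌉₊ with hL
  have hs4 : 4 ≤ √T := by rw [Real.le_sqrt (by norm_num) hT0.le]; linarith
  have hss : √T * √T = T := Real.mul_self_sqrt hT0.le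
  have hL1 : √T ≤ L := Nat.le_ceil _
  have hL2 : (L : ℝ) ≤ 2 * √T := by
    have := Nat.ceil_lt_add_one (Real.sqrt_nonneg T); linarith
  have hL0 : (0:ℝ) < L := by linarith
  have hLT : (L : ℝ) ≤ T / 2 := by nlinarith
  have hLη : L * η ≤ 1 := by
    calc L * η ≤ T / 2 * T⁻¹ := mul_le_mul hLT hη1 hη0 (by linarith)
      _ ≤ 1 := by field_simp; norm_num
  set H : ℝ → ℝ := fun x => (fractSum B d c x - fractSum B d c (x * (1 - η))) ^ 2 with hH
  have e1 : ∫⁻ x in Set.Ici T, ENNReal.ofReal ((fractSumStep B d c x -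
        fractSumStep B d c (x * Real.exp (-T⁻¹))) ^ 2 * x ^ (-2 * σ - 1)) =
      ∫⁻ x in Set.Ici T, ENNReal.ofReal (H x * x ^ (-2 * σ - 1)) := by
    refine setLIntegral_congr_fun measurableSet_Ici fun x hx => ?_
    rw [Set.mem_Ici] at hx
    have h1 : x ∈ Set.Ici (1:ℝ) := by rw [Set.mem_Ici]; linarith
    have h2 : x * Real.exp (-T⁻¹) ∈ Set.Ici (1:ℝ) := by
      rw [Set.mem_Ici]
      have h3 := Real.add_one_le_exp (-T⁻¹)
      have h4 : T * (-T⁻¹ + 1) ≤ x * Real.exp (-T⁻¹) :=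
        mul_le_mul hx h3 (by have := inv_le_one_of_one_le₀ (by linarith : 1 ≤ T); linarith) (by linarith)
      have h5 : T * (-T⁻¹ + 1) = T - 1 := by field_simp; ring
      linarith
    simp only [hH, fractSumStep, Set.indicator_of_mem h1, Set.indicator_of_mem h2, hη]
    rw [sub_sub_cancel]
    congr 3
    simp only [Pi.one_apply]
    ring
  rw [e1]
  have hN0 : 0 ≤ N := le_trans (Finset.sum_nonneg fun i _ => abs_nonneg _) hN
  have hfb : ∀ v, |fractSum B d c v| ≤ N := fun v => by
    refine (Finset.abs_sum_le_sum_abs _ _).trans (le_trans (Finset.sum_le_sum fun i _ => ?_) hN)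
    rw [abs_mul, abs_of_nonneg (Int.fract_nonneg (v / (d i : ℝ)))]
    exact mul_le_of_le_one_right (abs_nonneg _) (Int.fract_lt_one _).le
  set Err : ℝ := 20 * N ^ 2 * D ^ 2 * (√T)⁻¹ with hErr
  have hErr0 : 0 ≤ Err := by positivity
  have hmain := lintegral_mul_antitone_le (H := H) (w := fun x => x ^ (-2 * σ - 1))
    (R := fun x => 4 * Q * T⁻¹ * x + Err) (T := T) (L := L)
    ((measurable_fractSum.sub (measurable_fractSum.comp (measurable_id.mul_const _))).pow_const 2)
    (fun x => sq_nonneg _)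
    ⟨(2 * N) ^ 2, fun x => by
      simp only [hH]
      rw [abs_pow]
      refine pow_le_pow_left₀ (abs_nonneg _) ((abs_sub _ _).trans ?_) 2
      linarith [hfb x, hfb (x * (1 - η))]⟩ (by fun_prop) hL0
    (fun x hx => Real.rpow_nonneg (by linarith) _)
    (fun x x' hx hxx' => Real.rpow_le_rpow_of_nonpos (by linarith) hxx' (by linarith))
    (fun x hx => by
      have hx0 : 0 ≤ x := by linarith
      refine (integral_sq_fractSum_increment_le hd hD hN hQ hη0 L hLη hx0).trans ?_
      have h1 : (L:ℝ) * (4 * (x * η) * Q) ≤ L * (4 * Q * T⁻¹ * x) := by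
        refine mul_le_mul_of_nonneg_left ?_ hL0.le
        have := mul_le_mul_of_nonneg_left hη1 (by positivity : 0 ≤ 4 * x * Q)
        linarith
      have h2 : 4 * N ^ 2 * D ^ 2 ≤ L * (4 * N ^ 2 * D ^ 2 * (√T)⁻¹) := by
        have : 1 ≤ L * (√T)⁻¹ := by rw [← div_eq_mul_inv, le_div_iff₀ (by linarith)]; linarith
        have := mul_le_mul_of_nonneg_left this (by positivity : 0 ≤ 4 * N ^ 2 * D ^ 2)
        linarith
      have h3 : L * η ≤ 2 * (√T)⁻¹ := by
        calc L * η ≤ (2 * √T) * T⁻¹ := mul_le_mul hL2 hη1 hη0 (by positivity)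
          _ = 2 * (√T)⁻¹ := by
            rw [← hss, mul_inv, Real.sqrt_mul_self (by positivity)]
            field_simp
      have h4 : 8 * N ^ 2 * (L * (L * η)) ≤ L * (16 * N ^ 2 * D ^ 2 * (√T)⁻¹) := by
        have hD2 : 1 ≤ D ^ 2 := one_le_pow₀ hD1
        have a1 : 8 * N ^ 2 * (L * (L * η)) ≤ 8 * N ^ 2 * (L * (2 * (√T)⁻¹)) := by gcongr
        have a2 : 0 ≤ 16 * N ^ 2 * L * (√T)⁻¹ := by positivity
        nlinarith
      simp only [hErr]
      linarith)
  refine hmain.trans ?_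
  have hTL : T / 2 ≤ T - L := by linarith
  refine (lintegral_mono_set (Set.Ici_subset_Ici.2 hTL)).trans ?_
  have e2 : ∫⁻ x in Set.Ici (T / 2), ENNReal.ofReal ((4 * Q * T⁻¹ * x + Err) * x ^ (-2 * σ - 1)) =
      ENNReal.ofReal (4 * Q * T⁻¹) * (∫⁻ x in Set.Ici (T / 2), ENNReal.ofReal (x ^ (-2 * σ))) +
      ENNReal.ofReal Err * ∫⁻ x in Set.Ici (T / 2), ENNReal.ofReal (x ^ (-2 * σ - 1)) := by
    rw [← lintegral_const_mul' _ _ ENNReal.ofReal_ne_top, ← lintegral_const_mul' _ _ ENNReal.ofReal_ne_top,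
      ← lintegral_add_left (by fun_prop)]
    refine setLIntegral_congr_fun measurableSet_Ici fun x hx => ?_
    rw [Set.mem_Ici] at hx
    have hx0 : 0 < x := by linarith
    have h1 := Real.rpow_nonneg hx0.le (-2 * σ)
    have h2 := Real.rpow_nonneg hx0.le (-2 * σ - 1)
    rw [← ENNReal.ofReal_mul (by positivity), ← ENNReal.ofReal_mul hErr0, ← ENNReal.ofReal_add (by positivity) (by positivity)]
    congr 1
    rw [add_mul, mul_assoc _ x, Real.rpow_sub_one hx0.ne']
    field_simp
  rw [e2, lintegral_Ici_rpow (by linarith) (by linarith), lintegral_Ici_rpow (by linarith) (by linarith),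
    ← ENNReal.ofReal_mul (by positivity), ← ENNReal.ofReal_mul hErr0, ← ENNReal.ofReal_add]
  · refine ENNReal.ofReal_le_ofReal (add_le_add ?_ ?_)
    · have h1 : (T / 2) ^ (-2 * σ + 1) ≤ 2 * T ^ (-2 * σ + 1) := by
        rw [Real.div_rpow hT0.le (by norm_num), div_eq_mul_inv, mul_comm]
        refine mul_le_mul_of_nonneg_right ?_ (by positivity)
        rw [← Real.rpow_neg (by norm_num)]
        calc (2:ℝ) ^ (-(-2 * σ + 1)) ≤ 2 ^ (1:ℝ) := Real.rpow_le_rpow_of_exponent_le (by norm_num) (by linarith)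
          _ = 2 := Real.rpow_one 2
      rw [show -(-2 * σ) - 1 = 2 * σ - 1 by ring, mul_div_assoc']
      refine div_le_div_of_nonneg_right ?_ (by linarith)
      calc 4 * Q * T⁻¹ * (T / 2) ^ (-2 * σ + 1) ≤ 4 * Q * T⁻¹ * (2 * T ^ (-2 * σ + 1)) := by gcongr
        _ = 8 * Q * T ^ (-2 * σ) := by
          rw [Real.rpow_add_one hT0.ne']; field_simp; ring
    · have h1 : (T / 2) ^ (-2 * σ) ≤ 3 * T ^ (-2 * σ) := by
        rw [Real.div_rpow hT0.le (by norm_num), div_eq_mul_inv, mul_comm]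
        refine mul_le_mul_of_nonneg_right ?_ (by positivity)
        rw [← Real.rpow_neg (by norm_num)]
        calc (2:ℝ) ^ (-(-2 * σ)) ≤ 2 ^ (3 / 2 : ℝ) := Real.rpow_le_rpow_of_exponent_le (by norm_num) (by linarith)
          _ = √(2 ^ (3:ℝ)) := by rw [Real.sqrt_eq_rpow, ← Real.rpow_mul (by norm_num)]; norm_num
          _ ≤ 3 := by
            rw [Real.sqrt_le_left (by norm_num)]; norm_num
      rw [show -2 * σ - 1 + 1 = -2 * σ by ring, show -(-2 * σ - 1) - 1 = 2 * σ by ring]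
      have h2 : (T / 2) ^ (-2 * σ) / (2 * σ) ≤ 3 * T ^ (-2 * σ) := by
        rw [div_le_iff₀ (by linarith)]
        have := Real.rpow_nonneg hT0.le (-2 * σ)
        nlinarith
      calc Err * ((T / 2) ^ (-2 * σ) / (2 * σ)) ≤ Err * (3 * T ^ (-2 * σ)) := by gcongr
        _ = _ := by simp only [hErr]; ring
  · have : 0 < -(-2 * σ) - 1 := by linarith
    positivity
  · have : 0 < -(-2 * σ - 1) - 1 := by linarith
    positivity

/-- The mean square of `1 - ζ M` on a line to the right of the critical line, for a short Dirichlet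
polynomial `M`. -/
theorem lintegral_one_sub_zeta_mul_dirichletPoly_sq_le (hd : ∀ i ∈ B, 0 < d i) {D N Q E σ T : ℝ}
    (hD : ∀ i ∈ B, (d i : ℝ) ≤ D) (hD1 : 1 ≤ D) (hN : ∑ i ∈ B, |c i| ≤ N) (hQ : GcdFormBound B d c Q)
    (hT : 16 ≤ T) (hσ0 : 1 / 2 < σ) (hσ1 : σ ≤ 3 / 4)
    (hκ : (∑ i ∈ B, c i / d i) ^ 2 ≤ Q) (h1 : divisorSum B d c 1 = 1)
    (hE : ∀ K : ℕ, ∑ n ∈ Finset.Ico 2 K, divisorSum B d c n ^ 2 * (n : ℝ) ^ (-2 * σ) ≤ E) :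
    ∫⁻ t in Set.Icc T (2 * T), ENNReal.ofReal (‖1 - riemannZeta (σ + Complex.I * t) *
        dirichletPoly B d c (σ + Complex.I * t)‖ ^ 2) ≤
      ENNReal.ofReal (288 * Real.pi * T * (4 * E + 12 * (Q * T ^ (1 - 2 * σ) / (2 * σ - 1)) +
        60 * (N ^ 2 * D ^ 2 * (√T)⁻¹))) := by
  have hT0 : 0 < T := by linarith
  have hE0 : 0 ≤ E := by simpa using hE 0
  have hQ0 : 0 ≤ Q := (sq_nonneg _).trans hκ
  have hN0 : 0 ≤ N := le_trans (Finset.sum_nonneg fun i _ => abs_nonneg _) hN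
  refine (lintegral_one_sub_zeta_mul_sq_le hd (by linarith) (by linarith) (by linarith)).trans ?_
  have hσ' : 0 < 2 * σ - 1 := by linarith
  rw [← Set.Ioo_union_Ici_eq_Ioi hT0]
  refine (mul_le_mul_right (lintegral_union_le _ _ _) _).trans ?_
  refine (mul_le_mul_right (add_le_add (lintegral_increment_Ioo_le h1 hσ1 (by linarith) (by linarith) hE)
    (lintegral_increment_Ici_le hd hD hD1 hN hQ hQ0 hT hσ0 hσ1)) _).trans ?_
  rw [← ENNReal.ofReal_add (by positivity) (by positivity), ← ENNReal.ofReal_mul (by positivity)]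
  refine ENNReal.ofReal_le_ofReal ?_
  have e1 : T ^ (1 - 2 * σ) = T * T ^ (-2 * σ) := by
    rw [show 1 - 2 * σ = -2 * σ + 1 by ring, Real.rpow_add_one hT0.ne', mul_comm]
  set p := T ^ (-2 * σ) with hp
  have hp0 : 0 ≤ p := by positivity
  have hTp : T * p ≤ 1 := by
    rw [← e1]; exact Real.rpow_le_one_of_one_le_of_nonpos (by linarith) (by linarith)
  rw [e1]
  have a1 : T * (4 * (∑ i ∈ B, c i / d i) ^ 2 * p) ≤ 4 * (Q * (T * p) / (2 * σ - 1)) := by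
    rw [mul_div_assoc']
    rw [le_div_iff₀ hσ']
    have b1 : 0 ≤ T * p := by positivity
    have b2 : (∑ i ∈ B, c i / d i) ^ 2 * (T * p) ≤ Q * (T * p) := mul_le_mul_of_nonneg_right hκ b1
    have b3 : 0 ≤ (∑ i ∈ B, c i / d i) ^ 2 * (T * p) := by positivity
    nlinarith
  have a2 : T * (60 * N ^ 2 * D ^ 2 * (√T)⁻¹ * p) ≤ 60 * (N ^ 2 * D ^ 2 * (√T)⁻¹) := by
    have : 0 ≤ 60 * (N ^ 2 * D ^ 2 * (√T)⁻¹) := by positivity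
    nlinarith
  have a3 : T * (4 * T⁻¹ * E) = 4 * E := by field_simp
  have a4 : T * (8 * Q * p / (2 * σ - 1)) = 8 * (Q * (T * p) / (2 * σ - 1)) := by field_simp
  calc _ = 288 * Real.pi * T * (T * (4 * (∑ i ∈ B, c i / d i) ^ 2 * p) + T * (4 * T⁻¹ * E) +
        (T * (8 * Q * p / (2 * σ - 1)) + T * (60 * N ^ 2 * D ^ 2 * (√T)⁻¹ * p))) := by ring
    _ ≤ _ := by
        refine mul_le_mul_of_nonneg_left ?_ (by positivity)
        rw [a3, a4]
        linarith

end MeanSquare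

/-! ### Diagonalization of quadratic forms over the gcd -/

section SelbergDiagonalization

/-- The Möbius transform of a function on finite sets. -/
noncomputable def finsetMoebius (G : Finset ℕ → ℝ) (A : Finset ℕ) : ℝ :=
  ∑ E ∈ A.powerset, (-1) ^ (A.card + E.card) * G E

theorem finsetMoebius_insert (G : Finset ℕ → ℝ) {A : Finset ℕ} {p : ℕ} (hp : p ∉ A) :
    finsetMoebius G (insert p A) = finsetMoebius (fun E => G (insert p E)) A - finsetMoebius G A := by
  rw [finsetMoebius, Finset.sum_powerset_insert hp, finsetMoebius, finsetMoebius, sub_eq_neg_add,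
    ← Finset.sum_neg_distrib]
  congr 1
  · refine Finset.sum_congr rfl fun E _ => ?_
    rw [Finset.card_insert_of_notMem hp]; ring
  · refine Finset.sum_congr rfl fun E hE => ?_
    rw [Finset.card_insert_of_notMem hp, Finset.card_insert_of_notMem
      (fun h => hp (Finset.mem_powerset.1 hE h))]
    ring

theorem sum_powerset_finsetMoebius (G : Finset ℕ → ℝ) (C : Finset ℕ) :
    ∑ A ∈ C.powerset, finsetMoebius G A = G C := by
  induction C using Finset.induction_on generalizing G with
  | empty => simp [finsetMoebius]
  | insert p C hp ih =>
    rw [Finset.sum_powerset_insert hp, ← Finset.sum_add_distrib, ← ih (fun E => G (insert p E))]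
    refine Finset.sum_congr rfl fun A hA => ?_
    rw [finsetMoebius_insert G (fun h => hp (Finset.mem_powerset.1 hA h))]
    ring

theorem gcd_prod_primes {A B : Finset ℕ} (hA : ∀ p ∈ A, p.Prime) (hB : ∀ p ∈ B, p.Prime) :
    (∏ p ∈ A, p).gcd (∏ p ∈ B, p) = ∏ p ∈ A ∩ B, p := by
  have h1 : ∏ p ∈ A, p = (∏ p ∈ A ∩ B, p) * ∏ p ∈ A \ B, p := by
    rw [← Finset.prod_union (Finset.disjoint_left.2 fun x h h' =>
      (Finset.mem_sdiff.1 h').2 (Finset.mem_inter.1 h).2)]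
    congr 1; ext x; simp only [Finset.mem_union, Finset.mem_inter, Finset.mem_sdiff]; tauto
  have h2 : ∏ p ∈ B, p = (∏ p ∈ A ∩ B, p) * ∏ p ∈ B \ A, p := by
    rw [← Finset.prod_union (Finset.disjoint_left.2 fun x h h' =>
      (Finset.mem_sdiff.1 h').2 (Finset.mem_inter.1 h).1)]
    congr 1; ext x; simp only [Finset.mem_union, Finset.mem_inter, Finset.mem_sdiff]; tauto
  have h3 : Nat.Coprime (∏ p ∈ A \ B, p) (∏ p ∈ B \ A, p) := by
    refine Nat.Coprime.prod_left fun p hp => Nat.Coprime.prod_right fun q hq => ?_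
    rw [Finset.mem_sdiff] at hp hq
    exact (Nat.coprime_primes (hA p hp.1) (hB q hq.1)).2 fun h => hp.2 (h ▸ hq.1)
  rw [h1, h2, Nat.gcd_mul_left, h3.gcd_eq_one, mul_one]

/-- Selberg's diagonalization of the quadratic form `∑ x_i x_j G(gcd(d_i, d_j))` for squarefree
`d_i = ∏_{p ∈ S i} p`. -/
theorem gcdFormBound_of_prod {ι : Type*} {B : Finset ι} {S : ι → Finset ℕ} {c : ι → ℝ} {P : Finset ℕ}
    (hP : ∀ p ∈ P, p.Prime) (hS : ∀ i ∈ B, S i ⊆ P) :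
    GcdFormBound B (fun i => ∏ p ∈ S i, p) c
      (∑ A ∈ P.powerset, (∏ p ∈ A, ((p : ℝ) + 1)) *
        (∑ i ∈ B with A ⊆ S i, c i / ((∏ p ∈ S i, p : ℕ) : ℝ)) ^ 2) := by
  intro G Z hZ hG
  set h := finsetMoebius fun E => G (∏ p ∈ E, p) with hh
  set x : ι → ℝ := fun i => c i / ((∏ p ∈ S i, p : ℕ) : ℝ) with hx
  have hbound : ∀ A ∈ P.powerset, h A ≤ Z * ∏ p ∈ A, ((p : ℝ) + 1) := by
    intro A hA
    have hA' := Finset.mem_powerset.1 hA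
    rw [Finset.prod_add_one, Finset.mul_sum]
    refine Finset.sum_le_sum fun E hE => ?_
    have hE' := Finset.mem_powerset.1 hE
    have hpos : 0 < ∏ p ∈ E, p := Finset.prod_pos fun p hp => (hP p (hA' (hE' hp))).pos
    obtain ⟨g1, g2⟩ := hG _ hpos
    refine (le_abs_self _).trans ?_
    rw [abs_mul, abs_pow, abs_neg, abs_one, one_pow, one_mul, abs_of_nonneg g1, mul_comm]
    refine g2.trans (le_of_eq ?_)
    push_cast; rfl
  have hexp : ∑ i ∈ B, ∑ j ∈ B, x i * x j * G ((∏ p ∈ S i, p).gcd (∏ p ∈ S j, p)) =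
      ∑ A ∈ P.powerset, h A * (∑ i ∈ B with A ⊆ S i, x i) ^ 2 := by
    have e1 : ∀ i ∈ B, ∀ j ∈ B, x i * x j * G ((∏ p ∈ S i, p).gcd (∏ p ∈ S j, p)) =
        ∑ A ∈ P.powerset, h A * ((if A ⊆ S i then x i else 0) * (if A ⊆ S j then x j else 0)) := by
      intro i hi j hj
      rw [gcd_prod_primes (fun p hp => hP p (hS i hi hp)) (fun p hp => hP p (hS j hj hp)),
        ← sum_powerset_finsetMoebius (fun E => G (∏ p ∈ E, p)) (S i ∩ S j), Finset.mul_sum]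
      have e2 : (S i ∩ S j).powerset = P.powerset.filter (fun A => A ⊆ S i ∧ A ⊆ S j) := by
        ext A
        simp only [Finset.mem_powerset, Finset.mem_filter, Finset.subset_inter_iff]
        exact ⟨fun h => ⟨h.1.trans (hS i hi), h⟩, fun h => h.2⟩
      rw [e2, Finset.sum_filter]
      refine Finset.sum_congr rfl fun A _ => ?_
      by_cases h1 : A ⊆ S i <;> by_cases h2 : A ⊆ S j <;> simp [h1, h2, hh, mul_comm]
    rw [Finset.sum_congr rfl fun i hi => Finset.sum_congr rfl fun j hj => e1 i hi j hj]
    have e3 : ∀ i ∈ B, ∑ j ∈ B, ∑ A ∈ P.powerset, h A * ((if A ⊆ S i then x i else 0) * (if A ⊆ S j then x j else 0)) =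
        ∑ A ∈ P.powerset, ∑ j ∈ B, h A * ((if A ⊆ S i then x i else 0) * (if A ⊆ S j then x j else 0)) :=
      fun i _ => Finset.sum_comm
    rw [Finset.sum_congr rfl e3, Finset.sum_comm]
    refine Finset.sum_congr rfl fun A _ => ?_
    rw [sq, Finset.sum_filter, Finset.sum_mul_sum, Finset.mul_sum]
    refine Finset.sum_congr rfl fun i _ => ?_
    rw [Finset.mul_sum]
  rw [hexp, Finset.mul_sum]
  refine Finset.sum_le_sum fun A hA => ?_
  rw [← mul_assoc]
  exact mul_le_mul_of_nonneg_right (hbound A hA) (sq_nonneg _)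

end SelbergDiagonalization

/-! ### The truncated Möbius function over a set of primes -/

section TruncatedSieve

/-- The subsets of `P` with at most `K` elements. -/
def truncatedPowerset (P : Finset ℕ) (K : ℕ) : Finset (Finset ℕ) := P.powerset.filter fun A => A.card ≤ K

/-- The diagonal coefficients `∑_{A ⊆ B ⊆ P, |B| ≤ K} (-1)^|B| / ∏_{p ∈ B} p`. -/
noncomputable def sieveCoeff (P : Finset ℕ) (K : ℕ) (A : Finset ℕ) : ℝ :=
  ∑ E ∈ truncatedPowerset P K with A ⊆ E, (-1) ^ E.card / ((∏ p ∈ E, p : ℕ) : ℝ)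

/-- The diagonalized quadratic form of the truncated Möbius function over the primes in `P`. -/
noncomputable def sieveForm (P : Finset ℕ) (K : ℕ) : ℝ :=
  ∑ A ∈ P.powerset, (∏ p ∈ A, ((p : ℝ) + 1)) * sieveCoeff P K A ^ 2

theorem sieveForm_nonneg (P : Finset ℕ) (K : ℕ) : 0 ≤ sieveForm P K :=
  Finset.sum_nonneg fun A _ => mul_nonneg (Finset.prod_nonneg fun p _ => by positivity) (sq_nonneg _)

theorem sum_powerset_superset {P A : Finset ℕ} (hA : A ⊆ P) (f : ℕ → ℝ) :
    ∑ E ∈ P.powerset with A ⊆ E, ∏ p ∈ E, f p = (∏ p ∈ A, f p) * ∏ p ∈ P \ A, (1 + f p) := by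
  rw [Finset.prod_one_add, Finset.mul_sum]
  refine (Finset.sum_nbij' (fun E => A ∪ E) (fun E => E \ A) ?_ ?_ ?_ ?_ ?_).symm
  · intro E hE
    rw [Finset.mem_powerset] at hE
    simp only [Finset.mem_filter, Finset.mem_powerset]
    exact ⟨Finset.union_subset hA (hE.trans Finset.sdiff_subset), Finset.subset_union_left⟩
  · intro E hE
    simp only [Finset.mem_filter, Finset.mem_powerset] at hE
    rw [Finset.mem_powerset]
    exact Finset.sdiff_subset_sdiff hE.1 (Finset.Subset.refl _)
  · intro E hE
    rw [Finset.mem_powerset] at hE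
    refine Finset.union_sdiff_cancel_left (Finset.disjoint_left.2 fun x h h' => ?_)
    exact (Finset.mem_sdiff.1 (hE h')).2 h
  · intro E hE
    simp only [Finset.mem_filter, Finset.mem_powerset] at hE
    exact Finset.union_sdiff_of_subset hE.2
  · intro E hE
    rw [Finset.mem_powerset] at hE
    rw [Finset.prod_union (Finset.disjoint_left.2 fun x h h' => (Finset.mem_sdiff.1 (hE h')).2 h)]

theorem neg_one_pow_card_div_prod (E : Finset ℕ) :
    (-1 : ℝ) ^ E.card / ((∏ p ∈ E, p : ℕ) : ℝ) = ∏ p ∈ E, (-(p : ℝ)⁻¹) := by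
  rw [Finset.prod_neg]
  push_cast
  rw [Finset.prod_inv_distrib, div_eq_mul_inv]

theorem inv_prod_eq (E : Finset ℕ) : (((∏ p ∈ E, p : ℕ) : ℝ))⁻¹ = ∏ p ∈ E, (p : ℝ)⁻¹ := by
  push_cast
  rw [Finset.prod_inv_distrib]

theorem abs_sieveCoeff_le {P A : Finset ℕ} (hA : A ⊆ P) (K : ℕ) :
    |sieveCoeff P K A| ≤ (∏ p ∈ A, (p : ℝ)⁻¹) * ∏ p ∈ P \ A, (1 + (p : ℝ)⁻¹) := by
  rw [← sum_powerset_superset hA]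
  refine (Finset.abs_sum_le_sum_abs _ _).trans ?_
  have : (truncatedPowerset P K).filter (fun E => A ⊆ E) ⊆ P.powerset.filter (fun E => A ⊆ E) :=
    Finset.filter_subset_filter _ (Finset.filter_subset _ _)
  refine le_trans (Finset.sum_le_sum fun E _ => le_of_eq ?_)
    (Finset.sum_le_sum_of_subset_of_nonneg this fun E _ _ => Finset.prod_nonneg fun p _ => by positivity)
  rw [abs_div, abs_pow, abs_neg, abs_one, one_pow, one_div, Nat.abs_cast, inv_prod_eq]

/-- Without cancellation, the form is bounded by a product over the primes in `P`. -/
theorem sieveForm_le_exp {P : Finset ℕ} (hP : ∀ p ∈ P, p.Prime) (K : ℕ) :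
    sieveForm P K ≤ Real.exp (4 * ∑ p ∈ P, (p : ℝ)⁻¹) := by
  have h1 : sieveForm P K ≤ ∑ A ∈ P.powerset, (∏ p ∈ A, (((p : ℝ) + 1) * (p : ℝ)⁻¹ ^ 2)) *
      ∏ p ∈ P \ A, (1 + (p : ℝ)⁻¹) ^ 2 := by
    refine Finset.sum_le_sum fun A hA => ?_
    have h2 := abs_sieveCoeff_le (Finset.mem_powerset.1 hA) K
    rw [Finset.prod_mul_distrib, Finset.prod_pow, Finset.prod_pow, mul_assoc, ← mul_pow, ← sq_abs (sieveCoeff _ _ _)]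
    exact mul_le_mul_of_nonneg_left (pow_le_pow_left₀ (abs_nonneg _) h2 2)
      (Finset.prod_nonneg fun p _ => by positivity)
  rw [← Finset.prod_add] at h1
  refine h1.trans ?_
  rw [Finset.mul_sum, Real.exp_sum]
  refine Finset.prod_le_prod (fun p _ => by positivity) fun p hp => ?_
  have h2 : (p : ℝ)⁻¹ ≤ 1 / 2 := by
    rw [one_div]; exact inv_anti₀ (by norm_num) (by exact_mod_cast (hP p hp).two_le)
  have h0 : (p : ℝ) ≠ 0 := by have := (hP p hp).pos; positivity
  have hpos : 0 < (p : ℝ)⁻¹ := by have := (hP p hp).pos; positivity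
  have e : ((p : ℝ) + 1) * (p : ℝ)⁻¹ ^ 2 = (p : ℝ)⁻¹ + (p : ℝ)⁻¹ ^ 2 := by field_simp
  rw [e]
  have := Real.add_one_le_exp (4 * (p : ℝ)⁻¹)
  nlinarith

/-- Rankin's bound for the effect of the truncation on the diagonal coefficients. -/
theorem abs_sieveCoeff_sub_le {P A : Finset ℕ} (hA : A ⊆ P) {K : ℕ} {κ : ℝ} (hκ : κ ≤ K + 1) :
    |sieveCoeff P K A - (∏ p ∈ A, (-(p : ℝ)⁻¹)) * ∏ p ∈ P \ A, (1 - (p : ℝ)⁻¹)| ≤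
      Real.exp (-κ) * ((∏ p ∈ A, (Real.exp 1 * (p : ℝ)⁻¹)) * ∏ p ∈ P, (1 + Real.exp 1 * (p : ℝ)⁻¹)) := by
  have h1 : (∏ p ∈ A, (-(p : ℝ)⁻¹)) * ∏ p ∈ P \ A, (1 - (p : ℝ)⁻¹) =
      ∑ E ∈ P.powerset with A ⊆ E, ∏ p ∈ E, (-(p : ℝ)⁻¹) := by
    rw [sum_powerset_superset hA]
    simp only [sub_eq_add_neg]
  have h2 : sieveCoeff P K A = ∑ E ∈ P.powerset with A ⊆ E, if E.card ≤ K then ∏ p ∈ E, (-(p : ℝ)⁻¹) else 0 := by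
    rw [← Finset.sum_filter, sieveCoeff, truncatedPowerset]
    rw [Finset.filter_filter, Finset.filter_filter]
    simp only [neg_one_pow_card_div_prod, and_comm]
  rw [h1, h2, ← Finset.sum_sub_distrib]
  refine (Finset.abs_sum_le_sum_abs _ _).trans ?_
  calc ∑ E ∈ P.powerset with A ⊆ E, |(if E.card ≤ K then ∏ p ∈ E, (-(p : ℝ)⁻¹) else 0) - ∏ p ∈ E, (-(p : ℝ)⁻¹)|
      ≤ ∑ E ∈ P.powerset with A ⊆ E, Real.exp (-κ) * ∏ p ∈ E, (Real.exp 1 * (p : ℝ)⁻¹) := by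
        refine Finset.sum_le_sum fun E _ => ?_
        by_cases h : E.card ≤ K
        · rw [if_pos h, sub_self, abs_zero]
          exact mul_nonneg (Real.exp_pos _).le (Finset.prod_nonneg fun p _ => by positivity)
        · rw [if_neg h, zero_sub, abs_neg, Finset.abs_prod, Finset.prod_mul_distrib, Finset.prod_const,
            ← Real.exp_nat_mul, ← mul_assoc, ← Real.exp_add]
          have h3 : (K : ℝ) + 1 ≤ E.card := by exact_mod_cast not_le.1 h
          simp only [abs_neg, abs_inv, Nat.abs_cast]
          refine le_mul_of_one_le_left (Finset.prod_nonneg fun p _ => by positivity) ?_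
          exact Real.one_le_exp (by linarith)
    _ = Real.exp (-κ) * ((∏ p ∈ A, (Real.exp 1 * (p : ℝ)⁻¹)) * ∏ p ∈ P \ A, (1 + Real.exp 1 * (p : ℝ)⁻¹)) := by
        rw [← Finset.mul_sum, sum_powerset_superset hA]
    _ ≤ _ := by
        refine mul_le_mul_of_nonneg_left (mul_le_mul_of_nonneg_left ?_ (Finset.prod_nonneg fun p _ => by positivity))
          (Real.exp_pos _).le
        refine Finset.prod_le_prod_of_subset_of_one_le Finset.sdiff_subset (fun p _ => by positivity)
          fun p _ _ => ?_
        exact le_add_of_nonneg_right (by positivity)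

theorem sum_inv_sq_le (P : Finset ℕ) : ∑ p ∈ P, ((p : ℝ)⁻¹) ^ 2 ≤ 2 := by
  have h : ∀ N : ℕ, ∑ n ∈ Finset.range (N + 2), ((n : ℝ)⁻¹) ^ 2 ≤ 2 - (N + 1 : ℝ)⁻¹ := by
    intro N
    induction N with
    | zero => norm_num [Finset.sum_range_succ]
    | succ N ih =>
      rw [Finset.sum_range_succ]
      have h3 : (((N + 2 : ℕ) : ℝ)⁻¹) ^ 2 ≤ ((N : ℝ) + 1)⁻¹ - (((N + 1 : ℕ) : ℝ) + 1)⁻¹ := by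
        have h4 : ((N : ℝ) + 1)⁻¹ - (((N + 1 : ℕ) : ℝ) + 1)⁻¹ = ((N : ℝ) + 1)⁻¹ * ((N : ℝ) + 2)⁻¹ := by
          push_cast; field_simp; ring
        rw [h4, sq]
        push_cast
        gcongr
        linarith
      linarith
  obtain ⟨N, hN⟩ := P.exists_nat_subset_range
  refine (Finset.sum_le_sum_of_subset_of_nonneg (hN.trans (Finset.range_subset_range.2 (Nat.le_add_right N 2)))
    fun _ _ _ => by positivity).trans ((h N).trans ?_)
  have : (0:ℝ) ≤ (N + 1 : ℝ)⁻¹ := by positivity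
  linarith

/-- The form is about as small as `∏_{p ∈ P} (1 - 1/p)`: without truncation it would be
`∏_{p ∈ P} ((1 - 1/p)² + (p + 1) / p²)`, and Rankin's bound controls the effect of the truncation. -/
theorem sieveForm_le {P : Finset ℕ} (hP : ∀ p ∈ P, p.Prime) {K : ℕ} {κ : ℝ} (hκ : κ ≤ K + 1) :
    sieveForm P K ≤ 2 * Real.exp 8 * ∏ p ∈ P, (1 - (p : ℝ)⁻¹) +
      2 * Real.exp (-2 * κ) * Real.exp (20 * ∑ p ∈ P, (p : ℝ)⁻¹) := by
  have he : Real.exp 1 < 2.7182818286 := Real.exp_one_lt_d9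
  have he0 : 0 < Real.exp 1 := Real.exp_pos 1
  have hinv : ∀ p ∈ P, 0 < (p : ℝ)⁻¹ ∧ (p : ℝ)⁻¹ ≤ 1 / 2 := fun p hp => by
    have := (hP p hp).pos
    refine ⟨by positivity, ?_⟩
    rw [one_div]; exact inv_anti₀ (by norm_num) (by exact_mod_cast (hP p hp).two_le)
  have h1 : sieveForm P K ≤ ∑ A ∈ P.powerset, (2 * ((∏ p ∈ A, (((p : ℝ) + 1) * (p : ℝ)⁻¹ ^ 2)) *
      ∏ p ∈ P \ A, (1 - (p : ℝ)⁻¹) ^ 2) + 2 * (Real.exp (-κ) * ∏ p ∈ P, (1 + Real.exp 1 * (p : ℝ)⁻¹)) ^ 2 *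
        ∏ p ∈ A, (((p : ℝ) + 1) * (Real.exp 1 * (p : ℝ)⁻¹) ^ 2)) := by
    refine Finset.sum_le_sum fun A hA => ?_
    have h2 := abs_sieveCoeff_sub_le (Finset.mem_powerset.1 hA) hκ
    have hprod : 0 ≤ ∏ p ∈ A, ((p : ℝ) + 1) := Finset.prod_nonneg fun p _ => by positivity
    set f := (∏ p ∈ A, (-(p : ℝ)⁻¹)) * ∏ p ∈ P \ A, (1 - (p : ℝ)⁻¹) with hf
    set r := Real.exp (-κ) * ((∏ p ∈ A, (Real.exp 1 * (p : ℝ)⁻¹)) * ∏ p ∈ P, (1 + Real.exp 1 * (p : ℝ)⁻¹)) with hr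
    have h3 : (sieveCoeff P K A - f) ^ 2 ≤ r ^ 2 := by
      rw [← sq_abs]; exact pow_le_pow_left₀ (abs_nonneg _) h2 2
    have h4 : sieveCoeff P K A ^ 2 ≤ 2 * f ^ 2 + 2 * r ^ 2 := by
      nlinarith [sq_nonneg (sieveCoeff P K A - f - f)]
    have h5 : (∏ p ∈ A, ((p : ℝ) + 1)) * f ^ 2 = (∏ p ∈ A, (((p : ℝ) + 1) * (p : ℝ)⁻¹ ^ 2)) *
        ∏ p ∈ P \ A, (1 - (p : ℝ)⁻¹) ^ 2 := by
      rw [Finset.prod_mul_distrib, hf, mul_pow, ← Finset.prod_pow, ← Finset.prod_pow]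
      simp only [neg_sq]
      ring
    have h6 : (∏ p ∈ A, ((p : ℝ) + 1)) * r ^ 2 = (Real.exp (-κ) * ∏ p ∈ P, (1 + Real.exp 1 * (p : ℝ)⁻¹)) ^ 2 *
        ∏ p ∈ A, (((p : ℝ) + 1) * (Real.exp 1 * (p : ℝ)⁻¹) ^ 2) := by
      rw [Finset.prod_mul_distrib, Finset.prod_pow, hr]
      ring
    calc _ ≤ (∏ p ∈ A, ((p : ℝ) + 1)) * (2 * f ^ 2 + 2 * r ^ 2) := mul_le_mul_of_nonneg_left h4 hprod
      _ = 2 * ((∏ p ∈ A, ((p : ℝ) + 1)) * f ^ 2) + 2 * ((∏ p ∈ A, ((p : ℝ) + 1)) * r ^ 2) := by ring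
      _ = _ := by rw [h5, h6]; ring
  rw [Finset.sum_add_distrib, ← Finset.mul_sum, ← Finset.mul_sum, ← Finset.prod_add, ← Finset.prod_one_add] at h1
  refine h1.trans (add_le_add ?_ ?_)
  · rw [mul_assoc]
    refine mul_le_mul_of_nonneg_left ?_ (by norm_num)
    have h7 : Real.exp (∑ p ∈ P, 4 * ((p : ℝ)⁻¹) ^ 2) ≤ Real.exp 8 := by
      rw [← Finset.mul_sum]
      exact Real.exp_le_exp.2 (by linarith [sum_inv_sq_le P])
    have hnn : 0 ≤ ∏ p ∈ P, (1 - (p : ℝ)⁻¹) :=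
      Finset.prod_nonneg fun p hp => by linarith [(hinv p hp).2]
    refine le_trans ?_ (mul_le_mul_of_nonneg_right h7 hnn)
    rw [Real.exp_sum, ← Finset.prod_mul_distrib]
    refine Finset.prod_le_prod (fun p _ => by positivity) fun p hp => ?_
    obtain ⟨a1, a2⟩ := hinv p hp
    have h0 : (p : ℝ) ≠ 0 := by have := (hP p hp).pos; positivity
    have e : ((p : ℝ) + 1) * (p : ℝ)⁻¹ ^ 2 = (p : ℝ)⁻¹ + (p : ℝ)⁻¹ ^ 2 := by field_simp
    rw [e]
    set x := (p : ℝ)⁻¹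
    have a3 : 4 * x ^ 2 + 1 ≤ Real.exp (4 * x ^ 2) := Real.add_one_le_exp _
    have a4 : (4 * x ^ 2 + 1) * (1 - x) ≤ Real.exp (4 * x ^ 2) * (1 - x) :=
      mul_le_mul_of_nonneg_right a3 (by linarith)
    nlinarith [mul_nonneg (sq_nonneg x) (by linarith : (0:ℝ) ≤ 1 - 2 * x)]
  · have h8 : (Real.exp (-κ) * ∏ p ∈ P, (1 + Real.exp 1 * (p : ℝ)⁻¹)) ^ 2 =
        Real.exp (-2 * κ) * ∏ p ∈ P, (1 + Real.exp 1 * (p : ℝ)⁻¹) ^ 2 := by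
      rw [mul_pow, Finset.prod_pow, ← Real.exp_nat_mul]; congr 2; push_cast; ring
    rw [h8, mul_assoc, mul_assoc, mul_assoc, ← Finset.prod_mul_distrib, Finset.mul_sum, Real.exp_sum]
    refine mul_le_mul_of_nonneg_left (mul_le_mul_of_nonneg_left ?_ (Real.exp_pos _).le) (by norm_num)
    refine Finset.prod_le_prod (fun p _ => by positivity) fun p hp => ?_
    obtain ⟨a1, a2⟩ := hinv p hp
    have h0 : (p : ℝ) ≠ 0 := by have := (hP p hp).pos; positivity
    have e : ((p : ℝ) + 1) * (Real.exp 1 * (p : ℝ)⁻¹) ^ 2 = Real.exp 1 ^ 2 * ((p : ℝ)⁻¹ + (p : ℝ)⁻¹ ^ 2) := by field_simp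
    rw [e]
    set x := (p : ℝ)⁻¹
    set E := Real.exp 1
    have hE2 : E ^ 2 ≤ 7.5 := by nlinarith
    have b1 : (1 + E * x) ^ 2 ≤ Real.exp (2 * (E * x)) := by
      have := Real.add_one_le_exp (E * x)
      rw [two_mul, Real.exp_add, ← sq]
      exact pow_le_pow_left₀ (by positivity) (by linarith) 2
    have b2 : 1 + E ^ 2 * (x + x ^ 2) ≤ Real.exp (12 * x) := by
      have := Real.add_one_le_exp (12 * x)
      have c1 : x + x ^ 2 ≤ 1.5 * x := by nlinarith
      have c2 : E ^ 2 * (x + x ^ 2) ≤ 7.5 * (1.5 * x) := mul_le_mul hE2 c1 (by positivity) (by norm_num)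
      linarith
    calc _ ≤ Real.exp (2 * (E * x)) * Real.exp (12 * x) := mul_le_mul b1 b2 (by positivity) (Real.exp_pos _).le
      _ = Real.exp (2 * (E * x) + 12 * x) := by rw [Real.exp_add]
      _ ≤ _ := Real.exp_le_exp.2 (by nlinarith)

/-- The alternating sum over the subsets of size at most `K` of the set of primes of `P` dividing `n`
vanishes unless there are no such primes or more than `K` of them. The second term bounds the latter
case by Rankin's trick; since `0 ^ 0 = 1`, the first is the indicator of the former. -/
theorem sq_sum_truncatedPowerset_le {P : Finset ℕ} (hP : ∀ p ∈ P, p.Prime) {K : ℕ} {κ : ℝ} (hκ : κ ≤ K + 1)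
    {n : ℕ} (hn : n ≠ 0) :
    (∑ A ∈ truncatedPowerset P K with (∏ p ∈ A, p) ∣ n, (-1 : ℝ) ^ A.card) ^ 2 ≤
      0 ^ (P ∩ n.primeFactors).card + Real.exp (-κ) * (4 * Real.exp 1) ^ (P ∩ n.primeFactors).card := by
  have he : (truncatedPowerset P K).filter (fun A => (∏ p ∈ A, p) ∣ n) =
      (P ∩ n.primeFactors).powerset.filter fun A => A.card ≤ K := by
    ext A
    simp only [truncatedPowerset, Finset.mem_filter, Finset.mem_powerset, Finset.subset_inter_iff]
    constructor
    · rintro ⟨⟨h1, h2⟩, h3⟩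
      refine ⟨⟨h1, fun p hp => ?_⟩, h2⟩
      exact Nat.mem_primeFactors.2 ⟨hP p (h1 hp), (Finset.dvd_prod_of_mem _ hp).trans h3, hn⟩
    · rintro ⟨⟨h1, h2⟩, h3⟩
      refine ⟨⟨h1, h3⟩, ?_⟩
      refine Finset.prod_primes_dvd n (fun p hp => (hP p (h1 hp)).prime) fun p hp => ?_
      exact Nat.dvd_of_mem_primeFactors (h2 hp)
  rw [he]
  set R := P ∩ n.primeFactors
  have hpos : 0 ≤ Real.exp (-κ) * (4 * Real.exp 1) ^ R.card := by positivity
  rcases le_or_gt R.card K with h | h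
  · have h1 : R.powerset.filter (fun A => A.card ≤ K) = R.powerset :=
      Finset.filter_true_of_mem fun A hA => (Finset.card_le_card (Finset.mem_powerset.1 hA)).trans h
    have h2 : ∑ A ∈ R.powerset, (-1 : ℝ) ^ A.card = 0 ^ R.card := by
      have := Finset.prod_one_add R (f := fun _ : ℕ => (-1 : ℝ))
      simp only [Finset.prod_const] at this
      rw [← this]; norm_num
    rw [h1, h2]
    refine le_trans (le_of_eq ?_) (le_add_of_nonneg_right hpos)
    rcases Nat.eq_zero_or_pos R.card with h3 | h3
    · rw [h3]; norm_num
    · rw [zero_pow h3.ne']; norm_num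
  · have h1 : |∑ A ∈ R.powerset with A.card ≤ K, (-1 : ℝ) ^ A.card| ≤ 2 ^ R.card := by
      refine (Finset.abs_sum_le_sum_abs _ _).trans ?_
      simp only [abs_pow, abs_neg, abs_one, one_pow, Finset.sum_const, nsmul_eq_mul, mul_one]
      have := (Finset.card_filter_le R.powerset (fun A => A.card ≤ K))
      rw [Finset.card_powerset] at this
      exact_mod_cast this
    have h2 : (∑ A ∈ R.powerset with A.card ≤ K, (-1 : ℝ) ^ A.card) ^ 2 ≤ 4 ^ R.card := by
      rw [← sq_abs]
      refine (pow_le_pow_left₀ (abs_nonneg _) h1 2).trans (le_of_eq ?_)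
      rw [← pow_mul, mul_comm, pow_mul]; norm_num
    refine h2.trans (le_add_of_nonneg_of_le (by positivity) ?_)
    rw [mul_pow, mul_left_comm, ← Real.exp_nat_mul, ← Real.exp_add]
    refine le_mul_of_one_le_right (by positivity) (Real.one_le_exp ?_)
    have h3 : (K : ℝ) + 1 ≤ R.card := by exact_mod_cast h
    linarith

end TruncatedSieve

/-! ### The mollifier over two ranges of primes -/

section TwoRanges

/-- The index set of the mollifier: pairs of small sets of primes from two ranges. -/
def mollifierIndex (P₁ P₂ : Finset ℕ) (K₁ K₂ : ℕ) : Finset (Finset ℕ × Finset ℕ) :=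
  truncatedPowerset P₁ K₁ ×ˢ truncatedPowerset P₂ K₂

/-- The squarefree number with the given prime factors, for a pair of disjoint sets of primes. -/
def mollifierArg (A : Finset ℕ × Finset ℕ) : ℕ := ∏ p ∈ A.1 ∪ A.2, p

/-- The Möbius function of `mollifierArg A`. -/
def mollifierSign (A : Finset ℕ × Finset ℕ) : ℝ := (-1) ^ A.1.card * (-1) ^ A.2.card

variable {P₁ P₂ : Finset ℕ} {K₁ K₂ : ℕ}

theorem mem_mollifierIndex {A : Finset ℕ × Finset ℕ} :
    A ∈ mollifierIndex P₁ P₂ K₁ K₂ ↔ (A.1 ⊆ P₁ ∧ A.1.card ≤ K₁) ∧ A.2 ⊆ P₂ ∧ A.2.card ≤ K₂ := by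
  simp [mollifierIndex, truncatedPowerset]

theorem mollifierArg_eq (h : Disjoint P₁ P₂) {A : Finset ℕ × Finset ℕ} (hA : A ∈ mollifierIndex P₁ P₂ K₁ K₂) :
    mollifierArg A = (∏ p ∈ A.1, p) * ∏ p ∈ A.2, p := by
  rw [mem_mollifierIndex] at hA
  exact Finset.prod_union (Finset.disjoint_of_subset_left hA.1.1 (Finset.disjoint_of_subset_right hA.2.1 h))

theorem mollifierArg_pos (h1 : ∀ p ∈ P₁, p.Prime) (h2 : ∀ p ∈ P₂, p.Prime) {A : Finset ℕ × Finset ℕ}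
    (hA : A ∈ mollifierIndex P₁ P₂ K₁ K₂) : 0 < mollifierArg A := by
  rw [mem_mollifierIndex] at hA
  refine Finset.prod_pos fun p hp => ?_
  rcases Finset.mem_union.1 hp with h | h
  · exact (h1 p (hA.1.1 h)).pos
  · exact (h2 p (hA.2.1 h)).pos

theorem union_subset_union_iff_of_disjoint (h : Disjoint P₁ P₂) {A₁ A₂ B₁ B₂ : Finset ℕ} (hA₁ : A₁ ⊆ P₁)
    (hA₂ : A₂ ⊆ P₂) (hB₁ : B₁ ⊆ P₁) (hB₂ : B₂ ⊆ P₂) : A₁ ∪ A₂ ⊆ B₁ ∪ B₂ ↔ A₁ ⊆ B₁ ∧ A₂ ⊆ B₂ := by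
  rw [Finset.disjoint_left] at h
  constructor
  · intro hs
    refine ⟨fun x hx => ?_, fun x hx => ?_⟩
    · rcases Finset.mem_union.1 (hs (Finset.mem_union_left _ hx)) with h' | h'
      · exact h'
      · exact absurd (hB₂ h') (h (hA₁ hx))
    · rcases Finset.mem_union.1 (hs (Finset.mem_union_right _ hx)) with h' | h'
      · exact absurd (hA₂ hx) (h (hB₁ h'))
      · exact h'
  · rintro ⟨h1, h2⟩
    exact Finset.union_subset_union h1 h2

theorem sum_powerset_union_of_disjoint (h : Disjoint P₁ P₂) (f : Finset ℕ → ℝ) :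
    ∑ A ∈ (P₁ ∪ P₂).powerset, f A = ∑ A₁ ∈ P₁.powerset, ∑ A₂ ∈ P₂.powerset, f (A₁ ∪ A₂) := by
  rw [← Finset.sum_product']
  refine (Finset.sum_nbij (fun A : Finset ℕ × Finset ℕ => A.1 ∪ A.2) ?_ ?_ ?_ fun _ _ => rfl).symm
  · rintro ⟨A₁, A₂⟩ hA
    simp only [Finset.mem_product, Finset.mem_powerset] at hA ⊢
    exact Finset.union_subset_union hA.1 hA.2
  · rintro ⟨A₁, A₂⟩ hA ⟨B₁, B₂⟩ hB hAB
    simp only [Finset.coe_product, Finset.coe_powerset, Set.mem_prod, Set.mem_preimage, Set.mem_powerset_iff,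
      Finset.coe_subset] at hA hB hAB
    have h1 := (union_subset_union_iff_of_disjoint h hA.1 hA.2 hB.1 hB.2).1 hAB.subset
    have h2 := (union_subset_union_iff_of_disjoint h hB.1 hB.2 hA.1 hA.2).1 hAB.symm.subset
    rw [h1.1.antisymm h2.1, h1.2.antisymm h2.2]
  · intro A hA
    simp only [Finset.coe_powerset, Set.mem_preimage, Set.mem_powerset_iff, Finset.coe_subset] at hA
    refine ⟨(A ∩ P₁, A ∩ P₂), ?_, ?_⟩
    · simp only [Finset.coe_product, Finset.coe_powerset, Set.mem_prod, Set.mem_preimage, Set.mem_powerset_iff,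
        Finset.coe_subset]
      exact ⟨Finset.inter_subset_right, Finset.inter_subset_right⟩
    · simp only
      rw [← Finset.inter_union_distrib_left, Finset.inter_eq_left.2 hA]

theorem gcdFormBound_mollifier (h1 : ∀ p ∈ P₁, p.Prime) (h2 : ∀ p ∈ P₂, p.Prime) (h : Disjoint P₁ P₂) :
    GcdFormBound (mollifierIndex P₁ P₂ K₁ K₂) mollifierArg mollifierSign (sieveForm P₁ K₁ * sieveForm P₂ K₂) := by
  have hP : ∀ p ∈ P₁ ∪ P₂, p.Prime := fun p hp => (Finset.mem_union.1 hp).elim (h1 p) (h2 p)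
  have key := gcdFormBound_of_prod (B := mollifierIndex P₁ P₂ K₁ K₂) (S := fun A => A.1 ∪ A.2)
    (c := mollifierSign) hP (fun A hA => by
      rw [mem_mollifierIndex] at hA
      exact Finset.union_subset_union hA.1.1 hA.2.1)
  have e : ∑ A ∈ (P₁ ∪ P₂).powerset, (∏ p ∈ A, ((p : ℝ) + 1)) *
        (∑ i ∈ mollifierIndex P₁ P₂ K₁ K₂ with A ⊆ i.1 ∪ i.2, mollifierSign i / ((∏ p ∈ i.1 ∪ i.2, p : ℕ) : ℝ)) ^ 2 =
      sieveForm P₁ K₁ * sieveForm P₂ K₂ := by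
    rw [sum_powerset_union_of_disjoint h, sieveForm, sieveForm, Finset.sum_mul_sum]
    refine Finset.sum_congr rfl fun A₁ hA₁ => Finset.sum_congr rfl fun A₂ hA₂ => ?_
    rw [Finset.mem_powerset] at hA₁ hA₂
    have e1 : (mollifierIndex P₁ P₂ K₁ K₂).filter (fun i => A₁ ∪ A₂ ⊆ i.1 ∪ i.2) =
        (truncatedPowerset P₁ K₁).filter (fun E => A₁ ⊆ E) ×ˢ (truncatedPowerset P₂ K₂).filter (fun E => A₂ ⊆ E) := by
      ext ⟨B₁, B₂⟩
      simp only [Finset.mem_filter, Finset.mem_product, mem_mollifierIndex, truncatedPowerset, Finset.mem_powerset]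
      constructor
      · rintro ⟨⟨a, b⟩, hs⟩
        have := (union_subset_union_iff_of_disjoint h hA₁ hA₂ a.1 b.1).1 hs
        exact ⟨⟨a, this.1⟩, b, this.2⟩
      · rintro ⟨⟨a, c⟩, b, d⟩
        exact ⟨⟨a, b⟩, Finset.union_subset_union c d⟩
    have e2 : ∑ i ∈ mollifierIndex P₁ P₂ K₁ K₂ with A₁ ∪ A₂ ⊆ i.1 ∪ i.2, mollifierSign i / ((∏ p ∈ i.1 ∪ i.2, p : ℕ) : ℝ) =
        sieveCoeff P₁ K₁ A₁ * sieveCoeff P₂ K₂ A₂ := by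
      rw [e1, Finset.sum_product, sieveCoeff, sieveCoeff, Finset.sum_mul_sum]
      refine Finset.sum_congr rfl fun B₁ hB₁ => Finset.sum_congr rfl fun B₂ hB₂ => ?_
      simp only [Finset.mem_filter, truncatedPowerset, Finset.mem_powerset] at hB₁ hB₂
      rw [Finset.prod_union (Finset.disjoint_of_subset_left hB₁.1.1 (Finset.disjoint_of_subset_right hB₂.1.1 h)),
        mollifierSign, Nat.cast_mul, mul_div_mul_comm]
    rw [e2, Finset.prod_union (Finset.disjoint_of_subset_left hA₁ (Finset.disjoint_of_subset_right hA₂ h))]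
    ring
  rw [e] at key
  exact key

/-- The case of the constant function `1` of the gcd. -/
theorem GcdFormBound.sq_sum_div_le {ι : Type*} {B : Finset ι} {d : ι → ℕ} {c : ι → ℝ} {Q : ℝ}
    (h : GcdFormBound B d c Q) : (∑ i ∈ B, c i / d i) ^ 2 ≤ Q := by
  have := h (fun _ => 1) 1 zero_le_one (fun e he => ⟨zero_le_one, by
    rw [mul_one]; exact_mod_cast he⟩)
  simp only [mul_one, one_mul] at this
  rwa [sq, Finset.sum_mul_sum]

theorem divisorSum_mollifier (h1 : ∀ p ∈ P₁, p.Prime) (h2 : ∀ p ∈ P₂, p.Prime) (h : Disjoint P₁ P₂) (n : ℕ) :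
    divisorSum (mollifierIndex P₁ P₂ K₁ K₂) mollifierArg mollifierSign n =
      (∑ A ∈ truncatedPowerset P₁ K₁ with (∏ p ∈ A, p) ∣ n, (-1 : ℝ) ^ A.card) *
      ∑ A ∈ truncatedPowerset P₂ K₂ with (∏ p ∈ A, p) ∣ n, (-1 : ℝ) ^ A.card := by
  have e1 : (mollifierIndex P₁ P₂ K₁ K₂).filter (fun i => mollifierArg i ∣ n) =
      (truncatedPowerset P₁ K₁).filter (fun A => (∏ p ∈ A, p) ∣ n) ×ˢ
        (truncatedPowerset P₂ K₂).filter (fun A => (∏ p ∈ A, p) ∣ n) := by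
    ext ⟨B₁, B₂⟩
    simp only [Finset.mem_filter, Finset.mem_product]
    have hmem : (B₁, B₂) ∈ mollifierIndex P₁ P₂ K₁ K₂ ↔ B₁ ∈ truncatedPowerset P₁ K₁ ∧ B₂ ∈ truncatedPowerset P₂ K₂ := by
      simp [mollifierIndex]
    constructor
    · rintro ⟨a, b⟩
      rw [mollifierArg_eq h a] at b
      exact ⟨⟨(hmem.1 a).1, (dvd_mul_right _ _).trans b⟩, (hmem.1 a).2, (dvd_mul_left _ _).trans b⟩
    · rintro ⟨⟨a, c⟩, b, d⟩
      have hm := hmem.2 ⟨a, b⟩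
      refine ⟨hm, ?_⟩
      rw [mollifierArg_eq h hm]
      rw [mem_mollifierIndex] at hm
      refine Nat.Coprime.mul_dvd_of_dvd_of_dvd ?_ c d
      refine Nat.Coprime.prod_left fun p hp => Nat.Coprime.prod_right fun q hq => ?_
      refine (Nat.coprime_primes (h1 p (hm.1.1 hp)) (h2 q (hm.2.1 hq))).2 fun hpq => ?_
      exact Finset.disjoint_left.1 h (hm.1.1 hp) (hpq ▸ hm.2.1 hq)
  rw [divisorSum, e1, Finset.sum_product, Finset.sum_mul_sum]
  rfl

theorem divisorSum_mollifier_one (h1 : ∀ p ∈ P₁, p.Prime) (h2 : ∀ p ∈ P₂, p.Prime) (h : Disjoint P₁ P₂) :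
    divisorSum (mollifierIndex P₁ P₂ K₁ K₂) mollifierArg mollifierSign 1 = 1 := by
  have key : ∀ {P : Finset ℕ} {K : ℕ}, (∀ p ∈ P, p.Prime) →
      ∑ A ∈ truncatedPowerset P K with (∏ p ∈ A, p) ∣ 1, (-1 : ℝ) ^ A.card = 1 := by
    intro P K hP
    have : (truncatedPowerset P K).filter (fun A => (∏ p ∈ A, p) ∣ 1) = {∅} := by
      ext A
      simp only [truncatedPowerset, Finset.mem_filter, Finset.mem_powerset, Finset.mem_singleton]
      constructor
      · rintro ⟨⟨a, -⟩, b⟩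
        by_contra hne
        obtain ⟨p, hp⟩ := Finset.nonempty_iff_ne_empty.2 hne
        exact (hP p (a hp)).one_lt.ne' (Nat.dvd_one.1 ((Finset.dvd_prod_of_mem _ hp).trans b))
      · rintro rfl
        simp
    rw [this]; simp
  rw [divisorSum_mollifier h1 h2 h, key h1, key h2, one_mul]

end TwoRanges

/-! ### Finite Euler products -/

section EulerProducts

/-- A finite part of an Euler product, for nonnegative functions that depend only on the set of prime
factors. -/
theorem sum_prod_primeFactors_mul_rpow_le {g : ℕ → ℝ} (hg : ∀ p, 0 ≤ g p) {s : ℝ} (hs : 0 < s) (N : ℕ) :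
    ∑ n ∈ Finset.Ico 1 N, (∏ p ∈ n.primeFactors, g p) * (n : ℝ) ^ (-s) ≤
      ∏ p ∈ N.primesBelow, (1 + g p / ((p : ℝ) ^ s - 1)) := by
  set f : ℕ → ℝ := fun n => if n = 0 then 0 else (∏ p ∈ n.primeFactors, g p) * (n : ℝ) ^ (-s) with hf
  have hf0 : ∀ n, 0 ≤ f n := fun n => by
    simp only [hf]; split_ifs
    · exact le_rfl
    · exact mul_nonneg (Finset.prod_nonneg fun p _ => hg p) (by positivity)
  have hf1 : f 1 = 1 := by simp [hf]
  have hmul : ∀ {m n : ℕ}, m.Coprime n → f (m * n) = f m * f n := by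
    intro m n hmn
    rcases eq_or_ne m 0 with rfl | hm
    · simp [hf]
    rcases eq_or_ne n 0 with rfl | hn
    · simp [hf]
    simp only [hf, hm, hn, Nat.mul_eq_zero, or_self, if_false]
    rw [hmn.primeFactors_mul, Finset.prod_union hmn.disjoint_primeFactors, Nat.cast_mul,
      Real.mul_rpow (by positivity) (by positivity)]
    ring
  have hpow : ∀ {p : ℕ}, p.Prime → HasSum (fun k : ℕ => f (p ^ k)) (1 + g p / ((p : ℝ) ^ s - 1)) := by
    intro p hp
    have hp0 : (0:ℝ) < p := by exact_mod_cast hp.pos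
    have hp1 : (1:ℝ) < p := by exact_mod_cast hp.one_lt
    set x : ℝ := (p : ℝ) ^ (-s) with hx
    have hx0 : 0 < x := by positivity
    have hx1 : x < 1 := Real.rpow_lt_one_of_one_lt_of_neg hp1 (by linarith)
    have h1 : ∀ k : ℕ, f (p ^ (k + 1)) = g p * x * x ^ k := by
      intro k
      have : p ^ (k + 1) ≠ 0 := pow_ne_zero _ hp.ne_zero
      simp only [hf, this, if_false]
      rw [Nat.primeFactors_prime_pow (Nat.succ_ne_zero k) hp, Finset.prod_singleton, Nat.cast_pow, hx,
        ← Real.rpow_natCast, ← Real.rpow_mul hp0.le, mul_comm ((k + 1 : ℕ) : ℝ), Real.rpow_mul hp0.le, Real.rpow_natCast]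
      ring
    have h2 : HasSum (fun k : ℕ => f (p ^ (k + 1))) (g p * x * (1 - x)⁻¹) := by
      simp only [h1]
      exact (hasSum_geometric_of_lt_one hx0.le hx1).mul_left _
    have h3 := (hasSum_nat_add_iff (f := fun k : ℕ => f (p ^ k)) 1).1 h2
    simp only [Finset.sum_range_one, pow_zero, hf1] at h3
    refine Eq.mp ?_ h3
    congr 1
    have e : (p : ℝ) ^ s = x⁻¹ := by rw [hx, Real.rpow_neg hp0.le, inv_inv]
    have hx2 : 1 - x ≠ 0 := by linarith
    have hx3 : x⁻¹ - 1 ≠ 0 := by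
      have := (one_lt_inv₀ hx0).2 hx1; linarith
    rw [e, add_comm]
    congr 1
    field_simp
  have hsum : ∀ {p : ℕ}, p.Prime → Summable fun n : ℕ => ‖f (p ^ n)‖ := fun hp => by
    simp only [Real.norm_of_nonneg (hf0 _)]
    exact (hpow hp).summable
  have hE := (EulerProduct.summable_and_hasSum_smoothNumbers_prod_primesBelow_tsum hf1 hmul hsum N).2
  have e2 : ∏ p ∈ N.primesBelow, ∑' n : ℕ, f (p ^ n) = ∏ p ∈ N.primesBelow, (1 + g p / ((p : ℝ) ^ s - 1)) :=
    Finset.prod_congr rfl fun p hp => (hpow (Nat.prime_of_mem_primesBelow hp)).tsum_eq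
  rw [e2] at hE
  have hmem : ∀ n ∈ Finset.Ico 1 N, n ∈ N.smoothNumbers := by
    intro n hn
    rw [Finset.mem_Ico] at hn
    refine Nat.mem_smoothNumbers_of_lt (by omega) hn.2
  have hE' : HasSum (N.smoothNumbers.indicator f) _ := hasSum_subtype_iff_indicator.1 hE
  have h3 := sum_le_hasSum (Finset.Ico 1 N) (fun i _ => Set.indicator_nonneg (fun a _ => hf0 a) i) hE'
  refine le_trans (le_of_eq (Finset.sum_congr rfl fun n hn => ?_)) h3
  rw [Set.indicator_of_mem (hmem n hn)]
  rw [Finset.mem_Ico] at hn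
  simp only [hf]
  rw [if_neg (by omega)]

theorem sum_prod_primeFactors_mul_rpow_le_exp {g : ℕ → ℝ} (hg : ∀ p, 0 ≤ g p) {s : ℝ} (hs : 0 < s) (N : ℕ) :
    ∑ n ∈ Finset.Ico 1 N, (∏ p ∈ n.primeFactors, g p) * (n : ℝ) ^ (-s) ≤
      Real.exp (∑ p ∈ N.primesBelow, g p / ((p : ℝ) ^ s - 1)) := by
  refine (sum_prod_primeFactors_mul_rpow_le hg hs N).trans ?_
  rw [Real.exp_sum]
  refine Finset.prod_le_prod (fun p hp => ?_) fun p _ => ?_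
  · have h1 : (1:ℝ) < p := by exact_mod_cast (Nat.prime_of_mem_primesBelow hp).one_lt
    have h2 := Real.one_lt_rpow h1 hs
    have := div_nonneg (hg p) (by linarith : 0 ≤ (p : ℝ) ^ s - 1)
    linarith
  · rw [add_comm]; exact Real.add_one_le_exp _

end EulerProducts

/-! ### Sums over primes -/

section PrimeSums

/-- Chebyshev's bound for the number of primes in a dyadic block. -/
theorem card_mul_le_of_log_eq {P : Finset ℕ} (hP : ∀ p ∈ P, p.Prime) {k : ℕ} (hk : ∀ p ∈ P, Nat.log 2 p = k) :
    (P.card : ℝ) * k ≤ 4 * 2 ^ k := by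
  have hlog2 : 0 < Real.log 2 := Real.log_pos one_lt_two
  have h1 : (P.card : ℝ) * (k * Real.log 2) ≤ Chebyshev.theta ((2:ℝ) ^ (k + 1)) := by
    calc (P.card : ℝ) * (k * Real.log 2) = ∑ p ∈ P, k * Real.log 2 := by simp
      _ ≤ ∑ p ∈ P, Real.log p := by
        refine Finset.sum_le_sum fun p hp => ?_
        rw [← Real.log_pow]
        refine Real.log_le_log (by positivity) ?_
        have := Nat.pow_log_le_self 2 (hP p hp).ne_zero
        rw [hk p hp] at this
        exact_mod_cast this
      _ ≤ _ := by
        rw [Chebyshev.theta]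
        refine Finset.sum_le_sum_of_subset_of_nonneg (fun p hp => ?_) fun p hp _ => ?_
        · rw [Finset.mem_filter, Finset.mem_Ioc]
          refine ⟨⟨(hP p hp).pos, Nat.le_floor ?_⟩, hP p hp⟩
          have := (Nat.lt_pow_succ_log_self one_lt_two p).le
          rw [hk p hp] at this
          exact_mod_cast this
        · rw [Finset.mem_filter, Finset.mem_Ioc] at hp
          exact Real.log_nonneg (by exact_mod_cast hp.2.one_le)
  have h2 := h1.trans (Chebyshev.theta_le_log4_mul_x (by positivity))
  have h3 : Real.log 4 = 2 * Real.log 2 := by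
    rw [show (4:ℝ) = 2 ^ 2 by norm_num, Real.log_pow]; norm_num
  rw [h3, pow_succ] at h2
  nlinarith

theorem sum_inv_le_of_log_eq {P : Finset ℕ} (hP : ∀ p ∈ P, p.Prime) {k : ℕ} (hk0 : 1 ≤ k)
    (hk : ∀ p ∈ P, Nat.log 2 p = k) : ∑ p ∈ P, (p : ℝ)⁻¹ ≤ 4 / k := by
  have hk1 : (0:ℝ) < k := by exact_mod_cast hk0
  calc ∑ p ∈ P, (p : ℝ)⁻¹ ≤ ∑ p ∈ P, ((2:ℝ) ^ k)⁻¹ := by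
        refine Finset.sum_le_sum fun p hp => inv_anti₀ (by positivity) ?_
        have := Nat.pow_log_le_self 2 (hP p hp).ne_zero
        rw [hk p hp] at this
        exact_mod_cast this
    _ = P.card / 2 ^ k := by rw [Finset.sum_const, nsmul_eq_mul, div_eq_mul_inv]
    _ ≤ 4 / k := by
        rw [div_le_div_iff₀ (by positivity) hk1]
        exact card_mul_le_of_log_eq hP hk

theorem sum_Icc_inv_le {a m : ℕ} (ha : 1 ≤ a) (ham : a ≤ m) :
    ∑ k ∈ Finset.Icc a m, (k : ℝ)⁻¹ ≤ 1 + Real.log (m / a) := by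
  have ha0 : (0:ℝ) < a := by exact_mod_cast ha
  induction m, ham using Nat.le_induction with
  | base =>
    rw [Finset.Icc_self, Finset.sum_singleton, div_self ha0.ne', Real.log_one, add_zero]
    exact inv_le_one_of_one_le₀ (by exact_mod_cast ha)
  | succ m ham ih =>
    have hm0 : (0:ℝ) < m := by exact_mod_cast (ha.trans ham)
    rw [Finset.sum_Icc_succ_top (by omega)]
    have h1 := Real.one_sub_inv_le_log_of_pos (show (0:ℝ) < (m + 1) / m by positivity)
    rw [inv_div, one_sub_div (by positivity), add_sub_cancel_left, Real.log_div (by positivity) (by positivity)] at h1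
    rw [Real.log_div (by positivity) (by positivity)] at ih ⊢
    push_cast
    rw [one_div] at h1
    linarith

/-- The upper half of Mertens' second theorem over an interval, with the constant `4` in place of `1`. -/
theorem sum_inv_prime_le {P : Finset ℕ} (hP : ∀ p ∈ P, p.Prime) {y x : ℝ} (hy : 2 ≤ y) (hyx : y ≤ x)
    (hPy : ∀ p ∈ P, y ≤ p) (hPx : ∀ p ∈ P, (p : ℝ) ≤ x) :
    ∑ p ∈ P, (p : ℝ)⁻¹ ≤ 4 * Real.log (Real.log x / Real.log y) + 8 := by
  have hlog2 : 0 < Real.log 2 := Real.log_pos one_lt_two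
  have hlogy : 0 < Real.log y := Real.log_pos (by linarith)
  have hlogx : 0 < Real.log x := Real.log_pos (by linarith)
  set a := ⌊Real.log y / Real.log 2⌋₊ with ha
  set m := ⌊Real.log x / Real.log 2⌋₊ with hm
  have hu : 1 ≤ Real.log y / Real.log 2 := by
    rw [le_div_iff₀ hlog2, one_mul]; exact Real.log_le_log two_pos hy
  have ha1 : 1 ≤ a := Nat.le_floor (by exact_mod_cast hu)
  have ham : a ≤ m := Nat.floor_mono (by gcongr)
  have ha2 : Real.log y / Real.log 2 / 2 ≤ a := by
    have := Nat.lt_floor_add_one (Real.log y / Real.log 2)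
    have : (1:ℝ) ≤ a := by exact_mod_cast ha1
    linarith
  have hm2 : (m : ℝ) ≤ Real.log x / Real.log 2 := Nat.floor_le (by positivity)
  have hmaps : ∀ p ∈ P, Nat.log 2 p ∈ Finset.Icc a m := by
    intro p hp
    have hp0 : (0:ℝ) < p := by exact_mod_cast (hP p hp).pos
    rw [Finset.mem_Icc]
    constructor
    · refine Nat.le_log_of_pow_le one_lt_two ?_
      have h1 : Real.log ((2:ℝ) ^ a) ≤ Real.log p := by
        rw [Real.log_pow]
        have := Nat.floor_le (show 0 ≤ Real.log y / Real.log 2 by positivity)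
        rw [le_div_iff₀ hlog2] at this
        exact this.trans (Real.log_le_log (by linarith) (hPy p hp))
      have := (Real.log_le_log_iff (by positivity) hp0).1 h1
      exact_mod_cast this
    · refine Nat.le_floor ?_
      rw [le_div_iff₀ hlog2, ← Real.log_pow]
      refine Real.log_le_log (by positivity) (le_trans ?_ (hPx p hp))
      exact_mod_cast Nat.pow_log_le_self 2 (hP p hp).ne_zero
  have ha0 : (0:ℝ) < a := by exact_mod_cast ha1
  have hm0 : (0:ℝ) < m := by exact_mod_cast (ha1.trans ham)
  calc ∑ p ∈ P, (p : ℝ)⁻¹ = ∑ k ∈ Finset.Icc a m, ∑ p ∈ P with Nat.log 2 p = k, (p : ℝ)⁻¹ :=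
        (Finset.sum_fiberwise_of_maps_to hmaps _).symm
    _ ≤ ∑ k ∈ Finset.Icc a m, 4 * (k : ℝ)⁻¹ := by
        refine Finset.sum_le_sum fun k hk => ?_
        rw [Finset.mem_Icc] at hk
        refine (sum_inv_le_of_log_eq (fun p hp => hP p (Finset.mem_filter.1 hp).1) (ha1.trans hk.1)
          fun p hp => (Finset.mem_filter.1 hp).2).trans_eq ?_
        rw [div_eq_mul_inv]
    _ ≤ 4 * (1 + Real.log (m / a)) := by
        rw [← Finset.mul_sum]
        exact mul_le_mul_of_nonneg_left (sum_Icc_inv_le ha1 ham) (by norm_num)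
    _ ≤ 4 * (1 + Real.log (2 * (Real.log x / Real.log y))) := by
        gcongr
        rw [div_le_iff₀ ha0]
        calc (m : ℝ) ≤ Real.log x / Real.log 2 := hm2
          _ = 2 * (Real.log x / Real.log y) * (Real.log y / Real.log 2 / 2) := by field_simp
          _ ≤ _ := by gcongr
    _ ≤ _ := by
        rw [Real.log_mul two_ne_zero (by positivity)]
        have := Real.log_two_lt_d9
        linarith

/-- The tail of the prime zeta function just to the right of `1`. -/
theorem sum_prime_rpow_le {P : Finset ℕ} (hP : ∀ p ∈ P, p.Prime) {x δ : ℝ} (hx : 2 ≤ x) (hδ : 0 < δ) (hδ1 : δ ≤ 1)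
    (hPx : ∀ p ∈ P, x ≤ p) : ∑ p ∈ P, (p : ℝ) ^ (-(1 + δ)) ≤ 12 / (δ * Real.log x) := by
  have hlog2 : 0 < Real.log 2 := Real.log_pos one_lt_two
  have hlogx : 0 < Real.log x := Real.log_pos (by linarith)
  set a := ⌊Real.log x / Real.log 2⌋₊ with ha
  have hu : 1 ≤ Real.log x / Real.log 2 := by
    rw [le_div_iff₀ hlog2, one_mul]; exact Real.log_le_log two_pos hx
  have ha1 : 1 ≤ a := Nat.le_floor (by exact_mod_cast hu)
  have ha0 : (0:ℝ) < a := by exact_mod_cast ha1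
  have ha2 : Real.log x / Real.log 2 / 2 ≤ a := by
    have := Nat.lt_floor_add_one (Real.log x / Real.log 2)
    have : (1:ℝ) ≤ a := by exact_mod_cast ha1
    linarith
  set m := P.sup id with hm
  have hmaps : ∀ p ∈ P, Nat.log 2 p ∈ Finset.Icc a m := by
    intro p hp
    have hp0 : (0:ℝ) < p := by exact_mod_cast (hP p hp).pos
    rw [Finset.mem_Icc]
    constructor
    · refine Nat.le_log_of_pow_le one_lt_two ?_
      have h1 : Real.log ((2:ℝ) ^ a) ≤ Real.log p := by
        rw [Real.log_pow]
        have := Nat.floor_le (show 0 ≤ Real.log x / Real.log 2 by positivity)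
        rw [le_div_iff₀ hlog2] at this
        exact this.trans (Real.log_le_log (by linarith) (hPx p hp))
      have := (Real.log_le_log_iff (by positivity) hp0).1 h1
      exact_mod_cast this
    · exact (Nat.log_le_self 2 p).trans (Finset.le_sup (f := id) hp)
  set r : ℝ := 2 ^ (-δ) with hr
  have hr0 : 0 < r := by positivity
  have hr1 : r ≤ 1 - δ / 2 := by
    have := rpow_one_add_le_one_add_mul_self (s := -(1/2)) (by norm_num) hδ.le hδ1
    calc r = (1 + -(1/2)) ^ δ := by
          rw [hr, Real.rpow_neg two_pos.le, ← Real.inv_rpow two_pos.le]; norm_num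
      _ ≤ _ := by linarith
  have hr2 : r < 1 := by linarith
  calc ∑ p ∈ P, (p : ℝ) ^ (-(1 + δ))
      = ∑ k ∈ Finset.Icc a m, ∑ p ∈ P with Nat.log 2 p = k, (p : ℝ) ^ (-(1 + δ)) :=
        (Finset.sum_fiberwise_of_maps_to hmaps _).symm
    _ ≤ ∑ k ∈ Finset.Icc a m, 4 / a * r ^ k := by
        refine Finset.sum_le_sum fun k hk => ?_
        rw [Finset.mem_Icc] at hk
        have hk0 : (0:ℝ) < k := by exact_mod_cast (ha1.trans hk.1)
        have h1 : ∀ p ∈ P.filter (fun p => Nat.log 2 p = k), (p : ℝ) ^ (-(1 + δ)) ≤ (p : ℝ)⁻¹ * r ^ k := by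
          intro p hp
          rw [Finset.mem_filter] at hp
          have hp0 : (0:ℝ) < p := by exact_mod_cast (hP p hp.1).pos
          rw [neg_add, Real.rpow_add hp0, Real.rpow_neg_one]
          refine mul_le_mul_of_nonneg_left ?_ (by positivity)
          rw [hr, ← Real.rpow_natCast, ← Real.rpow_mul two_pos.le, mul_comm, Real.rpow_mul two_pos.le, Real.rpow_natCast]
          refine Real.rpow_le_rpow_of_nonpos (by positivity) ?_ (by linarith)
          have := Nat.pow_log_le_self 2 (hP p hp.1).ne_zero
          rw [hp.2] at this
          exact_mod_cast this
        refine (Finset.sum_le_sum h1).trans ?_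
        rw [← Finset.sum_mul]
        refine mul_le_mul_of_nonneg_right ?_ (by positivity)
        refine (sum_inv_le_of_log_eq (fun p hp => hP p (Finset.mem_filter.1 hp).1) (ha1.trans hk.1)
          fun p hp => (Finset.mem_filter.1 hp).2).trans ?_
        have : (a : ℝ) ≤ k := by exact_mod_cast hk.1
        gcongr
    _ ≤ 4 / a * (1 - r)⁻¹ := by
        rw [← Finset.mul_sum]
        gcongr
        exact sum_le_hasSum _ (fun k _ => by positivity) (hasSum_geometric_of_lt_one hr0.le hr2)
    _ ≤ 4 / (Real.log x / Real.log 2 / 2) * (δ / 2)⁻¹ := by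
        gcongr
        linarith
    _ = 16 * Real.log 2 / (δ * Real.log x) := by field_simp; ring
    _ ≤ _ := by
        have := Real.log_two_lt_d9
        gcongr
        linarith

/-- The upper half of Mertens' third theorem: the inverse of the product dominates the harmonic sum. -/
theorem prod_one_sub_inv_prime_le (N : ℕ) (hN : 2 ≤ N) :
    ∏ p ∈ N.primesBelow, (1 - (p : ℝ)⁻¹) ≤ (Real.log N)⁻¹ := by
  have hpos : 0 < Real.log N := Real.log_pos (by exact_mod_cast hN)
  have h1 := sum_prod_primeFactors_mul_rpow_le (g := fun _ => 1) (fun _ => zero_le_one) one_pos N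
  have h2 : Real.log N ≤ ∑ n ∈ Finset.Ico 1 N, (∏ p ∈ n.primeFactors, (1:ℝ)) * (n : ℝ) ^ (-1:ℝ) := by
    have := log_add_one_le_harmonic (N - 1)
    rw [harmonic_eq_sum_Icc] at this
    have e1 : ((N - 1 : ℕ) : ℝ) + 1 = N := by exact_mod_cast Nat.sub_add_cancel (by omega : 1 ≤ N)
    push_cast at this e1
    rw [e1] at this
    refine this.trans (le_of_eq ?_)
    refine Finset.sum_congr ?_ fun n hn => ?_
    · ext n; simp only [Finset.mem_Icc, Finset.mem_Ico]; omega
    · rw [Finset.prod_const_one, one_mul, Real.rpow_neg_one]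
  have h3 : ∏ p ∈ N.primesBelow, (1 + 1 / ((p : ℝ) ^ (1:ℝ) - 1)) = (∏ p ∈ N.primesBelow, (1 - (p : ℝ)⁻¹))⁻¹ := by
    rw [← Finset.prod_inv_distrib]
    refine Finset.prod_congr rfl fun p hp => ?_
    have hp1 : (1:ℝ) < p := by exact_mod_cast (Nat.prime_of_mem_primesBelow hp).one_lt
    have : (p : ℝ) - 1 ≠ 0 := by linarith
    rw [Real.rpow_one]
    field_simp
    ring
  have h4 : 0 < ∏ p ∈ N.primesBelow, (1 - (p : ℝ)⁻¹) := by
    refine Finset.prod_pos fun p hp => ?_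
    have hp1 : (1:ℝ) < p := by exact_mod_cast (Nat.prime_of_mem_primesBelow hp).one_lt
    have := inv_lt_one_of_one_lt₀ hp1
    linarith
  rw [h3] at h1
  exact (le_inv_comm₀ hpos h4).1 (h2.trans h1)

theorem inv_rpow_sub_one_le {p : ℕ} (hp : p.Prime) {s : ℝ} (hs : 1 ≤ s) :
    1 / ((p : ℝ) ^ s - 1) ≤ (p : ℝ)⁻¹ + 2 * (p : ℝ)⁻¹ ^ 2 := by
  have hp2 : (2:ℝ) ≤ p := by exact_mod_cast hp.two_le
  have h1 : (p : ℝ) ≤ (p : ℝ) ^ s := by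
    conv_lhs => rw [← Real.rpow_one (p : ℝ)]
    exact Real.rpow_le_rpow_of_exponent_le (by linarith) hs
  calc 1 / ((p : ℝ) ^ s - 1) ≤ 1 / (p - 1) := by
        apply one_div_le_one_div_of_le <;> linarith
    _ ≤ _ := by
        rw [div_le_iff₀ (by linarith)]
        have : (p:ℝ)⁻¹ * p = 1 := inv_mul_cancel₀ (by linarith)
        have h0 : 0 < (p:ℝ)⁻¹ := by positivity
        have h2 : (p:ℝ)⁻¹ ≤ 1 / 2 := by rw [inv_le_comm₀ (by linarith) (by norm_num)]; linarith
        nlinarith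

theorem sum_inv_rpow_sub_one_le {P : Finset ℕ} (hP : ∀ p ∈ P, p.Prime) {s : ℝ} (hs : 1 ≤ s) :
    ∑ p ∈ P, 1 / ((p : ℝ) ^ s - 1) ≤ ∑ p ∈ P, (p : ℝ)⁻¹ + 4 := by
  have h := sum_inv_sq_le P
  calc ∑ p ∈ P, 1 / ((p : ℝ) ^ s - 1) ≤ ∑ p ∈ P, ((p : ℝ)⁻¹ + 2 * (p : ℝ)⁻¹ ^ 2) :=
        Finset.sum_le_sum fun p hp => inv_rpow_sub_one_le (hP p hp) hs
    _ = ∑ p ∈ P, (p : ℝ)⁻¹ + 2 * ∑ p ∈ P, (p : ℝ)⁻¹ ^ 2 := by rw [Finset.sum_add_distrib, Finset.mul_sum]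
    _ ≤ _ := by linarith

theorem sum_inv_rpow_sub_one_tail_le {P : Finset ℕ} (hP : ∀ p ∈ P, p.Prime) {x δ : ℝ} (hx : 2 ≤ x) (hδ : 0 < δ)
    (hδ1 : δ ≤ 1) (hPx : ∀ p ∈ P, x ≤ p) : ∑ p ∈ P, 1 / ((p : ℝ) ^ (1 + δ) - 1) ≤ 24 / (δ * Real.log x) := by
  calc ∑ p ∈ P, 1 / ((p : ℝ) ^ (1 + δ) - 1) ≤ ∑ p ∈ P, 2 * (p : ℝ) ^ (-(1 + δ)) := by
        refine Finset.sum_le_sum fun p hp => ?_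
        have hp2 : (2:ℝ) ≤ p := by exact_mod_cast (hP p hp).two_le
        have h1 : (p : ℝ) ≤ (p : ℝ) ^ (1 + δ) := by
          conv_lhs => rw [← Real.rpow_one (p : ℝ)]
          exact Real.rpow_le_rpow_of_exponent_le (by linarith) (by linarith)
        rw [Real.rpow_neg (by linarith), ← div_eq_mul_inv, div_le_div_iff₀ (by linarith) (by linarith)]
        linarith
    _ = 2 * ∑ p ∈ P, (p : ℝ) ^ (-(1 + δ)) := by rw [Finset.mul_sum]
    _ ≤ 2 * (12 / (δ * Real.log x)) := by gcongr; exact sum_prime_rpow_le hP hx hδ hδ1 hPx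
    _ = _ := by ring

end PrimeSums

/-! ### The Dirichlet coefficients of `ζ M` in mean square -/

section MollifierL2

variable {P₁ P₂ : Finset ℕ}

theorem sum_pow_card_mul_pow_card_le (h : Disjoint P₁ P₂) (hP₁ : ∀ p ∈ P₁, p.Prime) (hP₂ : ∀ p ∈ P₂, p.Prime)
    {s R w₁ w₂ : ℝ} (hs : 0 < s)
    (hR : ∀ P : Finset ℕ, (∀ p ∈ P, p.Prime ∧ p ∉ P₁ ∧ p ∉ P₂) → ∑ p ∈ P, 1 / ((p : ℝ) ^ s - 1) ≤ R)
    (hw₁ : 0 ≤ w₁) (hw₂ : 0 ≤ w₂) (N : ℕ) :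
    ∑ n ∈ Finset.Ico 1 N, w₁ ^ (P₁ ∩ n.primeFactors).card * w₂ ^ (P₂ ∩ n.primeFactors).card * (n : ℝ) ^ (-s) ≤
      Real.exp (R + w₁ * ∑ p ∈ P₁, 1 / ((p : ℝ) ^ s - 1) + w₂ * ∑ p ∈ P₂, 1 / ((p : ℝ) ^ s - 1)) := by
  set g : ℕ → ℝ := fun p => (if p ∈ P₁ then w₁ else 1) * (if p ∈ P₂ then w₂ else 1) with hg
  have hg0 : ∀ p, 0 ≤ g p := fun p => by
    simp only [hg]; split_ifs <;> positivity
  have e : ∀ n : ℕ, w₁ ^ (P₁ ∩ n.primeFactors).card * w₂ ^ (P₂ ∩ n.primeFactors).card =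
      ∏ p ∈ n.primeFactors, g p := fun n => by
    simp only [hg]
    rw [Finset.prod_mul_distrib, Finset.prod_ite, Finset.prod_ite]
    simp only [Finset.prod_const, one_pow, mul_one, Finset.filter_mem_eq_inter, Finset.inter_comm]
  simp only [e]
  refine (sum_prod_primeFactors_mul_rpow_le_exp hg0 hs N).trans (Real.exp_le_exp.2 ?_)
  have hterm : ∀ {p : ℕ}, p.Prime → 0 ≤ 1 / ((p : ℝ) ^ s - 1) := fun {p} hp => by
    have h1 : (1:ℝ) < p := by exact_mod_cast hp.one_lt
    have h2 := Real.one_lt_rpow h1 hs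
    exact div_nonneg zero_le_one (by linarith)
  set B := N.primesBelow with hB
  have hBp : ∀ p ∈ B, p.Prime := fun p hp => Nat.prime_of_mem_primesBelow hp
  have hle : ∀ p ∈ B, g p / ((p : ℝ) ^ s - 1) ≤
      (if p ∉ P₁ ∧ p ∉ P₂ then 1 / ((p : ℝ) ^ s - 1) else 0) +
      (if p ∈ P₁ then w₁ * (1 / ((p : ℝ) ^ s - 1)) else 0) + (if p ∈ P₂ then w₂ * (1 / ((p : ℝ) ^ s - 1)) else 0) := by
    intro p hp
    rw [Finset.disjoint_left] at h
    by_cases h1 : p ∈ P₁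
    · have h2 := h h1
      simp only [hg, h1, h2, if_true, if_false, not_true, not_false_eq_true, false_and]
      apply le_of_eq; ring
    · by_cases h2 : p ∈ P₂
      · simp only [hg, h1, h2, if_true, if_false, not_true, not_false_eq_true, and_false]
        apply le_of_eq; ring
      · simp only [hg, h1, h2, if_false, not_false_eq_true, and_self, if_true]
        apply le_of_eq; ring
  refine (Finset.sum_le_sum hle).trans ?_
  have hsub : ∀ {P : Finset ℕ} {w : ℝ}, (∀ p ∈ P, p.Prime) → 0 ≤ w →
      ∑ p ∈ B, (if p ∈ P then w * (1 / ((p : ℝ) ^ s - 1)) else 0) ≤ w * ∑ p ∈ P, 1 / ((p : ℝ) ^ s - 1) := by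
    intro P w hP hw
    rw [← Finset.sum_filter, Finset.mul_sum]
    refine Finset.sum_le_sum_of_subset_of_nonneg (fun p hp => (Finset.mem_filter.1 hp).2) fun p hp _ =>
      mul_nonneg hw (hterm (hP p hp))
  rw [Finset.sum_add_distrib, Finset.sum_add_distrib]
  refine add_le_add (add_le_add ?_ (hsub hP₁ hw₁)) (hsub hP₂ hw₂)
  rw [← Finset.sum_filter]
  exact hR _ fun p hp => ⟨hBp p (Finset.mem_filter.1 hp).1, (Finset.mem_filter.1 hp).2⟩

/-- The coefficients at `n ≥ 2` of the Dirichlet series `ζ M` are small in mean square. A coefficient is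
nonzero only if in each of the two ranges `n` has no prime factor or more of them than the truncation
allows. -/
theorem sum_divisorSum_sq_mul_rpow_le (h : Disjoint P₁ P₂) (hP₁ : ∀ p ∈ P₁, p.Prime) (hP₂ : ∀ p ∈ P₂, p.Prime)
    {K₁ K₂ : ℕ} {κ₁ κ₂ : ℝ} (hκ₁ : κ₁ ≤ K₁ + 1) (hκ₂ : κ₂ ≤ K₂ + 1) {s R : ℝ} (hs : 0 < s)
    (hR : ∀ P : Finset ℕ, (∀ p ∈ P, p.Prime ∧ p ∉ P₁ ∧ p ∉ P₂) → ∑ p ∈ P, 1 / ((p : ℝ) ^ s - 1) ≤ R) (N : ℕ) :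
    ∑ n ∈ Finset.Ico 2 N, divisorSum (mollifierIndex P₁ P₂ K₁ K₂) mollifierArg mollifierSign n ^ 2 *
      (n : ℝ) ^ (-s) ≤
      Real.exp R * (1 + Real.exp (-κ₁ + 4 * Real.exp 1 * ∑ p ∈ P₁, 1 / ((p : ℝ) ^ s - 1))) *
        (1 + Real.exp (-κ₂ + 4 * Real.exp 1 * ∑ p ∈ P₂, 1 / ((p : ℝ) ^ s - 1))) - 1 := by
  set S₁ := ∑ p ∈ P₁, 1 / ((p : ℝ) ^ s - 1) with hS₁
  set S₂ := ∑ p ∈ P₂, 1 / ((p : ℝ) ^ s - 1) with hS₂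
  set w := 4 * Real.exp 1 with hw
  have hw0 : 0 ≤ w := by positivity
  set F : ℕ → ℝ := fun n => divisorSum (mollifierIndex P₁ P₂ K₁ K₂) mollifierArg mollifierSign n ^ 2 *
      (n : ℝ) ^ (-s) with hF
  have hR0 : 0 ≤ R := by simpa using hR ∅ (by simp)
  rcases Nat.lt_or_ge N 2 with hN | hN
  · rw [Finset.Ico_eq_empty (by omega), Finset.sum_empty, sub_nonneg]
    have h1 := Real.one_le_exp hR0
    have h2 := Real.exp_pos (-κ₁ + w * S₁)
    have h3 := Real.exp_pos (-κ₂ + w * S₂)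
    nlinarith [mul_pos h2 h3, mul_nonneg (sub_nonneg.2 h1) h2.le, mul_nonneg (mul_nonneg (sub_nonneg.2 h1) h2.le) h3.le]
  have hF1 : F 1 = 1 := by
    simp only [hF]
    rw [divisorSum_mollifier_one hP₁ hP₂ h]; simp
  have hsplit : ∑ n ∈ Finset.Ico 1 N, F n = 1 + ∑ n ∈ Finset.Ico 2 N, F n := by
    rw [Finset.sum_eq_sum_Ico_succ_bot (by omega), hF1]
  -- Each factor is an indicator, written as a power of `0`, plus a Rankin majorant; the product has four terms.
  have hbound : ∀ n ∈ Finset.Ico 1 N, F n ≤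
      (0:ℝ) ^ (P₁ ∩ n.primeFactors).card * 0 ^ (P₂ ∩ n.primeFactors).card * (n : ℝ) ^ (-s) +
      Real.exp (-κ₁) * (w ^ (P₁ ∩ n.primeFactors).card * 0 ^ (P₂ ∩ n.primeFactors).card * (n : ℝ) ^ (-s)) +
      Real.exp (-κ₂) * (0 ^ (P₁ ∩ n.primeFactors).card * w ^ (P₂ ∩ n.primeFactors).card * (n : ℝ) ^ (-s)) +
      Real.exp (-κ₁) * Real.exp (-κ₂) *
        (w ^ (P₁ ∩ n.primeFactors).card * w ^ (P₂ ∩ n.primeFactors).card * (n : ℝ) ^ (-s)) := by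
    intro n hn
    rw [Finset.mem_Ico] at hn
    have h1 := sq_sum_truncatedPowerset_le hP₁ hκ₁ (show n ≠ 0 by omega)
    have h2 := sq_sum_truncatedPowerset_le hP₂ hκ₂ (show n ≠ 0 by omega)
    simp only [hF]
    rw [divisorSum_mollifier hP₁ hP₂ h, mul_pow]
    have h3 := mul_le_mul_of_nonneg_right (mul_le_mul h1 h2 (sq_nonneg _) ((sq_nonneg _).trans h1))
      (show 0 ≤ (n : ℝ) ^ (-s) by positivity)
    refine h3.trans (le_of_eq ?_)
    rw [← hw]
    ring
  have hsum := Finset.sum_le_sum hbound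
  rw [hsplit, Finset.sum_add_distrib, Finset.sum_add_distrib, Finset.sum_add_distrib, ← Finset.mul_sum, ← Finset.mul_sum,
    ← Finset.mul_sum] at hsum
  have b1 := sum_pow_card_mul_pow_card_le h hP₁ hP₂ hs hR (le_refl (0:ℝ)) le_rfl N
  have b2 := mul_le_mul_of_nonneg_left (sum_pow_card_mul_pow_card_le h hP₁ hP₂ hs hR hw0 (le_refl (0:ℝ)) N) (Real.exp_pos (-κ₁)).le
  have b3 := mul_le_mul_of_nonneg_left (sum_pow_card_mul_pow_card_le h hP₁ hP₂ hs hR (le_refl (0:ℝ)) hw0 N) (Real.exp_pos (-κ₂)).le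
  have b4 := mul_le_mul_of_nonneg_left (sum_pow_card_mul_pow_card_le h hP₁ hP₂ hs hR hw0 hw0 N)
    (mul_pos (Real.exp_pos (-κ₁)) (Real.exp_pos (-κ₂))).le
  simp only [← hS₁, ← hS₂, zero_mul, add_zero] at b1 b2 b3 b4
  simp only [Real.exp_add] at b1 b2 b3 b4 ⊢
  nlinarith [hsum, b1, b2, b3, b4]

end MollifierL2

/-! ### The mollifier as a Dirichlet polynomial -/

section MollifierAsDirichletPoly

open SelbergCLT

/-- The primes up to `Y`. -/
noncomputable def smallPrimes (T : ℝ) : Finset ℕ := (⌊Y T⌋₊ + 1).primesBelow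

/-- The primes in `(Y, X]`. -/
noncomputable def mediumPrimes (T : ℝ) : Finset ℕ := {p ∈ (⌊X T⌋₊ + 1).primesBelow | Y T < (p : ℕ)}

theorem mem_primesBelow_floor_add_one {x : ℝ} {p : ℕ} :
    p ∈ (⌊x⌋₊ + 1).primesBelow ↔ p.Prime ∧ (p : ℝ) ≤ x := by
  rw [Nat.mem_primesBelow, Nat.lt_succ_iff, and_comm]
  refine and_congr_right fun hp => Nat.le_floor_iff' hp.ne_zero

theorem mem_smallPrimes {T : ℝ} {p : ℕ} : p ∈ smallPrimes T ↔ p.Prime ∧ (p : ℝ) ≤ Y T :=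
  mem_primesBelow_floor_add_one

theorem mem_mediumPrimes {T : ℝ} {p : ℕ} : p ∈ mediumPrimes T ↔ p.Prime ∧ (p : ℝ) ≤ X T ∧ Y T < p := by
  rw [mediumPrimes, Finset.mem_filter, mem_primesBelow_floor_add_one, and_assoc]

theorem disjoint_smallPrimes_mediumPrimes (T : ℝ) : Disjoint (smallPrimes T) (mediumPrimes T) :=
  Finset.disjoint_left.2 fun _ hp hp' => (mem_smallPrimes.1 hp).2.not_gt (mem_mediumPrimes.1 hp').2.2

theorem prime_of_mem_smallPrimes {T : ℝ} : ∀ p ∈ smallPrimes T, p.Prime := fun _ hp => (mem_smallPrimes.1 hp).1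

theorem prime_of_mem_mediumPrimes {T : ℝ} : ∀ p ∈ mediumPrimes T, p.Prime := fun _ hp => (mem_mediumPrimes.1 hp).1

section

variable {P₁ P₂ : Finset ℕ} {K₁ K₂ : ℕ}

theorem primeFactors_mollifierArg (hP₁ : ∀ p ∈ P₁, p.Prime) (hP₂ : ∀ p ∈ P₂, p.Prime) {A : Finset ℕ × Finset ℕ}
    (hA : A ∈ mollifierIndex P₁ P₂ K₁ K₂) : (mollifierArg A).primeFactors = A.1 ∪ A.2 := by
  rw [mem_mollifierIndex] at hA
  exact Nat.primeFactors_prod fun p hp => (Finset.mem_union.1 hp).elim (fun h => hP₁ p (hA.1.1 h)) fun h => hP₂ p (hA.2.1 h)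

theorem mollifierArg_injOn (hP₁ : ∀ p ∈ P₁, p.Prime) (hP₂ : ∀ p ∈ P₂, p.Prime) (h : Disjoint P₁ P₂) :
    Set.InjOn mollifierArg (mollifierIndex P₁ P₂ K₁ K₂ : Set (Finset ℕ × Finset ℕ)) := by
  intro A hA B hB hAB
  rw [Finset.mem_coe] at hA hB
  have e : A.1 ∪ A.2 = B.1 ∪ B.2 := by
    rw [← primeFactors_mollifierArg hP₁ hP₂ hA, ← primeFactors_mollifierArg hP₁ hP₂ hB, hAB]
  rw [mem_mollifierIndex] at hA hB
  have h1 := (union_subset_union_iff_of_disjoint h hA.1.1 hA.2.1 hB.1.1 hB.2.1).1 e.subset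
  have h2 := (union_subset_union_iff_of_disjoint h hB.1.1 hB.2.1 hA.1.1 hA.2.1).1 e.symm.subset
  exact Prod.ext (h1.1.antisymm h2.1) (h1.2.antisymm h2.2)

theorem abs_mollifierSign (A : Finset ℕ × Finset ℕ) : |mollifierSign A| = 1 := by
  simp [mollifierSign, abs_mul, abs_pow]

theorem sum_abs_mollifierSign_le (hP₁ : ∀ p ∈ P₁, p.Prime) (hP₂ : ∀ p ∈ P₂, p.Prime) (h : Disjoint P₁ P₂) {D : ℝ}
    (hD0 : 0 ≤ D) (hD : ∀ A ∈ mollifierIndex P₁ P₂ K₁ K₂, (mollifierArg A : ℝ) ≤ D) :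
    ∑ A ∈ mollifierIndex P₁ P₂ K₁ K₂, |mollifierSign A| ≤ D := by
  have h1 : (mollifierIndex P₁ P₂ K₁ K₂).card ≤ (Finset.Icc 1 ⌊D⌋₊).card := by
    refine Finset.card_le_card_of_injOn mollifierArg (fun A hA => ?_) (mollifierArg_injOn hP₁ hP₂ h)
    rw [Finset.mem_coe] at hA ⊢
    rw [Finset.mem_Icc]
    exact ⟨mollifierArg_pos hP₁ hP₂ hA, Nat.le_floor (hD A hA)⟩
  rw [Nat.card_Icc, Nat.add_sub_cancel] at h1
  simp only [abs_mollifierSign, Finset.sum_const, nsmul_eq_mul, mul_one]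
  exact (Nat.cast_le.2 h1).trans (Nat.floor_le hD0)

theorem mollifierArg_le (h : Disjoint P₁ P₂) {y x : ℝ} (hy : 1 ≤ y)
    (hx : 1 ≤ x) (h1 : ∀ p ∈ P₁, (p : ℝ) ≤ y) (h2 : ∀ p ∈ P₂, (p : ℝ) ≤ x) {A : Finset ℕ × Finset ℕ}
    (hA : A ∈ mollifierIndex P₁ P₂ K₁ K₂) : (mollifierArg A : ℝ) ≤ y ^ K₁ * x ^ K₂ := by
  have key : ∀ {P : Finset ℕ} {z : ℝ} {K : ℕ}, 1 ≤ z → (∀ p ∈ P, (p : ℝ) ≤ z) → P.card ≤ K →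
      ((∏ p ∈ P, p : ℕ) : ℝ) ≤ z ^ K := by
    intro P z K hz hP hK
    push_cast
    calc ∏ p ∈ P, (p : ℝ) ≤ ∏ _p ∈ P, z := Finset.prod_le_prod (fun _ _ => by positivity) hP
      _ = z ^ P.card := by simp
      _ ≤ z ^ K := pow_le_pow_right₀ hz hK
  rw [mollifierArg_eq h hA, Nat.cast_mul]
  rw [mem_mollifierIndex] at hA
  exact mul_le_mul (key hy (fun p hp => h1 p (hA.1.1 hp)) hA.1.2) (key hx (fun p hp => h2 p (hA.2.1 hp)) hA.2.2)
    (by positivity) (by positivity)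

end

theorem bigOmegaBetween_of_squarefree {n : ℕ} (hn : Squarefree n) (y x : ℝ) :
    bigOmegaBetween y x n = (n.primeFactors.filter (fun p : ℕ => y < (p : ℝ) ∧ (p : ℝ) ≤ x)).card := by
  rw [bigOmegaBetween, Finset.card_eq_sum_ones]
  refine Finset.sum_congr rfl fun p hp => ?_
  have hp' := (Finset.mem_filter.1 hp).1
  have h1 := hn.natFactorization_le_one p
  have h2 : n.factorization p ≠ 0 := by
    rw [← Finsupp.mem_support_iff, Nat.support_factorization]; exact hp'
  omega

/-- The mollifier is the Dirichlet polynomial over the squarefree numbers with few prime factors in each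
of the two ranges. -/
theorem M_eq_dirichletPoly {T : ℝ} (h₂ : 0 ≤ log₂ T) (h₃ : 0 ≤ log₃ T) (hYX : Y T ≤ X T) (s : ℂ) :
    M T s = dirichletPoly (mollifierIndex (smallPrimes T) (mediumPrimes T) ⌊100 * log₂ T⌋₊ ⌊100 * log₃ T⌋₊)
      mollifierArg mollifierSign s := by
  set I := mollifierIndex (smallPrimes T) (mediumPrimes T) ⌊100 * log₂ T⌋₊ ⌊100 * log₃ T⌋₊ with hI
  have hinj := mollifierArg_injOn (K₁ := ⌊100 * log₂ T⌋₊) (K₂ := ⌊100 * log₃ T⌋₊) (@prime_of_mem_smallPrimes T)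
    (@prime_of_mem_mediumPrimes T) (disjoint_smallPrimes_mediumPrimes T)
  have hf₂ : ∀ k : ℕ, (k : ℝ) ≤ 100 * log₂ T ↔ k ≤ ⌊100 * log₂ T⌋₊ := fun k => (Nat.le_floor_iff (by positivity)).symm
  have hf₃ : ∀ k : ℕ, (k : ℝ) ≤ 100 * log₃ T ↔ k ≤ ⌊100 * log₃ T⌋₊ := fun k => (Nat.le_floor_iff (by positivity)).symm
  have hout : ∀ n ∉ I.image mollifierArg, (ArithmeticFunction.moebius n : ℂ) * a T n / (n : ℂ) ^ s = 0 := by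
    intro n hn
    by_contra hne
    have hμ : ArithmeticFunction.moebius n ≠ 0 := fun h => hne (by simp [h])
    have ha : a T n ≠ 0 := fun h => hne (by simp [h])
    have hsq : Squarefree n := ArithmeticFunction.moebius_ne_zero_iff_squarefree.mp hμ
    have hc : n ≠ 0 ∧ (∀ p ∈ n.primeFactors, (p : ℝ) ≤ X T) ∧
        (bigOmegaBetween 0 (Y T) n : ℝ) ≤ 100 * log₂ T ∧ (bigOmegaBetween (Y T) (X T) n : ℝ) ≤ 100 * log₃ T := by
      by_contra h; exact ha (if_neg h)
    obtain ⟨hn0, hX, hΩ₁, hΩ₂⟩ := hc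
    rw [bigOmegaBetween_of_squarefree hsq, hf₂] at hΩ₁
    rw [bigOmegaBetween_of_squarefree hsq, hf₃] at hΩ₂
    refine hn (Finset.mem_image.2 ⟨(n.primeFactors.filter (fun p : ℕ => 0 < (p : ℝ) ∧ (p : ℝ) ≤ Y T),
      n.primeFactors.filter (fun p : ℕ => Y T < (p : ℝ) ∧ (p : ℝ) ≤ X T)), ?_, ?_⟩)
    · rw [hI, mem_mollifierIndex]
      refine ⟨⟨fun p hp => ?_, hΩ₁⟩, fun p hp => ?_, hΩ₂⟩
      · rw [Finset.mem_filter] at hp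
        exact mem_smallPrimes.2 ⟨Nat.prime_of_mem_primeFactors hp.1, hp.2.2⟩
      · rw [Finset.mem_filter] at hp
        exact mem_mediumPrimes.2 ⟨Nat.prime_of_mem_primeFactors hp.1, hp.2.2, hp.2.1⟩
    · rw [mollifierArg]
      conv_rhs => rw [← Nat.prod_primeFactors_of_squarefree hsq]
      refine Finset.prod_congr ?_ fun _ _ => rfl
      ext p
      simp only [Finset.mem_union, Finset.mem_filter]
      constructor
      · rintro (h | h) <;> exact h.1
      · intro h
        rcases le_or_gt (p : ℝ) (Y T) with h' | h'
        · exact Or.inl ⟨h, by exact_mod_cast (Nat.prime_of_mem_primeFactors h).pos, h'⟩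
        · exact Or.inr ⟨h, h', hX p h⟩
  rw [M, tsum_eq_sum hout, Finset.sum_image hinj, dirichletPoly]
  refine Finset.sum_congr rfl fun A hA => ?_
  have hpf := primeFactors_mollifierArg (@prime_of_mem_smallPrimes T) (@prime_of_mem_mediumPrimes T) hA
  have hpos := mollifierArg_pos (@prime_of_mem_smallPrimes T) (@prime_of_mem_mediumPrimes T) hA
  rw [hI, mem_mollifierIndex] at hA
  have hdisj : Disjoint A.1 A.2 :=
    Finset.disjoint_of_subset_left hA.1.1 (Finset.disjoint_of_subset_right hA.2.1 (disjoint_smallPrimes_mediumPrimes T))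
  have hprime : ∀ p ∈ A.1 ∪ A.2, p.Prime := fun p hp => (Finset.mem_union.1 hp).elim
    (fun h => prime_of_mem_smallPrimes p (hA.1.1 h)) fun h => prime_of_mem_mediumPrimes p (hA.2.1 h)
  have hsq : Squarefree (mollifierArg A) := by
    rw [mollifierArg]
    refine Finset.squarefree_prod_of_pairwise_isCoprime (fun p hp q hq hpq => ?_) fun p hp => (hprime p hp).squarefree
    exact Nat.coprime_iff_isRelPrime.1 ((Nat.coprime_primes (hprime p hp) (hprime q hq)).2 hpq)
  have hμ : (ArithmeticFunction.moebius (mollifierArg A) : ℂ) = (mollifierSign A : ℂ) := by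
    rw [ArithmeticFunction.moebius_apply_of_squarefree hsq,
      ← (ArithmeticFunction.cardDistinctFactors_eq_cardFactors_iff_squarefree hsq.ne_zero).2 hsq,
      ArithmeticFunction.cardDistinctFactors_apply, ← List.card_toFinset]
    change ((((-1) ^ (mollifierArg A).primeFactors.card : ℤ)) : ℂ) = _
    rw [hpf, Finset.card_union_of_disjoint hdisj, mollifierSign, pow_add]
    push_cast
    rfl
  have ha : a T (mollifierArg A) = 1 := by
    rw [a, if_pos]
    refine ⟨hpos.ne', fun p hp => ?_, ?_, ?_⟩
    · rw [hpf, Finset.mem_union] at hp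
      rcases hp with hp | hp
      · exact (mem_smallPrimes.1 (hA.1.1 hp)).2.trans hYX
      · exact (mem_mediumPrimes.1 (hA.2.1 hp)).2.1
    · rw [bigOmegaBetween_of_squarefree hsq, hf₂, hpf]
      refine le_trans (Finset.card_le_card fun p hp => ?_) hA.1.2
      rw [Finset.mem_filter, Finset.mem_union] at hp
      exact hp.1.resolve_right fun h => (mem_mediumPrimes.1 (hA.2.1 h)).2.2.not_ge hp.2.2
    · rw [bigOmegaBetween_of_squarefree hsq, hf₃, hpf]
      refine le_trans (Finset.card_le_card fun p hp => ?_) hA.2.2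
      rw [Finset.mem_filter, Finset.mem_union] at hp
      exact hp.1.resolve_left fun h => (mem_smallPrimes.1 (hA.1.1 h)).2.not_gt hp.2.1
  rw [hμ, ha, mul_one, Complex.cpow_neg, div_eq_mul_inv, Complex.ofReal_natCast]

end MollifierAsDirichletPoly

/-! ### Asymptotics in `T` -/

section Asymptotics

open SelbergCLT

/-- The size condition under which the explicit estimates below hold. The constant `4000` makes the
length of the mollifier at most `T^{1/20}`. -/
structure IsLargeScale (T : ℝ) : Prop where
  pos : 0 < T
  log_pos : 0 < Real.log T
  log₂_pos : 0 < log₂ T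
  le_log₃ : 4000 ≤ log₃ T

theorem tendsto_log₃_atTop : Tendsto log₃ atTop atTop :=
  Real.tendsto_log_atTop.comp (Real.tendsto_log_atTop.comp Real.tendsto_log_atTop)

theorem eventually_isLargeScale : ∀ᶠ T : ℝ in atTop, IsLargeScale T := by
  filter_upwards [eventually_gt_atTop 0, Real.tendsto_log_atTop.eventually_gt_atTop 0,
    (Real.tendsto_log_atTop.comp Real.tendsto_log_atTop).eventually_gt_atTop 0,
    tendsto_log₃_atTop.eventually_ge_atTop 4000] with T h1 h2 h3 h4
  exact ⟨h1, h2, h3, h4⟩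

theorem two_mul_σ₀ (T : ℝ) : 2 * σ₀ T = 1 + 2 * W T / Real.log T := by
  rw [σ₀]; ring

namespace IsLargeScale

variable {T : ℝ} (h : IsLargeScale T)
include h

theorem log₂_eq : log₂ T = Real.exp (log₃ T) := (Real.exp_log h.log₂_pos).symm

theorem log_eq : Real.log T = Real.exp (log₂ T) := (Real.exp_log h.log_pos).symm

theorem log₃_sq_le : 2 * log₃ T ^ 2 ≤ log₂ T := by
  have hu := h.le_log₃
  rw [h.log₂_eq]
  have h1 := Real.pow_div_factorial_le_exp (log₃ T) (by linarith) 3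
  have h2 : ((Nat.factorial 3 : ℕ) : ℝ) = 6 := by norm_num [Nat.factorial]
  rw [h2] at h1
  nlinarith [sq_nonneg (log₃ T)]

theorem log₃_le_log₂ : log₃ T ≤ log₂ T := by
  have := h.log₃_sq_le
  have := h.le_log₃
  nlinarith

theorem log₂_sq_le : log₂ T ^ 2 ≤ Real.log T := by
  have hu := h.le_log₃.trans h.log₃_le_log₂
  rw [h.log_eq]
  have h1 := Real.pow_div_factorial_le_exp (log₂ T) (by linarith) 3
  have h2 : ((Nat.factorial 3 : ℕ) : ℝ) = 6 := by norm_num [Nat.factorial]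
  rw [h2] at h1
  nlinarith [sq_nonneg (log₂ T)]

theorem log₂_le_log : log₂ T ≤ Real.log T := by
  have := h.log₂_sq_le
  have := h.le_log₃.trans h.log₃_le_log₂
  nlinarith

theorem log_Y : Real.log (Y T) = Real.log T / log₂ T ^ 2 := by
  rw [Y, Real.log_rpow h.pos, one_div, inv_mul_eq_div]

theorem log_X : Real.log (X T) = Real.log T / log₃ T ^ 2 := by
  rw [X, Real.log_rpow h.pos, one_div, inv_mul_eq_div]

theorem Y_pos : 0 < Y T := Real.rpow_pos_of_pos h.pos _

theorem X_pos : 0 < X T := Real.rpow_pos_of_pos h.pos _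

theorem one_le_log_Y : 1 ≤ Real.log (Y T) := by
  rw [h.log_Y, le_div_iff₀ (pow_pos h.log₂_pos 2), one_mul]
  exact h.log₂_sq_le

theorem two_le_Y : 2 ≤ Y T := by
  have h1 := (Real.le_log_iff_exp_le h.Y_pos).1 h.one_le_log_Y
  have := Real.exp_one_gt_d9
  linarith

theorem Y_le_X : Y T ≤ X T := by
  have hu := h.le_log₃
  refine (Real.log_le_log_iff h.Y_pos h.X_pos).1 ?_
  rw [h.log_Y, h.log_X]
  have := h.log₃_le_log₂
  have := h.log_pos
  gcongr

theorem sum_inv_smallPrimes_le : ∑ p ∈ smallPrimes T, (p : ℝ)⁻¹ ≤ 4 * log₂ T + 10 := by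
  have hL := h.log_pos
  have hl : 0 < Real.log 2 := Real.log_pos one_lt_two
  refine (sum_inv_prime_le (prime_of_mem_smallPrimes (T := T)) le_rfl h.two_le_Y
    (fun p hp => by exact_mod_cast (prime_of_mem_smallPrimes p hp).two_le) fun p hp => (mem_smallPrimes.1 hp).2).trans ?_
  have hY1 := h.one_le_log_Y
  have h1 : Real.log (Y T) / Real.log 2 ≤ Real.log T * (3 / 2) := by
    have h2 : Real.log (Y T) ≤ Real.log T := by
      rw [h.log_Y]
      refine div_le_self hL.le (one_le_pow₀ ?_)
      linarith [h.le_log₃, h.log₃_le_log₂]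
    rw [div_le_iff₀ hl]
    have := Real.log_two_gt_d9
    nlinarith
  have h3 := Real.log_le_log (by positivity) h1
  rw [Real.log_mul hL.ne' (by norm_num)] at h3
  have h4 := Real.log_le_sub_one_of_pos (show (0:ℝ) < 3 / 2 by norm_num)
  have h5 : Real.log (Real.log T) = log₂ T := rfl
  linarith

theorem sum_inv_mediumPrimes_le : ∑ p ∈ mediumPrimes T, (p : ℝ)⁻¹ ≤ 8 * log₃ T + 8 := by
  have hL := h.log_pos
  have hu := h.le_log₃
  have hl2 := h.log₂_pos
  refine (sum_inv_prime_le (prime_of_mem_mediumPrimes (T := T)) h.two_le_Y h.Y_le_X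
    (fun p hp => (mem_mediumPrimes.1 hp).2.2.le) fun p hp => (mem_mediumPrimes.1 hp).2.1).trans ?_
  have h1 : Real.log (X T) / Real.log (Y T) ≤ log₂ T ^ 2 := by
    rw [h.log_X, h.log_Y, div_div_div_cancel_left' _ _ hL.ne']
    exact div_le_self (by positivity) (one_le_pow₀ (by linarith))
  have hX : 0 < Real.log (X T) := by rw [h.log_X]; positivity
  have h3 := Real.log_le_log (div_pos hX (by linarith [h.one_le_log_Y])) h1
  rw [Real.log_pow] at h3
  have h5 : Real.log (log₂ T) = log₃ T := rfl
  rw [h5] at h3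
  push_cast at h3
  linarith

theorem sieveForm_smallPrimes_le : sieveForm (smallPrimes T) ⌊100 * log₂ T⌋₊ ≤
    (2 * Real.exp 8 + 2 * Real.exp 200) * (log₂ T ^ 2 / Real.log T) := by
  have hL := h.log_pos
  have hl2 := h.log₂_pos
  have h40 := h.le_log₃.trans h.log₃_le_log₂
  have h1 := sieveForm_le (prime_of_mem_smallPrimes (T := T)) (Nat.lt_floor_add_one (100 * log₂ T)).le
  have h2 : ∏ p ∈ smallPrimes T, (1 - (p : ℝ)⁻¹) ≤ log₂ T ^ 2 / Real.log T := by
    have h3 := prod_one_sub_inv_prime_le (⌊Y T⌋₊ + 1) (by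
      have : 1 ≤ ⌊Y T⌋₊ := Nat.le_floor (by exact_mod_cast (by linarith [h.two_le_Y] : (1:ℝ) ≤ Y T))
      omega)
    refine h3.trans ?_
    rw [← inv_div, ← h.log_Y]
    refine inv_anti₀ (by linarith [h.one_le_log_Y]) (Real.log_le_log h.Y_pos ?_)
    push_cast
    exact (Nat.lt_floor_add_one _).le
  have h4 : Real.exp (-2 * (100 * log₂ T)) * Real.exp (20 * ∑ p ∈ smallPrimes T, (p : ℝ)⁻¹) ≤
      Real.exp 200 * (log₂ T ^ 2 / Real.log T) := by
    have h5 := h.sum_inv_smallPrimes_le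
    calc _ = Real.exp (-2 * (100 * log₂ T) + 20 * ∑ p ∈ smallPrimes T, (p : ℝ)⁻¹) := (Real.exp_add _ _).symm
      _ ≤ Real.exp (200 + -log₂ T) := Real.exp_le_exp.2 (by linarith)
      _ = Real.exp 200 * (1 / Real.log T) := by rw [Real.exp_add, Real.exp_neg, h.log_eq, one_div]
      _ ≤ _ := by
        gcongr
        exact one_le_pow₀ (by linarith)
  have h5 := Real.exp_pos 8
  nlinarith [mul_le_mul_of_nonneg_left h2 h5.le]

theorem sieveForm_mediumPrimes_le : sieveForm (mediumPrimes T) ⌊100 * log₃ T⌋₊ ≤ Real.exp (32 * log₃ T + 32) := by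
  refine (sieveForm_le_exp (prime_of_mem_mediumPrimes (T := T)) _).trans (Real.exp_le_exp.2 ?_)
  linarith [h.sum_inv_mediumPrimes_le]

theorem four_mul_W_le : 4 * W T ≤ Real.log T := by
  have h1 := h.log₃_sq_le
  have h2 := h.log₂_sq_le
  have h3 := pow_le_pow_left₀ (by positivity) h1 2
  rw [W]
  nlinarith

theorem W_pos : 0 < W T := by
  have := h.le_log₃
  rw [W]; positivity

theorem sum_divisorSum_sq_le (N : ℕ) :
    ∑ n ∈ Finset.Ico 2 N, divisorSum (mollifierIndex (smallPrimes T) (mediumPrimes T) ⌊100 * log₂ T⌋₊ ⌊100 * log₃ T⌋₊)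
      mollifierArg mollifierSign n ^ 2 * (n : ℝ) ^ (-2 * σ₀ T) ≤
      Real.exp (12 / log₃ T ^ 2) * (1 + Real.exp (170 - 12 * log₃ T)) ^ 2 - 1 := by
  have hL := h.log_pos
  have hu := h.le_log₃
  have hl2 := h.log₂_pos
  have hW := h.W_pos
  set δ := 2 * W T / Real.log T with hδ
  have hδ0 : 0 < δ := by positivity
  have hδ1 : δ ≤ 1 := by
    rw [hδ, div_le_one hL]; linarith [h.four_mul_W_le]
  have hX2 : 2 ≤ X T := h.two_le_Y.trans h.Y_le_X
  have hR : ∀ P : Finset ℕ, (∀ p ∈ P, p.Prime ∧ p ∉ smallPrimes T ∧ p ∉ mediumPrimes T) →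
      ∑ p ∈ P, 1 / ((p : ℝ) ^ (1 + δ) - 1) ≤ 12 / log₃ T ^ 2 := by
    intro P hP
    refine (sum_inv_rpow_sub_one_tail_le (fun p hp => (hP p hp).1) hX2 hδ0 hδ1 fun p hp => ?_).trans (le_of_eq ?_)
    · obtain ⟨hp1, hp2, hp3⟩ := hP p hp
      rw [mem_smallPrimes, not_and, not_le] at hp2
      by_contra hlt
      exact hp3 (mem_mediumPrimes.2 ⟨hp1, (not_le.1 hlt).le, hp2 hp1⟩)
    · rw [h.log_X, hδ, W]
      have : log₃ T ≠ 0 := by linarith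
      field_simp
      norm_num
  have key := sum_divisorSum_sq_mul_rpow_le (disjoint_smallPrimes_mediumPrimes T) (prime_of_mem_smallPrimes (T := T))
    (prime_of_mem_mediumPrimes (T := T)) (Nat.lt_floor_add_one (100 * log₂ T)).le (Nat.lt_floor_add_one (100 * log₃ T)).le
    (show 0 < 1 + δ by positivity) hR N
  have e : -2 * σ₀ T = -(1 + δ) := by rw [hδ]; linarith [two_mul_σ₀ T]
  rw [e]
  refine key.trans ?_
  -- With `4 e < 10.9`, the exponents `4 · 10.9` and `8 · 10.9` of the two Rankin majorants stay below `100`.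
  have hexp := Real.exp_one_lt_d9
  have hexp0 := Real.exp_pos 1
  have s1 := (sum_inv_rpow_sub_one_le (prime_of_mem_smallPrimes (T := T)) (show 1 ≤ 1 + δ by linarith)).trans
    (add_le_add_left h.sum_inv_smallPrimes_le 4)
  have s2 := (sum_inv_rpow_sub_one_le (prime_of_mem_mediumPrimes (T := T)) (show 1 ≤ 1 + δ by linarith)).trans
    (add_le_add_left h.sum_inv_mediumPrimes_le 4)
  have b1 : -(100 * log₂ T) + 4 * Real.exp 1 * ∑ p ∈ smallPrimes T, 1 / ((p : ℝ) ^ (1 + δ) - 1) ≤ 170 - 12 * log₃ T := by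
    have := mul_le_mul_of_nonneg_left s1 (show 0 ≤ 4 * Real.exp 1 by positivity)
    have h2 : 4 * Real.exp 1 * (4 * log₂ T + 10 + 4) ≤ 10.9 * (4 * log₂ T + 10 + 4) := by
      refine mul_le_mul_of_nonneg_right (by linarith) (by positivity)
    have := h.log₃_le_log₂
    linarith
  have b2 : -(100 * log₃ T) + 4 * Real.exp 1 * ∑ p ∈ mediumPrimes T, 1 / ((p : ℝ) ^ (1 + δ) - 1) ≤ 170 - 12 * log₃ T := by
    have := mul_le_mul_of_nonneg_left s2 (show 0 ≤ 4 * Real.exp 1 by positivity)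
    have h2 : 4 * Real.exp 1 * (8 * log₃ T + 8 + 4) ≤ 10.9 * (8 * log₃ T + 8 + 4) := by
      refine mul_le_mul_of_nonneg_right (by linarith) (by positivity)
    linarith
  rw [sq (1 + _), ← mul_assoc]
  gcongr

theorem mollifierArg_le_exp {A : Finset ℕ × Finset ℕ}
    (hA : A ∈ mollifierIndex (smallPrimes T) (mediumPrimes T) ⌊100 * log₂ T⌋₊ ⌊100 * log₃ T⌋₊) :
    (mollifierArg A : ℝ) ≤ Real.exp (Real.log T / 20) := by
  have hL := h.log_pos
  have hu := h.le_log₃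
  have hl2 := h.log₂_pos
  have hY := h.two_le_Y
  have hX : 2 ≤ X T := h.two_le_Y.trans h.Y_le_X
  refine (mollifierArg_le (disjoint_smallPrimes_mediumPrimes T) (by linarith) (by linarith : 1 ≤ X T)
    (fun p hp => (mem_smallPrimes.1 hp).2) (fun p hp => (mem_mediumPrimes.1 hp).2.1) hA).trans ?_
  have key : ∀ {z κ : ℝ}, 0 < z → 4000 ≤ κ → Real.log z = Real.log T / κ ^ 2 →
      z ^ ⌊100 * κ⌋₊ ≤ Real.exp (Real.log T / 40) := by
    intro z κ hz hκ hlog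
    have h1 := Nat.floor_le (show 0 ≤ 100 * κ by linarith)
    refine (Real.log_le_iff_le_exp (by positivity)).1 ?_
    rw [Real.log_pow, hlog]
    calc (⌊100 * κ⌋₊ : ℝ) * (Real.log T / κ ^ 2) ≤ 100 * κ * (Real.log T / κ ^ 2) := by gcongr
      _ = Real.log T * (100 / κ) := by field_simp
      _ ≤ Real.log T * (1 / 40) := by
        refine mul_le_mul_of_nonneg_left ?_ hL.le
        rw [div_le_div_iff₀ (by linarith) (by norm_num)]
        linarith
      _ = _ := by ring
  calc Y T ^ ⌊100 * log₂ T⌋₊ * X T ^ ⌊100 * log₃ T⌋₊ ≤ Real.exp (Real.log T / 40) * Real.exp (Real.log T / 40) :=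
        mul_le_mul (key h.Y_pos (hu.trans h.log₃_le_log₂) h.log_Y) (key h.X_pos hu h.log_X) (by positivity) (by positivity)
    _ = _ := by rw [← Real.exp_add]; ring_nf

end IsLargeScale

/-- An explicit rate, as a function of `log log log T`, for the mean square of `1 - ζ M`. -/
noncomputable def meanSquareRate (u : ℝ) : ℝ :=
  288 * Real.pi * (4 * (Real.exp (12 / u ^ 2) * (1 + Real.exp (170 - 12 * u)) ^ 2 - 1) +
    12 * ((2 * Real.exp 8 + 2 * Real.exp 200) * Real.exp (-u)) + 60 * Real.exp (-u))

theorem tendsto_meanSquareRate : Tendsto meanSquareRate atTop (𝓝 0) := by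
  have h1 : Tendsto (fun u : ℝ => 12 / u ^ 2) atTop (𝓝 0) := tendsto_const_nhds.div_atTop (tendsto_pow_atTop two_ne_zero)
  have h2 : Tendsto (fun u : ℝ => Real.exp (12 / u ^ 2)) atTop (𝓝 1) := by
    rw [← Real.exp_zero]
    exact (Real.continuous_exp.tendsto 0).comp h1
  have h3 : Tendsto (fun u : ℝ => Real.exp (170 - 12 * u)) atTop (𝓝 0) := by
    refine Real.tendsto_exp_atBot.comp ?_
    exact tendsto_atBot_add_const_left _ _ (tendsto_neg_atTop_atBot.comp (tendsto_id.const_mul_atTop (by norm_num : (0:ℝ) < 12)))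
  have h4 : Tendsto (fun u : ℝ => Real.exp (-u)) atTop (𝓝 0) := Real.tendsto_exp_neg_atTop_nhds_zero
  have := (((((h2.mul ((h3.const_add 1).pow 2)).sub_const 1).const_mul 4).add
    ((h4.const_mul (2 * Real.exp 8 + 2 * Real.exp 200)).const_mul 12)).add (h4.const_mul 60)).const_mul (288 * Real.pi)
  simp only [add_zero, one_pow, mul_one, sub_self, mul_zero] at this
  exact this

theorem IsLargeScale.lintegral_le {T : ℝ} (h : IsLargeScale T) :
    ∫⁻ t in Set.Icc T (2 * T), ENNReal.ofReal (‖1 - zetaM T t‖ ^ 2) ≤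
      ENNReal.ofReal (T * meanSquareRate (log₃ T)) := by
  have hT := h.pos
  have hL := h.log_pos
  have hu := h.le_log₃
  have hl2 := h.log₂_pos
  have hlu := h.log₃_le_log₂
  have hLl := h.log₂_le_log
  have hW := h.W_pos
  have hσ := two_mul_σ₀ T
  have hWL := h.four_mul_W_le
  have hδ0 : 0 < 2 * W T / Real.log T := by positivity
  have hT16 : 16 ≤ T := by
    have := Real.add_one_le_exp (Real.log T)
    rw [Real.exp_log hT] at this
    linarith
  have hp₁ := prime_of_mem_smallPrimes (T := T)
  have hp₂ := prime_of_mem_mediumPrimes (T := T)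
  have hd := disjoint_smallPrimes_mediumPrimes T
  have hQ := gcdFormBound_mollifier (K₁ := ⌊100 * log₂ T⌋₊) (K₂ := ⌊100 * log₃ T⌋₊) hp₁ hp₂ hd
  have hD : ∀ A ∈ mollifierIndex (smallPrimes T) (mediumPrimes T) ⌊100 * log₂ T⌋₊ ⌊100 * log₃ T⌋₊,
      (mollifierArg A : ℝ) ≤ Real.exp (Real.log T / 20) := fun A hA => h.mollifierArg_le_exp hA
  have key := lintegral_one_sub_zeta_mul_dirichletPoly_sq_le (σ := σ₀ T) (fun A hA => mollifierArg_pos hp₁ hp₂ hA) hD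
    (Real.one_le_exp (by positivity)) (sum_abs_mollifierSign_le hp₁ hp₂ hd (Real.exp_pos _).le hD) hQ hT16
    (by linarith) (by
      have : 2 * W T / Real.log T ≤ 1 / 2 := by
        rw [div_le_iff₀ hL]; linarith
      linarith) hQ.sq_sum_div_le (divisorSum_mollifier_one hp₁ hp₂ hd) h.sum_divisorSum_sq_le
  have hM := M_eq_dirichletPoly hl2.le (by linarith : 0 ≤ log₃ T) h.Y_le_X
  simp only [← hM] at key
  refine key.trans (ENNReal.ofReal_le_ofReal ?_)
  set Q := sieveForm (smallPrimes T) ⌊100 * log₂ T⌋₊ * sieveForm (mediumPrimes T) ⌊100 * log₃ T⌋₊ with hQdef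
  have hTexp : T = Real.exp (Real.log T) := (Real.exp_log hT).symm
  have b1 : Q * T ^ (1 - 2 * σ₀ T) / (2 * σ₀ T - 1) ≤ (2 * Real.exp 8 + 2 * Real.exp 200) * Real.exp (-log₃ T) := by
    have e1 : T ^ (1 - 2 * σ₀ T) = Real.exp (-(2 * W T)) := by
      rw [Real.rpow_def_of_pos hT, hσ]
      congr 1
      field_simp
      ring
    have e2 : 2 * σ₀ T - 1 = 2 * W T / Real.log T := by linarith
    have hQle : Q ≤ (2 * Real.exp 8 + 2 * Real.exp 200) * (log₂ T ^ 2 / Real.log T) * Real.exp (32 * log₃ T + 32) :=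
      mul_le_mul h.sieveForm_smallPrimes_le h.sieveForm_mediumPrimes_le (sieveForm_nonneg _ _) (by positivity)
    rw [e1, e2]
    have hW1 : 1 ≤ 2 * W T := by
      have : 1 ≤ log₃ T ^ 4 := one_le_pow₀ (by linarith)
      rw [W]; linarith
    calc Q * Real.exp (-(2 * W T)) / (2 * W T / Real.log T)
        ≤ (2 * Real.exp 8 + 2 * Real.exp 200) * (log₂ T ^ 2 / Real.log T) * Real.exp (32 * log₃ T + 32) *
          Real.exp (-(2 * W T)) / (1 / Real.log T) := by gcongr
      _ = (2 * Real.exp 8 + 2 * Real.exp 200) * (log₂ T ^ 2 * Real.exp (32 * log₃ T + 32) * Real.exp (-(2 * W T))) := by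
          field_simp
      _ = (2 * Real.exp 8 + 2 * Real.exp 200) * Real.exp (34 * log₃ T + 32 - 2 * W T) := by
          rw [h.log₂_eq, ← Real.exp_nat_mul, ← Real.exp_add, ← Real.exp_add]
          congr 2
          push_cast; ring
      _ ≤ _ := by
          gcongr
          have : 4000 ^ 3 * log₃ T ≤ W T := by
            rw [W, pow_succ _ 3]
            exact mul_le_mul_of_nonneg_right (pow_le_pow_left₀ (by norm_num) hu 3) (by linarith)
          linarith
  have b2 : Real.exp (Real.log T / 20) ^ 2 * Real.exp (Real.log T / 20) ^ 2 * (√T)⁻¹ ≤ Real.exp (-log₃ T) := by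
    have e1 : √T = Real.exp (Real.log T / 2) := by
      rw [Real.exp_half, Real.exp_log hT]
    rw [e1, ← Real.exp_neg, ← Real.exp_nat_mul, ← Real.exp_add, ← Real.exp_add, Real.exp_le_exp]
    push_cast
    have := h.log₂_sq_le
    nlinarith
  rw [meanSquareRate]
  have hpi := Real.pi_pos
  calc _ ≤ 288 * Real.pi * T * (4 * (Real.exp (12 / log₃ T ^ 2) * (1 + Real.exp (170 - 12 * log₃ T)) ^ 2 - 1) +
      12 * ((2 * Real.exp 8 + 2 * Real.exp 200) * Real.exp (-log₃ T)) + 60 * Real.exp (-log₃ T)) := by gcongr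
    _ = _ := by ring

end Asymptotics

/-! ### The mean square and the exceptional set -/

section Conclusion

open SelbergCLT

theorem meanSquareRate_pos (u : ℝ) : 0 < meanSquareRate u := by
  have h1 : 1 ≤ Real.exp (12 / u ^ 2) := Real.one_le_exp (by positivity)
  have h2 : 1 ≤ (1 + Real.exp (170 - 12 * u)) ^ 2 := one_le_pow₀ (by linarith [Real.exp_pos (170 - 12 * u)])
  have h3 : 0 ≤ Real.exp (12 / u ^ 2) * (1 + Real.exp (170 - 12 * u)) ^ 2 - 1 := by nlinarith
  rw [meanSquareRate]
  have := Real.pi_pos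
  positivity

theorem isLittleO_id_of_abs_le_mul {F r : ℝ → ℝ} (hF : ∀ᶠ T in atTop, |F T| ≤ T * r T) (hr : Tendsto r atTop (𝓝 0)) :
    F =o[atTop] fun T => T := by
  have h1 : (fun T => T * r T) =o[atTop] fun T : ℝ => T := by
    simpa using (isBigO_refl (fun T : ℝ => T) atTop).mul_isLittleO ((isLittleO_one_iff ℝ).2 hr)
  refine IsBigO.trans_isLittleO (IsBigO.of_bound 1 ?_) h1
  filter_upwards [hF] with T hT
  rw [Real.norm_eq_abs, one_mul]
  exact hT.trans (le_abs_self _)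

namespace IsLargeScale

variable {T : ℝ}

theorem continuousOn_zetaM (h : IsLargeScale T) : ContinuousOn (zetaM T) (Set.Icc T (2 * T)) := by
  have hline : Continuous fun t : ℝ => (σ₀ T : ℂ) + Complex.I * t := by fun_prop
  have hM : M T = dirichletPoly _ mollifierArg mollifierSign :=
    funext (M_eq_dirichletPoly h.log₂_pos.le (by linarith [h.le_log₃]) h.Y_le_X)
  refine ContinuousOn.mul (fun t ht => ?_) ?_
  · have ht0 : 0 < t := h.pos.trans_le ht.1
    have hne : (σ₀ T : ℂ) + Complex.I * t ≠ 1 := fun e => by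
      have := congrArg Complex.im e
      simp at this
      exact ht0.ne' this
    exact ((differentiableAt_riemannZeta hne).continuousAt.comp (f := fun t : ℝ => (σ₀ T : ℂ) + Complex.I * t)
      hline.continuousAt).continuousWithinAt
  · refine Continuous.continuousOn ?_
    rw [hM]
    unfold dirichletPoly
    refine continuous_finsetSum _ fun A hA => continuous_const.mul ?_
    refine Continuous.const_cpow (by fun_prop) (Or.inl ?_)
    have := mollifierArg_pos (prime_of_mem_smallPrimes (T := T)) prime_of_mem_mediumPrimes hA
    exact_mod_cast this.ne'

theorem continuousOn_norm_one_sub_zetaM_sq (h : IsLargeScale T) :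
    ContinuousOn (fun t => ‖1 - zetaM T t‖ ^ 2) (Set.Icc T (2 * T)) :=
  ((continuousOn_const.sub h.continuousOn_zetaM).norm).pow 2

theorem intervalIntegrable (h : IsLargeScale T) :
    IntervalIntegrable (fun t => ‖1 - zetaM T t‖ ^ 2) volume T (2 * T) := by
  refine ContinuousOn.intervalIntegrable ?_
  rw [Set.uIcc_of_le (by linarith [h.pos])]
  exact h.continuousOn_norm_one_sub_zetaM_sq

theorem abs_integral_le (h : IsLargeScale T) :
    |∫ t in T..(2 * T), ‖1 - zetaM T t‖ ^ 2| ≤ T * meanSquareRate (log₃ T) := by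
  have hT := h.pos
  have hr := meanSquareRate_pos (log₃ T)
  have hle : T ≤ 2 * T := by linarith
  rw [abs_of_nonneg (intervalIntegral.integral_nonneg hle fun t _ => by positivity),
    intervalIntegral.integral_of_le hle, ← integral_Icc_eq_integral_Ioc,
    integral_eq_lintegral_of_nonneg_ae (Eventually.of_forall fun t => by positivity)
      (h.continuousOn_norm_one_sub_zetaM_sq.aestronglyMeasurable measurableSet_Icc)]
  exact ENNReal.toReal_le_of_le_ofReal (by positivity) h.lintegral_le

end IsLargeScale

/-- The points of `[T, 2T]` at which `ζ M` is not close to `1`. -/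
def exceptionalSet (T ε : ℝ) : Set ℝ := {t ∈ Set.Icc T (2 * T) | ε < ‖zetaM T t - 1‖}

theorem IsLargeScale.measurableSet_exceptionalSet {T : ℝ} (h : IsLargeScale T) (ε : ℝ) :
    MeasurableSet (exceptionalSet T ε) := by
  have h1 : IsClosed (Set.Icc T (2 * T) ∩ (fun t => ‖zetaM T t - 1‖) ⁻¹' Set.Iic ε) :=
    ContinuousOn.preimage_isClosed_of_isClosed (h.continuousOn_zetaM.sub continuousOn_const).norm isClosed_Icc isClosed_Iic
  have h2 : exceptionalSet T ε = Set.Icc T (2 * T) \ (Set.Icc T (2 * T) ∩ (fun t => ‖zetaM T t - 1‖) ⁻¹' Set.Iic ε) := by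
    ext t
    simp [exceptionalSet]
  rw [h2]
  exact measurableSet_Icc.diff h1.measurableSet

/-- Chebyshev's inequality for the mean square of `1 - ζ M`. With the fourth root of the rate as threshold,
both the threshold and the relative measure of the exceptional set tend to `0`. -/
theorem IsLargeScale.volume_exceptionalSet_le {T : ℝ} (h : IsLargeScale T) :
    volume.real (exceptionalSet T √√(meanSquareRate (log₃ T))) ≤ T * √(meanSquareRate (log₃ T)) := by
  set r := meanSquareRate (log₃ T) with hrdef
  have hr : 0 < r := meanSquareRate_pos _
  have hT := h.pos
  have hs : 0 < √r := Real.sqrt_pos.2 hr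
  refine ENNReal.toReal_le_of_le_ofReal (by positivity) ?_
  have h1 : ENNReal.ofReal √r * volume (exceptionalSet T √√r) ≤ ENNReal.ofReal √r * ENNReal.ofReal (T * √r) := by
    calc ENNReal.ofReal √r * volume (exceptionalSet T √√r)
        = ∫⁻ _ in exceptionalSet T √√r, ENNReal.ofReal √r := (setLIntegral_const _ _).symm
      _ ≤ ∫⁻ t in exceptionalSet T √√r, ENNReal.ofReal (‖1 - zetaM T t‖ ^ 2) := by
          refine setLIntegral_mono' (h.measurableSet_exceptionalSet _) fun t ht => ENNReal.ofReal_le_ofReal ?_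
          rw [norm_sub_rev]
          calc √r = √√r ^ 2 := (Real.sq_sqrt hs.le).symm
            _ ≤ _ := pow_le_pow_left₀ (Real.sqrt_nonneg _) ht.2.le 2
      _ ≤ ∫⁻ t in Set.Icc T (2 * T), ENNReal.ofReal (‖1 - zetaM T t‖ ^ 2) := lintegral_mono_set fun t ht => ht.1
      _ ≤ ENNReal.ofReal (T * r) := h.lintegral_le
      _ = _ := by
          rw [← ENNReal.ofReal_mul hs.le]
          congr 1
          nth_rewrite 1 [← Real.mul_self_sqrt hr.le]
          ring
  exact (ENNReal.mul_le_mul_iff_right (by simpa using hs) ENNReal.ofReal_ne_top).1 h1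

end Conclusion

theorem proposition4 :
    ((∀ᶠ T : ℝ in atTop,
        IntervalIntegrable (fun t : ℝ => ‖1 - SelbergCLT.zetaM T t‖ ^ 2) volume T (2 * T)) ∧
      (fun T : ℝ => ∫ t in T..(2 * T), ‖1 - SelbergCLT.zetaM T t‖ ^ 2)
        =o[atTop] (fun T : ℝ => T)) ∧
    ∃ (E : ℝ → Set ℝ) (ε : ℝ → ℝ),
      (∀ T : ℝ, MeasurableSet (E T) ∧ E T ⊆ Set.Icc T (2 * T)) ∧
      (fun T : ℝ => volume.real (E T)) =o[atTop] (fun T : ℝ => T) ∧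
      Tendsto ε atTop (𝓝 0) ∧
      ∀ᶠ T : ℝ in atTop, ∀ t ∈ Set.Icc T (2 * T) \ E T, ‖SelbergCLT.zetaM T t - 1‖ ≤ ε T := by
  classical
  have hr : Tendsto (fun T => meanSquareRate (SelbergCLT.log₃ T)) atTop (𝓝 0) :=
    tendsto_meanSquareRate.comp tendsto_log₃_atTop
  have hsqrt : ∀ {f : ℝ → ℝ}, Tendsto f atTop (𝓝 0) → Tendsto (fun T => √(f T)) atTop (𝓝 0) := fun hf => by
    simpa using hf.sqrt
  -- For `T` not large the exceptional set is taken to be empty, as it has to be measurable for every `T`.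
  refine ⟨⟨eventually_isLargeScale.mono fun T h => h.intervalIntegrable,
    isLittleO_id_of_abs_le_mul (eventually_isLargeScale.mono fun T h => h.abs_integral_le) hr⟩,
    fun T => if IsLargeScale T then exceptionalSet T √√(meanSquareRate (SelbergCLT.log₃ T)) else ∅,
    fun T => √√(meanSquareRate (SelbergCLT.log₃ T)), fun T => ?_, ?_, hsqrt (hsqrt hr), ?_⟩
  · by_cases h : IsLargeScale T
    · simp only [if_pos h]
      exact ⟨h.measurableSet_exceptionalSet _, fun t ht => ht.1⟩
    · simp only [if_neg h]
      exact ⟨MeasurableSet.empty, Set.empty_subset _⟩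
  · refine isLittleO_id_of_abs_le_mul (eventually_isLargeScale.mono fun T h => ?_) (hsqrt hr)
    simp only [if_pos h]
    rw [abs_of_nonneg measureReal_nonneg]
    exact h.volume_exceptionalSet_le
  · filter_upwards [eventually_isLargeScale] with T h t ht
    by_contra hlt
    simp only [if_pos h] at ht
    exact ht.2 ⟨ht.1, not_le.1 hlt⟩
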